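/- **Setting.** For each $n$ let $\boldsymbol x_i=\boldsymbol\eta(\boldsymbol\alpha_i)+\boldsymbol u_i\in\mathbb R^p$, $i\in[n]$, $p=p_n$, with random latent variables $\boldsymbol\alpha_i\in\mathbb R^r$ ($r\ge1$) and random latent functions $\boldsymbol\eta=(\eta_1,\dots,\eta_p)$, which generate the $\sigma$-field $\mathscr F$. Put $H_{li}=\eta_l(\boldsymbol\alpha_i)$, $X_{li}=H_{li}+u_{il}$. The rows are split as $[p]=\mathcal R^\dagger\sqcup\mathcal R^\ddagger$ with $p^\dagger=|\mathcal R^\dagger|\asymp p^\ddagger=|\mathcal R^\ddagger|\asymp p$; $X^\dagger,H^\dagger$ are the submatrices with rows in $\mathcal R^\dagger$. Write $a_n\lesssim_{\mathbb P}b_n$ if $\lim_{\varepsilon\to\infty}\limsup_n\mathbb P[|a_n/b_n|\ge\varepsilon]=0$; $s_{\min},s_{\max}$ are the extreme singular values, $\|\cdot\|_{\max}$ is the entrywise sup-norm, and w.p.a.1 means with probability approaching one. *Regularities.* (a) The $\boldsymbol\alpha_i$ are i.i.d. on a compact convex set $\mathcal A$ with a density bounded and bounded away from zero on $\mathcal A$.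 (b) Each $\eta_l$ is $\bar m$ times continuously differentiable on $\mathcal A$, $\bar m\ge2$, with all partial derivatives of order at most $\bar m$ bounded by a universal constant. (c) Conditionally on $\mathscr F$ the $u_{il}$ are independent over $i,l$ with mean zero, and for some $\nu>0$, $\max_{i,l}\mathbb E[|u_{il}|^{2+\nu}|\mathscr F]<\infty$ a.s. *Indirect matching.* For a measurable "distance" $\rho$ between units (a function of two columns, or of the whole matching data and two unit labels), constants $\rho_0\ge0$, $\underline\varsigma,\bar\varsigma>0$ and positive $a_n=o(1)$: $\max_{i\ne j}|\rho(X^\dagger_{\cdot i},X^\dagger_{\cdot j})-\rho(H^\dagger_{\cdot i},H^\dagger_{\cdot j})-\rho_0|\lesssim_{\mathbb P}a_n$, $\ \max_{\boldsymbol\alpha_i\ne\boldsymbol\alpha_j}\rho(H^\dagger_{\cdot i},H^\dagger_{\cdot j})/\|\boldsymbol\alpha_i-\boldsymbol\alpha_j\|^{\bar\varsigma}\lesssim_{\mathbb P}1$, and $\min_{\boldsymbol\alpha_i\ne\boldsymbol\alpha_j}\rho(H^\dagger_{\cdot i},H^\dagger_{\cdot j})/\|\boldsymbol\alpha_i-\boldsymbol\alpha_j\|^{\underline\varsigma}$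 is positive and bounded away from zero in probability ($\gtrsim_{\mathbb P}1$). *Local quantities.* Let $j_1(i),\dots,j_K(i)$ be $K=K_n$ nearest neighbours of unit $i$ (including $i$) for the distance $\rho$ on $X^\dagger$, ties being broken in any measurable way. Let $h_n=(K/n)^{\bar\varsigma/(\underline\varsigma r)}$ and $\delta_n=(K\wedge p)^{1/2}/\sqrt{\log(n\vee p)}$. Let $1\le m\le\bar m$ be fixed and $\mathsf d=\binom{m-1+r}{r}$. Let $H_{\langle i\rangle}=(\eta_l(\boldsymbol\alpha_{j_k(i)}))_{l\in\mathcal R^\ddagger,k\le K}$, and let $\Lambda_{\langle i\rangle}\in\mathbb R^{K\times\mathsf d}$ have $k$th row $\big((\boldsymbol\alpha_{j_k(i)}-\boldsymbol\alpha_i)^{\boldsymbol q}\big)_{|\boldsymbol q|\le m-1}$, the multi-indices $\boldsymbol q$ being listed in any order of nondecreasing degree. Let $\Upsilon=\mathrm{diag}(\upsilon_1,\dots,\upsilon_{\mathsf d})=\mathrm{diag}(h_n^{|\boldsymbol q|})=\mathrm{diag}(1,h_nI_{\ell_1},\dots,h_n^{m-1}I_{\ell_{m-1}})$ with $\ell_j=\binom{r+j-1}{j}$.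 Put $F_{\langle i\rangle}=\mathbb E^\ddagger[H_{\langle i\rangle}\Lambda_{\langle i\rangle}]\,\mathbb E^\ddagger[\Lambda_{\langle i\rangle}'\Lambda_{\langle i\rangle}]^{-1}$ and $\Xi_{\langle i\rangle}=H_{\langle i\rangle}-F_{\langle i\rangle}\Lambda_{\langle i\rangle}'$, where $\mathbb E^\ddagger$ is the expectation conditional on $\mathscr F$ and $X^\dagger$. **Theorem.** Assume the regularity and indirect matching conditions. Let $\mathscr D\eta_l$ be the vector of all partial derivatives $\partial^{\boldsymbol q}\eta_l$, $|\boldsymbol q|\le m-1$, and suppose that for some constant $c>0$, w.p.a.1, for all $i\in[n]$, $$s_{\min}\Big(\tfrac1{p^\ddagger}\sum_{l\in\mathcal R^\ddagger}\mathscr D\eta_l(\boldsymbol\alpha_i)\,\mathscr D\eta_l(\boldsymbol\alpha_i)'\Big)\ge c .$$ If $K/n\to0$, $\delta_n^{-1}/h_n^{m-1}=o(1)$, $a_n^{1/\underline\varsigma}=o(h_n)$ and $\bar\varsigma=\underline\varsigma$, then the local approximation condition holds with $\mathsf d_i=\mathsf d$ for all $i$. That is, $\mathbb E^\ddagger[\Lambda_{\langle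 i\rangle}'\Lambda_{\langle i\rangle}]$ is invertible for all $i$ w.p.a.1, the conditional expectations above being those of integrable variables, and: (a) $\max_i\|\Lambda_{\langle i\rangle}\Upsilon^{-1}\|_{\max}\lesssim_{\mathbb P}1$ and $1\lesssim_{\mathbb P}\min_i s_{\min}\big(\tfrac1K\Upsilon^{-1}\Lambda_{\langle i\rangle}'\Lambda_{\langle i\rangle}\Upsilon^{-1}\big)\le\max_i s_{\max}\big(\tfrac1K\Upsilon^{-1}\Lambda_{\langle i\rangle}'\Lambda_{\langle i\rangle}\Upsilon^{-1}\big)\lesssim_{\mathbb P}1$; moreover $\upsilon_1\ge\dots\ge\upsilon_{\mathsf d}>0$, and for each $j<\mathsf d$ either $\upsilon_j/\upsilon_{j+1}\lesssim1$ or $\upsilon_j/\upsilon_{j+1}\to\infty$; (b) $\max_i\|\Xi_{\langle i\rangle}\|_{\max}\lesssim_{\mathbb P}h_n^m$, $h_n^m=o(\upsilon_{\mathsf d})$ and $\delta_n^{-1}/\upsilon_{\mathsf d}=o(1)$; (c) $1\lesssim_{\mathbb P}\min_i s_{\min}\big(\tfrac1{p^\ddagger}F_{\langle i\rangle}'F_{\langle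 i\rangle}\big)\le\max_i s_{\max}\big(\tfrac1{p^\ddagger}F_{\langle i\rangle}'F_{\langle i\rangle}\big)\lesssim_{\mathbb P}1$. -/

import Mathlib

open MeasureTheory ProbabilityTheory Filter Topology
open scoped ENNReal BigOperators Matrix

noncomputable section

/-! ### Stochastic orders along a triangular array of probability spaces -/

/-- `a_n ≲_P b_n`: `lim_{ε → ∞} limsup_n P_n[ |a_n| ≥ ε b_n ] = 0`.  For `b_n > 0` the event is
`|a_n / b_n| ≥ ε`.  The scale `b_n` is understood to be positive: outcomes with `b_n ≤ 0` always
count against the relation, so that `1 ≲_P b_n` says that `b_n` is positive and bounded away from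
zero with probability close to one. -/
def StochLE {Ω : ℕ → Type*} [∀ n, MeasurableSpace (Ω n)] (μ : ∀ n, Measure (Ω n))
    (a b : ∀ n, Ω n → ℝ) : Prop :=
  Tendsto (fun ε : ℝ => limsup (fun n => μ n {ω | ε * b n ω ≤ |a n ω|}) atTop) atTop (𝓝 0)

/-- The events `S_n` hold with probability approaching one: the (outer) probability of their
failure tends to zero. -/
def WPA1 {Ω : ℕ → Type*} [∀ n, MeasurableSpace (Ω n)] (μ : ∀ n, Measure (Ω n))
    (S : ∀ n, Set (Ω n)) : Prop :=
  Tendsto (fun n => μ n (S n)ᶜ) atTop (𝓝 0)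

/-! ### Matrices -/

/-- Entrywise sup-norm. -/
def matMaxNorm {ι κ : Type*} (A : Matrix ι κ ℝ) : ℝ := ⨆ ab : ι × κ, |A ab.1 ab.2|

/-- Largest singular value (Mathlib lists singular values in decreasing order from index `0`). -/
def sMax {a b : ℕ} (A : Matrix (Fin a) (Fin b) ℝ) : ℝ :=
  (Matrix.toEuclideanLin A).singularValues 0

/-- Smallest singular value: the last one of the `min a b` singular values of an `a × b` matrix. -/
def sMin {a b : ℕ} (A : Matrix (Fin a) (Fin b) ℝ) : ℝ :=
  (Matrix.toEuclideanLin A).singularValues (min a b - 1)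

/-- Entrywise conditional expectation of a random matrix. -/
def condExpMat {Ω : Type*} {mΩ : MeasurableSpace Ω} (μ : Measure Ω) (𝒢 : MeasurableSpace Ω)
    {ι κ : Type*} (A : Ω → Matrix ι κ ℝ) (ω : Ω) : Matrix ι κ ℝ :=
  Matrix.of fun a b => (μ[fun ω' => A ω' a b | 𝒢]) ω

/-! ### Multi-indices, partial derivatives, monomials -/

/-- The partial derivative `∂^q f (x)`, where derivatives are taken within `A` (on the boundary of
a convex body, derivatives are limits from inside).  The list contains the coordinate `t` exactly
`q t` times. -/
def partialDeriv {r : ℕ} (A : Set (EuclideanSpace ℝ (Fin r))) (q : Fin r → ℕ)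
    (f : EuclideanSpace ℝ (Fin r) → ℝ) (x : EuclideanSpace ℝ (Fin r)) : ℝ :=
  iteratedFDerivWithin ℝ ((List.finRange r).flatMap fun t => List.replicate (q t) t).length f A x
    fun k => EuclideanSpace.single
      (((List.finRange r).flatMap fun t => List.replicate (q t) t).get k) (1 : ℝ)

/-- An enumeration of all `r`-variate multi-indices of degree at most `M`, by nondecreasing
degree; there are `(M + r).choose r` of them. -/
structure GradedEnum (r M : ℕ) where
  toEquiv : Fin ((M + r).choose r) ≃ {q : Fin r → ℕ // ∑ t, q t ≤ M}
  mono : Monotone fun a => ∑ t, (toEquiv a : Fin r → ℕ) t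

/-- The degree `|q|` of the `a`-th multi-index. -/
def GradedEnum.deg {r M : ℕ} (e : GradedEnum r M) (a : Fin ((M + r).choose r)) : ℕ :=
  ∑ t, (e.toEquiv a : Fin r → ℕ) t

/-- Graded enumerations exist. -/
theorem GradedEnum.exists_gradedEnum (r M : ℕ) : Nonempty (GradedEnum r M) := by
  classical
  have e1 : {q : Fin r → ℕ // ∑ t, q t ≤ M} ≃ {P : Fin (r + 1) → ℕ // ∑ i, P i = M} :=
    { toFun := fun q => ⟨Fin.cons (M - ∑ t, q.1 t) q.1, by
        rw [Fin.sum_univ_succ]; simp only [Fin.cons_zero, Fin.cons_succ]; have := q.2; omega⟩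
      invFun := fun P => ⟨fun t => P.1 t.succ, by
        have := P.2; rw [Fin.sum_univ_succ] at this; change ∑ t, P.1 (Fin.succ t) ≤ M; omega⟩
      left_inv := fun q => by ext t; simp
      right_inv := fun P => by
        have h := P.2
        rw [Fin.sum_univ_succ] at h
        apply Subtype.ext
        funext i
        refine Fin.cases ?_ (fun t => ?_) i
        · simp only [Fin.cons_zero]; omega
        · simp }
  have e2 := e1.trans (Sym.equivNatSumOfFintype (Fin (r + 1)) M).symm
  have hc : Fintype.card (Sym (Fin (r + 1)) M) = (M + r).choose r := by
    rw [Sym.card_sym_eq_choose, Fintype.card_fin]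
    have : r + 1 + M - 1 = M + r := by omega
    rw [this, ← Nat.choose_symm_of_eq_add (rfl : M + r = M + r)]
  let g : Fin ((M + r).choose r) ≃ {q : Fin r → ℕ // ∑ t, q t ≤ M} :=
    ((Fintype.equivFinOfCardEq hc).symm).trans e2.symm
  exact ⟨⟨(Tuple.sort fun a => ∑ t, (g a : Fin r → ℕ) t).trans g,
    Tuple.monotone_sort fun a => ∑ t, (g a : Fin r → ℕ) t⟩⟩

/-! ### The nonlinear factor model -/

/-- The bandwidth `h_n = (K / n)^{ς̄ / (ς r)}`. -/
def bandwidth (K : ℕ → ℕ) (ςlo ςup : ℝ) (r n : ℕ) : ℝ :=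
  ((K n : ℝ) / (n : ℝ)) ^ (ςup / (ςlo * (r : ℝ)))

/-- A triangular array of nonlinear factor models: for every sample size `n`, on the space `Ω n`,
latent variables `α_i` (`i ∈ [n]`), random latent functions `η_l` (`l ∈ [p n]`), errors `u_{il}`,
and the subset `Rdag n` of the rows `[p n]` that is used for matching; local PCA uses the
complementary rows. -/
structure FactorArray (Ω : ℕ → Type*) [∀ n, MeasurableSpace (Ω n)] (r : ℕ) where
  p : ℕ → ℕ
  α : ∀ n, Fin n → Ω n → EuclideanSpace ℝ (Fin r)
  η : ∀ n, Fin (p n) → Ω n → EuclideanSpace ℝ (Fin r) → ℝ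
  u : ∀ n, Fin n → Fin (p n) → Ω n → ℝ
  Rdag : ∀ n, Finset (Fin (p n))
  measurable_α : ∀ n i, Measurable (α n i)
  measurable_η : ∀ n l,
    Measurable fun z : Ω n × EuclideanSpace ℝ (Fin r) => η n l z.1 z.2
  measurable_u : ∀ n i l, Measurable (u n i l)

namespace FactorArray

variable {Ω : ℕ → Type*} [∀ n, MeasurableSpace (Ω n)] {r : ℕ} (M : FactorArray Ω r)

/-- The rows used for local PCA. -/
abbrev Rddag (n : ℕ) : Finset (Fin (M.p n)) := (M.Rdag n)ᶜ

/-- Matching data: one vector, indexed by the matching rows, for every unit. -/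
abbrev MatchData (n : ℕ) : Type := Fin n → {l // l ∈ M.Rdag n} → ℝ

/-- `H_{li} = η_l(α_i)`. -/
def H (n : ℕ) (i : Fin n) (l : Fin (M.p n)) (ω : Ω n) : ℝ := M.η n l ω (M.α n i ω)

/-- `X = H + U`. -/
def X (n : ℕ) (i : Fin n) (l : Fin (M.p n)) (ω : Ω n) : ℝ := M.H n i l ω + M.u n i l ω

/-- Noise-free matching data. -/
def Hdag (n : ℕ) (ω : Ω n) : M.MatchData n := fun i l => M.H n i l ω

/-- Observed matching data. -/
def Xdag (n : ℕ) (ω : Ω n) : M.MatchData n := fun i l => M.X n i l ω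

/-- The σ-field generated by the latent variables and the latent functions (on `A`). -/
@[reducible] def sigmaLatent (A : Set (EuclideanSpace ℝ (Fin r))) (n : ℕ) : MeasurableSpace (Ω n) :=
  (⨆ i : Fin n, MeasurableSpace.comap (M.α n i) inferInstance) ⊔
    ⨆ (l : Fin (M.p n)) (x : A),
      MeasurableSpace.comap (fun ω => M.η n l ω (x : EuclideanSpace ℝ (Fin r))) inferInstance

/-- The conditioning σ-field of the local approximation: everything is conditional on the latent
variables and functions, and on the matching data. -/
@[reducible] def sigmaMatch (A : Set (EuclideanSpace ℝ (Fin r))) (n : ℕ) : MeasurableSpace (Ω n) :=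
  M.sigmaLatent A n ⊔ MeasurableSpace.comap (M.Xdag n) inferInstance

/-- The regularity conditions on latent variables, latent functions and errors. -/
structure Regularities (μ : ∀ n, Measure (Ω n)) (A : Set (EuclideanSpace ℝ (Fin r)))
    (mbar : ℕ) : Prop where
  compact : IsCompact A
  convex : Convex ℝ A
  indep : ∀ n, iIndepFun (M.α n) (μ n)
  /-- the `α_i` have a common density on `A`, bounded and bounded away from zero there -/
  density : ∃ (f : EuclideanSpace ℝ (Fin r) → ℝ) (c C : ℝ), Measurable f ∧ 0 < c ∧
    (∀ x ∈ A, c ≤ f x ∧ f x ≤ C) ∧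
    ∀ n i, (μ n).map (M.α n i) = (volume.restrict A).withDensity fun x => ENNReal.ofReal (f x)
  two_le : 2 ≤ mbar
  smooth : ∀ n l, ∀ᵐ ω ∂μ n, ContDiffOn ℝ mbar (M.η n l ω) A
  bounded : ∃ B : ℝ, ∀ n l, ∀ᵐ ω ∂μ n, ∀ x ∈ A, ∀ q : Fin r → ℕ, ∑ t, q t ≤ mbar →
    |partialDeriv A q (M.η n l ω) x| ≤ B
  u_integrable : ∀ n i l, Integrable (M.u n i l) (μ n)
  u_mean : ∀ n i l, (μ n)[M.u n i l | M.sigmaLatent A n] =ᵐ[μ n] 0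
  /-- all the `u_{il}` are independent conditionally on the latent σ-field -/
  u_condIndep : ∀ n, ∀ S : Fin n → Fin (M.p n) → Set ℝ, (∀ i l, MeasurableSet (S i l)) →
    (μ n)⟦⋂ (i) (l), M.u n i l ⁻¹' S i l | M.sigmaLatent A n⟧ =ᵐ[μ n]
      fun ω => ∏ i, ∏ l, ((μ n)⟦M.u n i l ⁻¹' S i l | M.sigmaLatent A n⟧) ω
  u_moment : ∃ ν : ℝ, 0 < ν ∧ ∀ n i l, ∀ᵐ ω ∂μ n,
    condLExp (M.sigmaLatent A n) (μ n) (fun ω' => ENNReal.ofReal (|M.u n i l ω'| ^ (2 + ν))) ω < ⊤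

/-- The two groups of rows are both of the order of `p`. -/
def BalancedSplit : Prop :=
  ∃ c : ℝ, 0 < c ∧ ∀ᶠ n in atTop,
    c * (M.p n : ℝ) ≤ ((M.Rdag n).card : ℝ) ∧ c * (M.p n : ℝ) ≤ ((M.Rddag n).card : ℝ)

/-- The indirect-matching condition.  The "distance" `ρ` between the units `i` and `j` may use the
whole data set (as the pseudo-max distance does). -/
structure IndirectMatching (μ : ∀ n, Measure (Ω n))
    (ρ : ∀ n, M.MatchData n → Fin n → Fin n → ℝ) (ρ₀ ςlo ςup : ℝ) (a : ℕ → ℝ) : Prop where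
  rho_nonneg : 0 ≤ ρ₀
  lo_pos : 0 < ςlo
  up_pos : 0 < ςup
  a_pos : ∀ᶠ n in atTop, 0 < a n
  a_tendsto : Tendsto a atTop (𝓝 0)
  denoise : StochLE μ
    (fun n ω => ⨆ ij : {ij : Fin n × Fin n // ij.1 ≠ ij.2},
      |ρ n (M.Xdag n ω) ij.1.1 ij.1.2 - ρ n (M.Hdag n ω) ij.1.1 ij.1.2 - ρ₀|)
    (fun n _ => a n)
  upper : StochLE μ
    (fun n ω => ⨆ ij : {ij : Fin n × Fin n // M.α n ij.1 ω ≠ M.α n ij.2 ω},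
      ρ n (M.Hdag n ω) ij.1.1 ij.1.2 / ‖M.α n ij.1.1 ω - M.α n ij.1.2 ω‖ ^ ςup)
    (fun _ _ => 1)
  lower : StochLE μ
    (fun _ _ => 1)
    (fun n ω => ⨅ ij : {ij : Fin n × Fin n // M.α n ij.1 ω ≠ M.α n ij.2 ω},
      ρ n (M.Hdag n ω) ij.1.1 ij.1.2 / ‖M.α n ij.1.1 ω - M.α n ij.1.2 ω‖ ^ ςlo)

/-- `nn n V i` lists, without repetition, `K n` nearest neighbours of the unit `i` (including `i`
itself) for the distance `ρ` and the matching data `V`: no other unit is closer to `i` than one of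
the listed ones.  Ties are broken in an arbitrary measurable way. -/
structure IsNearestNeighbors (K : ℕ → ℕ) (ρ : ∀ n, M.MatchData n → Fin n → Fin n → ℝ)
    (nn : ∀ n, M.MatchData n → Fin n → Fin (K n) → Fin n) : Prop where
  measurable : ∀ n i k, Measurable fun V => nn n V i k
  injective : ∀ n V i, Function.Injective (nn n V i)
  self_mem : ∀ n V i, i ∈ Set.range (nn n V i)
  nearest : ∀ n V i k j, nn n V i k ≠ i → j ∉ Set.range (nn n V i) →
    ρ n V i (nn n V i k) ≤ ρ n V i j

/-- `δ_n = (K ∧ p)^{1/2} / √(log (n ∨ p))`. -/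
def delta (K : ℕ → ℕ) (n : ℕ) : ℝ :=
  √(min (K n) (M.p n) : ℕ) / √(Real.log (max n (M.p n) : ℕ))

/-- The index `j_k(i)` of the `k`-th neighbour of the unit `i` found from `X†`. -/
def nbr {K : ℕ → ℕ} (nn : ∀ n, M.MatchData n → Fin n → Fin (K n) → Fin n)
    (n : ℕ) (i : Fin n) (k : Fin (K n)) (ω : Ω n) : Fin n := nn n (M.Xdag n ω) i k

/-- The local signal matrix `H_{⟨i⟩}`. -/
def Hloc {K : ℕ → ℕ} (nn : ∀ n, M.MatchData n → Fin n → Fin (K n) → Fin n)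
    (n : ℕ) (i : Fin n) (ω : Ω n) : Matrix {l // l ∈ M.Rddag n} (Fin (K n)) ℝ :=
  Matrix.of fun l k => M.H n (M.nbr nn n i k ω) l ω

/-- The `L²`-projection coefficients `F_{⟨i⟩} = E‡[H_{⟨i⟩} Λ_{⟨i⟩}] E‡[Λ_{⟨i⟩}' Λ_{⟨i⟩}]⁻¹`. -/
def Floc (μ : ∀ n, Measure (Ω n)) (A : Set (EuclideanSpace ℝ (Fin r))) {K : ℕ → ℕ}
    (nn : ∀ n, M.MatchData n → Fin n → Fin (K n) → Fin n) {d : ∀ n, Fin n → ℕ}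
    (Λ : ∀ n (i : Fin n), Ω n → Matrix (Fin (K n)) (Fin (d n i)) ℝ)
    (n : ℕ) (i : Fin n) (ω : Ω n) : Matrix {l // l ∈ M.Rddag n} (Fin (d n i)) ℝ :=
  condExpMat (μ n) (M.sigmaMatch A n) (fun ω' => M.Hloc nn n i ω' * Λ n i ω') ω *
    (condExpMat (μ n) (M.sigmaMatch A n) (fun ω' => (Λ n i ω')ᵀ * Λ n i ω') ω)⁻¹

/-- The projection errors `Ξ_{⟨i⟩} = H_{⟨i⟩} - F_{⟨i⟩} Λ_{⟨i⟩}'`. -/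
def Xiloc (μ : ∀ n, Measure (Ω n)) (A : Set (EuclideanSpace ℝ (Fin r))) {K : ℕ → ℕ}
    (nn : ∀ n, M.MatchData n → Fin n → Fin (K n) → Fin n) {d : ∀ n, Fin n → ℕ}
    (Λ : ∀ n (i : Fin n), Ω n → Matrix (Fin (K n)) (Fin (d n i)) ℝ)
    (n : ℕ) (i : Fin n) (ω : Ω n) : Matrix {l // l ∈ M.Rddag n} (Fin (K n)) ℝ :=
  M.Hloc nn n i ω - M.Floc μ A nn Λ n i ω * (Λ n i ω)ᵀ

/-- The scaled Gram matrix `K⁻¹ Υ⁻¹ Λ' Λ Υ⁻¹`. -/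
def scaledGram {K d : ℕ} (υ : Fin d → ℝ) (L : Matrix (Fin K) (Fin d) ℝ) :
    Matrix (Fin d) (Fin d) ℝ :=
  (K : ℝ)⁻¹ • ((Matrix.diagonal υ)⁻¹ * Lᵀ * L * (Matrix.diagonal υ)⁻¹)

/-- The local-approximation condition, of order `m`, with `d n i` local factors for the unit `i`,
loadings `Λ_{⟨i⟩}` and scalings `Υ_{⟨i⟩} = diag(υ n i)`, for a bandwidth sequence `h`. -/
structure LocalApproximation (μ : ∀ n, Measure (Ω n)) (A : Set (EuclideanSpace ℝ (Fin r)))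
    {K : ℕ → ℕ} (nn : ∀ n, M.MatchData n → Fin n → Fin (K n) → Fin n) (h : ℕ → ℝ) (m : ℕ)
    (d : ∀ n, Fin n → ℕ) (Λ : ∀ n (i : Fin n), Ω n → Matrix (Fin (K n)) (Fin (d n i)) ℝ)
    (υ : ∀ n (i : Fin n), Fin (d n i) → ℝ) : Prop where
  /-- the conditional expectations that define `F_{⟨i⟩}` are those of integrable variables, -/
  integrable_HΛ : ∀ n i l b, Integrable (fun ω => (M.Hloc nn n i ω * Λ n i ω) l b) (μ n)
  integrable_ΛΛ : ∀ n i a b, Integrable (fun ω => ((Λ n i ω)ᵀ * Λ n i ω) a b) (μ n)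
  /-- and the inverse exists for all units with probability approaching one -/
  invertible : WPA1 μ fun n => {ω | ∀ i, IsUnit
    (condExpMat (μ n) (M.sigmaMatch A n) (fun ω' => (Λ n i ω')ᵀ * Λ n i ω') ω).det}
  d_pos : ∀ n i, 0 < d n i
  scale_pos : ∀ n i j, 0 < υ n i j
  scale_anti : ∀ n i, Antitone (υ n i)
  loadings_max : StochLE μ
    (fun n ω => ⨆ i : Fin n, matMaxNorm (Λ n i ω * (Matrix.diagonal (υ n i))⁻¹)) (fun _ _ => 1)
  loadings_min : StochLE μ (fun _ _ => 1)
    (fun n ω => ⨅ i : Fin n, sMin (scaledGram (υ n i) (Λ n i ω)))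
  loadings_sup : StochLE μ
    (fun n ω => ⨆ i : Fin n, sMax (scaledGram (υ n i) (Λ n i ω))) (fun _ _ => 1)
  /-- consecutive scales are either of the same order or of different orders (`S` is the set of
  units, labelled by natural numbers, for which the first alternative holds) -/
  scale_ratio : ∀ j : ℕ, ∃ S : Set ℕ,
    (∃ C : ℝ, ∀ᶠ n in atTop, ∀ (i : Fin n) (hj : j + 1 < d n i), (i : ℕ) ∈ S →
      υ n i ⟨j, Nat.lt_of_succ_lt hj⟩ / υ n i ⟨j + 1, hj⟩ ≤ C) ∧
    (∀ C : ℝ, ∀ᶠ n in atTop, ∀ (i : Fin n) (hj : j + 1 < d n i), (i : ℕ) ∉ S →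
      C ≤ υ n i ⟨j, Nat.lt_of_succ_lt hj⟩ / υ n i ⟨j + 1, hj⟩)
  bias : StochLE μ (fun n ω => ⨆ i : Fin n, matMaxNorm (M.Xiloc μ A nn Λ n i ω))
    (fun n _ => h n ^ m)
  /-- `h_n^m = o(υ_{d_i})`, uniformly over the units -/
  bias_small : ∀ ε : ℝ, 0 < ε → ∀ᶠ n in atTop, ∀ (i : Fin n) (j : Fin (d n i)),
    (j : ℕ) + 1 = d n i → h n ^ m ≤ ε * υ n i j
  /-- `δ_n⁻¹ / υ_{d_i} = o(1)`, uniformly over the units -/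
  noise_small : ∀ ε : ℝ, 0 < ε → ∀ᶠ n in atTop, ∀ (i : Fin n) (j : Fin (d n i)),
    (j : ℕ) + 1 = d n i → (M.delta K n)⁻¹ / υ n i j ≤ ε
  factors_min : StochLE μ (fun _ _ => 1)
    (fun n ω => ⨅ i : Fin n, sMin (((M.Rddag n).card : ℝ)⁻¹ •
      ((M.Floc μ A nn Λ n i ω)ᵀ * M.Floc μ A nn Λ n i ω)))
  factors_sup : StochLE μ
    (fun n ω => ⨆ i : Fin n, sMax (((M.Rddag n).card : ℝ)⁻¹ •
      ((M.Floc μ A nn Λ n i ω)ᵀ * M.Floc μ A nn Λ n i ω)))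
    (fun _ _ => 1)

/-- The monomial loadings of degree at most `m - 1` centred at `α_i`: the `(k, a)` entry of
`Λ_{⟨i⟩}` is `(α_{j_k(i)} - α_i)^q` for the `a`-th multi-index `q`. -/
def monomialLoadings {K : ℕ → ℕ} (nn : ∀ n, M.MatchData n → Fin n → Fin (K n) → Fin n) {m : ℕ}
    (e : GradedEnum r (m - 1)) (n : ℕ) (i : Fin n) (ω : Ω n) :
    Matrix (Fin (K n)) (Fin ((m - 1 + r).choose r)) ℝ :=
  Matrix.of fun k a => ∏ t,
    (M.α n (M.nbr nn n i k ω) ω t - M.α n i ω t) ^ (e.toEquiv a : Fin r → ℕ) t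

/-- The Gram matrix `(p‡)⁻¹ ∑_{l ∈ R‡} (𝒟η_l(α_i)) (𝒟η_l(α_i))'`, where `𝒟η_l` collects the
partial derivatives of `η_l` of all orders `0, …, m - 1`. -/
def derivGram (A : Set (EuclideanSpace ℝ (Fin r))) {m : ℕ} (e : GradedEnum r (m - 1))
    (n : ℕ) (i : Fin n) (ω : Ω n) :
    Matrix (Fin ((m - 1 + r).choose r)) (Fin ((m - 1 + r).choose r)) ℝ :=
  ((M.Rddag n).card : ℝ)⁻¹ • ∑ l ∈ M.Rddag n,
    Matrix.vecMulVec (fun a => partialDeriv A (e.toEquiv a) (M.η n l ω) (M.α n i ω))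
      (fun a => partialDeriv A (e.toEquiv a) (M.η n l ω) (M.α n i ω))

end FactorArray

end

/-! The core is deterministic. Suppose that all neighbours of a unit `i` lie within `C h` of it, and
that for every unit vector `v` fewer than half of them fall where the polynomial with coefficients
`v`, read in the rescaled variable `(α - α_i) / h`, is at most `ε` in absolute value. Monomials are
homogeneous, so `Λ Υ⁻¹` consists of monomials at bounded points, and the quadratic form of its Gram
matrix divided by `K` is at least `ε² / 2`: this is (a). Taylor's formula gives `H = D Λ' + R`,
where `D` holds the derivatives of `η` with positive weights and `R = O(h^m)`. Everything inside
`E‡` is measurable for the conditioning σ-field, so `F` is an ordinary least-squares fit and `F = D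
+ R Λ (Λ'Λ)⁻¹`. The last term costs at most the smallest scale `h^(m-1)`, hence is `O(h)`, and `F`
inherits the conditioning of `D`: this is (c). The residuals of `H` are the projection residuals of
`R`, which gives (b). `projection_bounds` and `FactorArray.exists_localFit` carry this half.

The neighbours depend on the noise, so their law is never studied. Both suppositions follow from
counts of sample points that hold simultaneously for all centres in `A` and all `v`. The condition
on `δ_n` makes `K` exceed `9 log n` eventually, so `n exp(-K/4) → 0`, and Chernoff bounds survive a
union over a net of `O(n)` centres. Convexity and the lower bound on the density put more than `K`
points in every ball of radius `D h` (`LocalSampling.wpa1_lt_countIn`); because the two matching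
exponents agree, the nearest neighbours then cannot be farther than a multiple of `h`
(`FactorArray.norm_nbr_sub_le`). A nonzero polynomial has a null zero set, so by compactness of the
sphere of coefficients finitely many sets of small volume contain all slightly enlarged sublevel
sets (`exists_finite_cover_sublevel`); the upper bound on the density leaves fewer than `K / 2`
sample points in each (`LocalSampling.wpa1_countIn_sublevel_lt`). -/

/-! ### Singular values and quadratic forms -/

theorem toEuclideanLin_norm_sq {a b : ℕ} (A : Matrix (Fin a) (Fin b) ℝ)
    (v : EuclideanSpace ℝ (Fin b)) :
    ‖Matrix.toEuclideanLin A v‖ ^ 2 = ∑ i, (A *ᵥ v.ofLp) i ^ 2 := by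
  rw [EuclideanSpace.norm_sq_eq]
  simp [Matrix.toEuclideanLin]

/-- A unit eigenvector of `T† T` for its `k`-th eigenvalue works, since that eigenvalue is the
square of the `k`-th singular value. -/
theorem exists_eigenvector_singularValues {d : ℕ} (A : Matrix (Fin d) (Fin d) ℝ) {k : ℕ}
    (hk : k < d) : ∃ v : Fin d → ℝ, ∑ a, v a ^ 2 = 1 ∧
      ∑ i, (A *ᵥ v) i ^ 2 = (Matrix.toEuclideanLin A).singularValues k ^ 2 := by
  set T := Matrix.toEuclideanLin A
  have hfr : Module.finrank ℝ (EuclideanSpace ℝ (Fin d)) = d := by simp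
  have hS := T.isSymmetric_adjoint_comp_self
  set w := hS.eigenvectorBasis hfr ⟨k, hk⟩
  have hw : ‖w‖ = 1 := (hS.eigenvectorBasis hfr).orthonormal.1 _
  refine ⟨w.ofLp, ?_, ?_⟩
  · have := EuclideanSpace.real_norm_sq_eq w
    rw [← this, hw]; norm_num
  · rw [← toEuclideanLin_norm_sq, T.sq_singularValues_of_lt hfr hk, ← real_inner_self_eq_norm_sq]
    have h1 := hS.apply_eigenvectorBasis hfr ⟨k, hk⟩
    have h2 : inner ℝ (T w) (T w) = inner ℝ ((LinearMap.adjoint T ∘ₗ T) w) w := by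
      rw [LinearMap.comp_apply, LinearMap.adjoint_inner_left]
    rw [h2, h1, inner_smul_left, real_inner_self_eq_norm_sq]
    change _ * ‖w‖ ^ 2 = _
    rw [hw]; simp

/-- Parseval in an eigenbasis of `T† T`: every eigenvalue is at least the square of the last
singular value. -/
theorem sMin_sq_mul_le {d : ℕ} (A : Matrix (Fin d) (Fin d) ℝ) (v : Fin d → ℝ) :
    sMin A ^ 2 * ∑ a, v a ^ 2 ≤ ∑ i, (A *ᵥ v) i ^ 2 := by
  set T := Matrix.toEuclideanLin A
  have hfr : Module.finrank ℝ (EuclideanSpace ℝ (Fin d)) = d := by simp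
  have hS := T.isSymmetric_adjoint_comp_self
  set b := hS.eigenvectorBasis hfr
  set x : EuclideanSpace ℝ (Fin d) := WithLp.toLp 2 v
  have hx : ∑ a, v a ^ 2 = ‖x‖ ^ 2 := (EuclideanSpace.real_norm_sq_eq x).symm
  have hT : ∑ i, (A *ᵥ v) i ^ 2 = ‖T x‖ ^ 2 := (toEuclideanLin_norm_sq A x).symm
  rw [hx, hT, ← real_inner_self_eq_norm_sq (T x)]
  have h2 : inner ℝ (T x) (T x) = inner ℝ ((LinearMap.adjoint T ∘ₗ T) x) x := by
    rw [LinearMap.comp_apply, LinearMap.adjoint_inner_left]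
  rw [h2, ← b.sum_inner_mul_inner, ← b.sum_sq_norm_inner_right x, Finset.mul_sum]
  refine Finset.sum_le_sum fun k _ => ?_
  have h3 : inner ℝ ((LinearMap.adjoint T ∘ₗ T) x) (b k)
      = T.singularValues k ^ 2 * inner ℝ x (b k) := by
    rw [hS, hS.apply_eigenvectorBasis hfr k, inner_smul_right, T.sq_singularValues_of_lt hfr k.2]
    rfl
  rw [h3, real_inner_comm x (b k), Real.norm_eq_abs, sq_abs, mul_assoc, ← sq, real_inner_comm]
  have h4 : sMin A ≤ T.singularValues k := by
    apply T.singularValues_antitone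
    have := k.2; simp; omega
  have h5 : 0 ≤ sMin A := T.singularValues_nonneg _
  gcongr

theorem gram_bilin {ι : Type*} [Fintype ι] {d : ℕ} (B : Matrix ι (Fin d) ℝ) (v w : Fin d → ℝ) :
    w ⬝ᵥ ((Bᵀ * B) *ᵥ v) = (B *ᵥ w) ⬝ᵥ (B *ᵥ v) := by
  rw [← Matrix.mulVec_mulVec, Matrix.dotProduct_mulVec, Matrix.vecMul_transpose]

theorem sq_dotProduct_le {ι : Type*} [Fintype ι] (v w : ι → ℝ) :
    (v ⬝ᵥ w) ^ 2 ≤ (∑ i, v i ^ 2) * ∑ i, w i ^ 2 :=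
  Finset.sum_mul_sq_le_sq_mul_sq _ _ _

/-- At the unit vector `v` that realises the smallest singular value, Cauchy-Schwarz bounds the
quadratic form by `‖G v‖`, which is that singular value. -/
theorem le_sMin_smul_gram {ι : Type*} [Fintype ι] {d : ℕ} (hd : 0 < d) (B : Matrix ι (Fin d) ℝ)
    {s c : ℝ}
    (h : ∀ v : Fin d → ℝ, c * ∑ a, v a ^ 2 ≤ s * ∑ l, (B *ᵥ v) l ^ 2) :
    c ≤ sMin (s • (Bᵀ * B)) := by
  obtain ⟨v, hv, hA⟩ := exists_eigenvector_singularValues (s • (Bᵀ * B)) (k := d - 1) (by omega)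
  have hs : sMin (s • (Bᵀ * B)) = (Matrix.toEuclideanLin (s • (Bᵀ * B))).singularValues (d - 1) := by
    simp [sMin]
  rw [hs]
  set σ := (Matrix.toEuclideanLin (s • (Bᵀ * B))).singularValues (d - 1)
  have h0 : 0 ≤ σ := LinearMap.singularValues_nonneg _ _
  by_contra hlt
  push Not at hlt
  have h1 := h v
  rw [hv, mul_one] at h1
  have h2 : s * ∑ l, (B *ᵥ v) l ^ 2 = v ⬝ᵥ ((s • (Bᵀ * B)) *ᵥ v) := by
    rw [Matrix.smul_mulVec, dotProduct_smul, gram_bilin, smul_eq_mul]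
    simp [dotProduct, sq]
  have h3 := sq_dotProduct_le v ((s • (Bᵀ * B)) *ᵥ v)
  rw [hv, hA, ← h2] at h3
  nlinarith

/-- With `v` the top right singular vector and `w = G v`, one has `‖w‖² = s ⟨B w, B v⟩`.
Cauchy-Schwarz and the form bound at `w` and at `v` give `σ⁴ ≤ C² σ²`. -/
theorem sMax_smul_gram_le {ι : Type*} [Fintype ι] {d : ℕ} (hd : 0 < d) (B : Matrix ι (Fin d) ℝ)
    {s C : ℝ} (hs : 0 ≤ s) (hC : 0 ≤ C)
    (h : ∀ v : Fin d → ℝ, s * ∑ l, (B *ᵥ v) l ^ 2 ≤ C * ∑ a, v a ^ 2) :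
    sMax (s • (Bᵀ * B)) ≤ C := by
  obtain ⟨v, hv, hA⟩ := exists_eigenvector_singularValues (s • (Bᵀ * B)) hd
  set G := s • (Bᵀ * B)
  set w := G *ᵥ v
  have h0 : 0 ≤ sMax G := LinearMap.singularValues_nonneg _ _
  change ∑ i, w i ^ 2 = sMax G ^ 2 at hA
  have h2 : ∑ i, w i ^ 2 = s * ((B *ᵥ w) ⬝ᵥ (B *ᵥ v)) := by
    have : ∑ i, w i ^ 2 = w ⬝ᵥ (G *ᵥ v) := by simp [dotProduct, sq, w]
    rw [this, Matrix.smul_mulVec, dotProduct_smul, gram_bilin, smul_eq_mul]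
  have h3 := sq_dotProduct_le (B *ᵥ w) (B *ᵥ v)
  have h4 := h v
  have h5 := h w
  rw [hv, mul_one] at h4
  rw [hA] at h5 h2
  have h6 : (sMax G ^ 2) ^ 2 ≤ (C * sMax G ^ 2) * C := by
    calc (sMax G ^ 2) ^ 2 = s ^ 2 * ((B *ᵥ w) ⬝ᵥ (B *ᵥ v)) ^ 2 := by rw [h2]; ring
      _ ≤ s ^ 2 * ((∑ l, (B *ᵥ w) l ^ 2) * ∑ l, (B *ᵥ v) l ^ 2) := by gcongr
      _ = (s * ∑ l, (B *ᵥ w) l ^ 2) * (s * ∑ l, (B *ᵥ v) l ^ 2) := by ring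
      _ ≤ _ := by
        gcongr
  by_contra hlt
  push Not at hlt
  have : 0 < sMax G := by linarith
  nlinarith [mul_pos this this, mul_lt_mul'' hlt hlt hC hC, sq_nonneg (sMax G)]

/-! ### Zero sets and sublevel sets of polynomials -/

/-- Induction on the number of variables, with Fubini: the leading coefficient in the first variable
is nonzero at almost every value of the others, and there the slice is the finite root set of a
univariate polynomial. -/
theorem MvPolynomial.volume_zeros_eq_zero (n : ℕ) (p : MvPolynomial (Fin n) ℝ) (hp : p ≠ 0) :
    volume {x : Fin n → ℝ | MvPolynomial.eval x p = 0} = 0 := by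
  induction n with
  | zero =>
    obtain ⟨c, rfl⟩ := MvPolynomial.C_surjective (Fin 0) p
    have hc : c ≠ 0 := by rintro rfl; simp at hp
    simp [hc]
  | succ n ih =>
    set q := MvPolynomial.finSuccEquiv ℝ n p
    have hq : q ≠ 0 := by simpa [q] using hp
    have hmeas : MeasurableSet {x : Fin (n + 1) → ℝ | MvPolynomial.eval x p = 0} :=
      (MvPolynomial.continuous_eval p).measurable (measurableSet_singleton 0)
    -- The swap puts the distinguished variable second, so that slices of the product run along it.
    have hmp := (volume_preserving_piFinSuccAbove (fun _ : Fin (n + 1) => ℝ) 0).symm.comp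
      (Measure.measurePreserving_swap (μ := (volume : Measure (Fin n → ℝ)))
        (ν := (volume : Measure ℝ)))
    rw [← hmp.measure_preimage hmeas.nullMeasurableSet]
    refine Measure.measure_prod_null_of_ae_null (hmp.measurable hmeas) ?_
    have hlc : ∀ᵐ s : Fin n → ℝ, MvPolynomial.eval s q.leadingCoeff ≠ 0 := by
      rw [ae_iff]
      simpa using ih q.leadingCoeff (by simpa using hq)
    filter_upwards [hlc] with s hs
    have hmap : Polynomial.map (MvPolynomial.eval s) q ≠ 0 := by
      intro h0
      apply hs
      have := congrArg (fun f => f.coeff q.natDegree) h0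
      simpa using this
    have hset : Prod.mk s ⁻¹' ((⇑(MeasurableEquiv.piFinSuccAbove (fun _ : Fin (n + 1) => ℝ) 0).symm ∘
        Prod.swap) ⁻¹' {x | MvPolynomial.eval x p = 0})
        ⊆ ((Polynomial.map (MvPolynomial.eval s) q).roots.toFinset : Set ℝ) := by
      intro y hy
      have hy' : MvPolynomial.eval (Fin.cons y s : Fin (n + 1) → ℝ) p = 0 := by
        have h1 : MvPolynomial.eval ((MeasurableEquiv.piFinSuccAbove
          (fun _ : Fin (n + 1) => ℝ) 0).symm (y, s)) p = 0 := hy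
        rw [← h1]
        congr 2
        ext k
        refine Fin.cases ?_ (fun t => ?_) k <;> simp [MeasurableEquiv.piFinSuccAbove]
      rw [MvPolynomial.eval_eq_eval_mv_eval'] at hy'
      simp only [Finset.mem_coe, Multiset.mem_toFinset]
      exact (Polynomial.mem_roots hmap).2 hy'
    exact measure_mono_null hset ((Finset.finite_toSet _).measure_zero _)

/-- The monomials of degree at most `N`, listed by a graded enumeration, evaluated at `y`. -/
def monomialVec {r N : ℕ} (e : GradedEnum r N) (y : EuclideanSpace ℝ (Fin r)) :
    Fin ((N + r).choose r) → ℝ :=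
  fun a => ∏ t, y t ^ (e.toEquiv a : Fin r → ℕ) t

theorem continuous_monomialVec_dotProduct {r N : ℕ} (e : GradedEnum r N) :
    Continuous fun z : (Fin ((N + r).choose r) → ℝ) × EuclideanSpace ℝ (Fin r) =>
      monomialVec e z.2 ⬝ᵥ z.1 := by
  unfold monomialVec dotProduct
  fun_prop

/-- Distinct indices carry distinct monomials, so a nonzero coefficient vector defines a nonzero
polynomial. -/
theorem volume_monomialVec_zeros {r N : ℕ} (e : GradedEnum r N) {v : Fin ((N + r).choose r) → ℝ}
    (hv : v ≠ 0) : volume {y : EuclideanSpace ℝ (Fin r) | monomialVec e y ⬝ᵥ v = 0} = 0 := by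
  set p : MvPolynomial (Fin r) ℝ :=
    ∑ a, MvPolynomial.monomial (Finsupp.equivFunOnFinite.symm (e.toEquiv a : Fin r → ℕ)) (v a)
  have hp : p ≠ 0 := by
    obtain ⟨a, ha⟩ := Function.ne_iff.1 hv
    intro h0
    apply ha
    have h1 := congrArg
      (MvPolynomial.coeff (Finsupp.equivFunOnFinite.symm (e.toEquiv a : Fin r → ℕ))) h0
    rw [MvPolynomial.coeff_sum, Finset.sum_eq_single a] at h1
    · simpa using h1
    · intro b _ hb
      rw [MvPolynomial.coeff_monomial, if_neg]
      intro h2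
      exact hb (e.toEquiv.injective (Subtype.ext (Finsupp.equivFunOnFinite.symm.injective h2)))
    · simp
  have h := MvPolynomial.volume_zeros_eq_zero r p hp
  have hmeas : MeasurableSet {x : Fin r → ℝ | MvPolynomial.eval x p = 0} :=
    (MvPolynomial.continuous_eval p).measurable (measurableSet_singleton 0)
  rw [← (PiLp.volume_preserving_ofLp (Fin r)).measure_preimage hmeas.nullMeasurableSet] at h
  convert h using 2
  ext y
  simp [p, monomialVec, dotProduct, MvPolynomial.eval_monomial, Finsupp.prod_fintype, mul_comm]

/-- Inside a fixed ball the sublevel sets at levels `1 / (k + 1)` decrease to a null set; continuity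
from above applies because the ball has finite volume. -/
theorem exists_volume_sublevel_le {r N : ℕ} (e : GradedEnum r N) {v : Fin ((N + r).choose r) → ℝ}
    (hv : v ≠ 0) (C : ℝ) {η : ℝ≥0∞} (hη : 0 < η) :
    ∃ ε : ℝ, 0 < ε ∧ volume {y : EuclideanSpace ℝ (Fin r) |
      y ∈ Metric.closedBall 0 C ∧ |monomialVec e y ⬝ᵥ v| ≤ ε} ≤ η := by
  set S : ℕ → Set (EuclideanSpace ℝ (Fin r)) := fun k =>
    {y | y ∈ Metric.closedBall 0 C ∧ |monomialVec e y ⬝ᵥ v| ≤ 1 / ((k : ℝ) + 1)}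
  have hc : Continuous fun y => monomialVec e y ⬝ᵥ v :=
    (continuous_monomialVec_dotProduct e).comp (by fun_prop : Continuous fun y => (v, y))
  have hS : ∀ k, NullMeasurableSet (S k) := fun k =>
    ((Metric.isClosed_closedBall).inter (isClosed_le hc.abs continuous_const)).measurableSet.nullMeasurableSet
  have hanti : Antitone S := by
    intro j k hjk y hy
    exact ⟨hy.1, hy.2.trans (Nat.one_div_le_one_div hjk)⟩
  have hfin : ∃ k, volume (S k) ≠ ⊤ :=
    ⟨0, ne_top_of_le_ne_top (measure_closedBall_lt_top (x := (0 : EuclideanSpace ℝ (Fin r))) (r := C)).ne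
      (measure_mono fun y hy => hy.1)⟩
  have ht := tendsto_measure_iInter_atTop hS hanti hfin
  have h0 : volume (⋂ k, S k) = 0 := by
    refine measure_mono_null (fun y hy => ?_) (volume_monomialVec_zeros e hv)
    have h1 : ∀ k : ℕ, |monomialVec e y ⬝ᵥ v| ≤ 1 / ((k : ℝ) + 1) := fun k =>
      ((Set.mem_iInter.1 hy) k).2
    have h2 := ge_of_tendsto' (tendsto_one_div_add_atTop_nhds_zero_nat (𝕜 := ℝ)) h1
    simpa using h2
  rw [h0] at ht
  obtain ⟨k, hk⟩ := (ht.eventually (gt_mem_nhds hη)).exists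
  exact ⟨1 / ((k : ℝ) + 1), by positivity, hk.le⟩

/-- This reduces the uncountably many directions `v` to finitely many sets, by compactness of the
unit sphere. The tolerance `τ` is there so that a centre may later be replaced by a nearby net
point. -/
theorem exists_finite_cover_sublevel {r N : ℕ} (e : GradedEnum r N) (C : ℝ) {η : ℝ≥0∞}
    (hη : 0 < η) :
    ∃ ε > (0 : ℝ), ∃ τ > (0 : ℝ), ∃ Z : Finset (Set (EuclideanSpace ℝ (Fin r))),
      (∀ B ∈ Z, MeasurableSet B ∧ volume B ≤ η) ∧
      ∀ v : Fin ((N + r).choose r) → ℝ, ∑ a, v a ^ 2 = 1 → ∃ B ∈ Z,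
        ∀ y z, ‖y‖ ≤ C → ‖z - y‖ ≤ τ → |monomialVec e y ⬝ᵥ v| ≤ ε → z ∈ B := by
  classical
  have hK : IsCompact {v : Fin ((N + r).choose r) → ℝ | ∑ a, v a ^ 2 = 1} := by
    refine Metric.isCompact_of_isClosed_isBounded (isClosed_eq (by fun_prop) continuous_const) ?_
    refine Metric.isBounded_closedBall (x := 0) (r := 1) |>.subset fun v hv => ?_
    rw [mem_closedBall_zero_iff, pi_norm_le_iff_of_nonneg zero_le_one]
    intro a
    have h1 : v a ^ 2 ≤ 1 := by
      rw [← (hv : ∑ a, v a ^ 2 = 1)]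
      exact Finset.single_le_sum (f := fun a => v a ^ 2) (fun _ _ => sq_nonneg _) (Finset.mem_univ a)
    rw [Real.norm_eq_abs]
    exact abs_le_one_iff_mul_self_le_one.2 (by rwa [← sq])
  refine hK.induction_on (p := fun S => ∃ ε > (0 : ℝ), ∃ τ > (0 : ℝ),
      ∃ Z : Finset (Set (EuclideanSpace ℝ (Fin r))),
      (∀ B ∈ Z, MeasurableSet B ∧ volume B ≤ η) ∧ ∀ v ∈ S, ∃ B ∈ Z,
        ∀ y z, ‖y‖ ≤ C → ‖z - y‖ ≤ τ → |monomialVec e y ⬝ᵥ v| ≤ ε → z ∈ B) ?_ ?_ ?_ ?_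
  · exact ⟨1, one_pos, 1, one_pos, ∅, by simp, by simp⟩
  · rintro S T hST ⟨ε, hε, τ, hτ, Z, h1, h2⟩
    exact ⟨ε, hε, τ, hτ, Z, h1, fun v hv => h2 v (hST hv)⟩
  · rintro S T ⟨ε, hε, τ, hτ, Z, h1, h2⟩ ⟨ε', hε', τ', hτ', Z', h1', h2'⟩
    refine ⟨min ε ε', lt_min hε hε', min τ τ', lt_min hτ hτ', Z ∪ Z', ?_, ?_⟩
    · intro B hB
      rcases Finset.mem_union.1 hB with h | h
      exacts [h1 B h, h1' B h]
    · rintro v (hv | hv)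
      · obtain ⟨B, hB, h⟩ := h2 v hv
        exact ⟨B, Finset.mem_union_left _ hB, fun y z hy hz hP =>
          h y z hy (hz.trans (min_le_left _ _)) (hP.trans (min_le_left _ _))⟩
      · obtain ⟨B, hB, h⟩ := h2' v hv
        exact ⟨B, Finset.mem_union_right _ hB, fun y z hy hz hP =>
          h y z hy (hz.trans (min_le_right _ _)) (hP.trans (min_le_right _ _))⟩
  · intro v hv
    have hv0 : v ≠ 0 := by rintro rfl; simp at hv
    obtain ⟨ε₀, hε₀, hvol⟩ := exists_volume_sublevel_le e hv0 (C + 1) hη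
    have hcont := continuous_monomialVec_dotProduct e
    have hc : Continuous fun y => monomialVec e y ⬝ᵥ v :=
      hcont.comp (by fun_prop : Continuous fun y => (v, y))
    have hcomp := isCompact_closedBall (0 : EuclideanSpace ℝ (Fin r)) (C + 1)
    have huc := hcomp.uniformContinuousOn_of_continuous hc.continuousOn
    obtain ⟨τ, hτ, hτ'⟩ := Metric.uniformContinuousOn_iff.1 huc (ε₀ / 3) (by positivity)
    have hev : ∀ᶠ w in 𝓝 v, ∀ y ∈ Metric.closedBall (0 : EuclideanSpace ℝ (Fin r)) (C + 1),
        |monomialVec e y ⬝ᵥ w - monomialVec e y ⬝ᵥ v| < ε₀ / 3 := by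
      refine hcomp.eventually_forall_of_forall_eventually fun y _ => ?_
      have : Continuous fun z : (Fin ((N + r).choose r) → ℝ) × EuclideanSpace ℝ (Fin r) =>
          |monomialVec e z.2 ⬝ᵥ z.1 - monomialVec e z.2 ⬝ᵥ v| :=
        (hcont.sub (hc.comp continuous_snd)).abs
      refine this.continuousAt.eventually (gt_mem_nhds ?_)
      simpa using by positivity
    -- The level `ε₀` is split in three: the new level, the change of `v`, and the displacement of
    -- the point. Halving `τ` gives the strict inequality of uniform continuity, and the cap `1`
    -- keeps the displaced point in the ball of radius `C + 1`.
    refine ⟨_, mem_nhdsWithin_of_mem_nhds hev, ε₀ / 3, by positivity, min (τ / 2) 1,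
      lt_min (by positivity) one_pos,
      {{y | y ∈ Metric.closedBall 0 (C + 1) ∧ |monomialVec e y ⬝ᵥ v| ≤ ε₀}}, ?_, ?_⟩
    · intro B hB
      rw [Finset.mem_singleton.1 hB]
      exact ⟨((Metric.isClosed_closedBall).inter
        (isClosed_le hc.abs continuous_const)).measurableSet, hvol⟩
    · intro w hw
      refine ⟨_, Finset.mem_singleton_self _, fun y z hy hz hP => ?_⟩
      have hzC : z ∈ Metric.closedBall (0 : EuclideanSpace ℝ (Fin r)) (C + 1) := by
        rw [mem_closedBall_zero_iff]
        calc ‖z‖ = ‖y + (z - y)‖ := by congr 1; abel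
          _ ≤ ‖y‖ + ‖z - y‖ := norm_add_le _ _
          _ ≤ C + 1 := add_le_add hy (hz.trans (min_le_right _ _))
      have hyC : y ∈ Metric.closedBall (0 : EuclideanSpace ℝ (Fin r)) (C + 1) := by
        rw [mem_closedBall_zero_iff]; linarith
      have h1 := hτ' z hzC y hyC (by
        rw [dist_eq_norm]; linarith [hz.trans (min_le_left _ _)])
      have h2 := hw y hyC
      rw [Real.dist_eq] at h1
      refine ⟨hzC, ?_⟩
      rw [abs_lt] at h1 h2
      rw [abs_le] at hP ⊢
      constructor <;> linarith [hP.1, hP.2, h1.1, h1.2, h2.1, h2.2]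

/-! ### Masses of small balls and nets -/

section Geometry

variable {r : ℕ}

/-- The homothety of ratio `t` centred at `x` sends `A` into the intersection and multiplies volume
by `t ^ r`. Boundary points thus need no separate treatment. -/
theorem Convex.volume_inter_closedBall_ge {A : Set (EuclideanSpace ℝ (Fin r))} (hA : Convex ℝ A)
    {R : ℝ} {x : EuclideanSpace ℝ (Fin r)} (hx : x ∈ A) (hR : ∀ y ∈ A, dist y x ≤ R) {t : ℝ}
    (ht0 : 0 ≤ t) (ht1 : t ≤ 1) :
    ENNReal.ofReal (t ^ r) * volume A ≤ volume (Metric.closedBall x (t * R) ∩ A) := by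
  have h := Measure.addHaar_image_homothety (volume : Measure (EuclideanSpace ℝ (Fin r))) x t A
  rw [finrank_euclideanSpace, Fintype.card_fin, abs_of_nonneg (pow_nonneg ht0 r)] at h
  rw [← h]
  refine measure_mono ?_
  rintro _ ⟨y, hy, rfl⟩
  constructor
  · rw [Metric.mem_closedBall, AffineMap.homothety_apply, vsub_eq_sub, vadd_eq_add, dist_eq_norm,
      add_sub_cancel_right, norm_smul, Real.norm_of_nonneg ht0,
      ← dist_eq_norm]
    exact mul_le_mul_of_nonneg_left (hR y hy) ht0
  · rw [AffineMap.homothety_eq_lineMap]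
    exact hA.lineMap_mem hx hy ⟨ht0, ht1⟩

/-- A separated set of maximal cardinality is a net. Its balls of radius `ε / 2` are disjoint and
each has mass at least `κ`, which bounds the cardinality. -/
theorem exists_finset_net {A : Set (EuclideanSpace ℝ (Fin r))}
    (ν : Measure (EuclideanSpace ℝ (Fin r))) [IsProbabilityMeasure ν] {κ ε : ℝ} (hκ : 0 < κ)
    (hν : ∀ x ∈ A, κ ≤ ν.real (Metric.closedBall x (ε / 2))) :
    ∃ T : Finset (EuclideanSpace ℝ (Fin r)), (T : Set (EuclideanSpace ℝ (Fin r))) ⊆ A ∧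
      (T.card : ℝ) ≤ 1 / κ ∧ ∀ x ∈ A, ∃ y ∈ T, dist x y ≤ ε := by
  classical
  let P : Finset (EuclideanSpace ℝ (Fin r)) → Prop := fun T =>
    (T : Set (EuclideanSpace ℝ (Fin r))) ⊆ A ∧ (T : Set (EuclideanSpace ℝ (Fin r))).Pairwise fun x y => ε < dist x y
  have hcard : ∀ T, P T → (T.card : ℝ) ≤ 1 / κ := by
    rintro T ⟨hTA, hT⟩
    have hdisj : (T : Set (EuclideanSpace ℝ (Fin r))).PairwiseDisjoint
        fun x : EuclideanSpace ℝ (Fin r) => Metric.closedBall x (ε / 2) := by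
      intro x hx y hy hxy
      exact Metric.closedBall_disjoint_closedBall (by linarith [hT hx hy hxy])
    have h1 := measureReal_biUnion_finset (μ := ν) hdisj
      (fun x _ => Metric.isClosed_closedBall.measurableSet)
    have h2 : ∑ x ∈ T, κ ≤ ∑ x ∈ T, ν.real (Metric.closedBall x (ε / 2)) :=
      Finset.sum_le_sum fun x hx => hν x (hTA hx)
    rw [← h1, Finset.sum_const, nsmul_eq_mul] at h2
    rw [le_div_iff₀ hκ]
    exact h2.trans measureReal_le_one
  let N := {k : ℕ | ∃ T, P T ∧ T.card = k}
  have hN : N.Nonempty := ⟨0, ∅, ⟨by simp, by simp⟩, by simp⟩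
  have hNb : BddAbove N := by
    refine ⟨⌊1 / κ⌋₊, ?_⟩
    rintro k ⟨T, hT, rfl⟩
    exact Nat.le_floor (hcard T hT)
  obtain ⟨T, hT, hTc⟩ := Nat.sSup_mem hN hNb
  refine ⟨T, hT.1, hcard T hT, fun x hx => ?_⟩
  by_contra! hno
  by_cases hxT : x ∈ T
  · have h1 := hno x hxT
    -- A negative `ε` would make the balls empty, against `κ > 0`.
    have h2 : ¬ (ε < 0) := by
      intro hε
      have := hν x hx
      rw [Metric.closedBall_eq_empty.2 (by linarith)] at this
      simp at this
      linarith
    rw [dist_self] at h1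
    exact h2 h1
  · have hP : P (insert x T) := by
      refine ⟨by simpa [Set.insert_subset_iff] using ⟨hx, hT.1⟩, ?_⟩
      rw [Finset.coe_insert]
      refine hT.2.insert_of_notMem (by simpa using hxT) fun y hy => ⟨hno y hy, ?_⟩
      rw [dist_comm]; exact hno y hy
    have h3 : (insert x T).card ≤ sSup N := le_csSup hNb ⟨_, hP, rfl⟩
    rw [Finset.card_insert_of_notMem hxT, hTc] at h3
    omega

end Geometry

section Density

variable {r : ℕ} {A : Set (EuclideanSpace ℝ (Fin r))} {f : EuclideanSpace ℝ (Fin r) → ℝ} {c C : ℝ}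

theorem withDensity_restrict_le (hA : MeasurableSet A) (hf : ∀ x ∈ A, f x ≤ C)
    {S : Set (EuclideanSpace ℝ (Fin r))} (hS : MeasurableSet S) :
    ((volume.restrict A).withDensity fun x => ENNReal.ofReal (f x)) S
      ≤ ENNReal.ofReal C * volume S := by
  rw [withDensity_apply _ hS, Measure.restrict_restrict hS]
  calc ∫⁻ x in S ∩ A, ENNReal.ofReal (f x) ≤ ∫⁻ _ in S ∩ A, ENNReal.ofReal C :=
        setLIntegral_mono' (hS.inter hA) fun x hx => ENNReal.ofReal_le_ofReal (hf x hx.2)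
    _ = ENNReal.ofReal C * volume (S ∩ A) := setLIntegral_const _ _
    _ ≤ _ := by gcongr; exact Set.inter_subset_left

theorem le_withDensity_restrict (hA : MeasurableSet A) (hf : ∀ x ∈ A, c ≤ f x)
    {S : Set (EuclideanSpace ℝ (Fin r))} (hS : MeasurableSet S) :
    ENNReal.ofReal c * volume (S ∩ A) ≤
      ((volume.restrict A).withDensity fun x => ENNReal.ofReal (f x)) S := by
  rw [withDensity_apply _ hS, Measure.restrict_restrict hS, ← setLIntegral_const]
  exact setLIntegral_mono' (hS.inter hA) fun x hx => ENNReal.ofReal_le_ofReal (hf x hx.2)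

/-- Homotheties of `A` of ratio `s / R` give the volume bound, and the lower bound on the density
turns it into mass. `A` has positive volume because it carries a probability law with a density. -/
theorem exists_measure_closedBall_ge (hcpt : IsCompact A) (hconv : Convex ℝ A) (hc : 0 < c)
    (hf : ∀ x ∈ A, c ≤ f x) {ν : Measure (EuclideanSpace ℝ (Fin r))} [IsProbabilityMeasure ν]
    (hν : ν = (volume.restrict A).withDensity fun x => ENNReal.ofReal (f x)) :
    ∃ κ > (0 : ℝ), ∃ s₀ > (0 : ℝ), ∀ x ∈ A, ∀ s, 0 ≤ s → s ≤ s₀ →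
      κ * s ^ r ≤ ν.real (Metric.closedBall x s) := by
  have hA := hcpt.isClosed.measurableSet
  have hvol : volume A ≠ 0 := by
    intro h0
    have h1 : ν Set.univ = 1 := measure_univ
    rw [hν, Measure.restrict_zero_set h0] at h1
    simp at h1
  have hvol' : volume A ≠ ⊤ := hcpt.measure_lt_top.ne
  set R := Metric.diam A + 1
  have hR : 0 < R := by have := Metric.diam_nonneg (s := A); positivity
  have hpos : 0 < (volume A).toReal := ENNReal.toReal_pos hvol hvol'
  refine ⟨c * (volume A).toReal / R ^ r, by positivity, R, hR, fun x hx s hs0 hs => ?_⟩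
  have h1 := hconv.volume_inter_closedBall_ge hx (R := R) (fun y hy => by
    have := Metric.dist_le_diam_of_mem hcpt.isBounded hy hx
    simp only [R]; linarith) (t := s / R) (by positivity) (by rwa [div_le_one hR])
  rw [div_mul_cancel₀ _ hR.ne'] at h1
  have h2 := le_withDensity_restrict hA hf (S := Metric.closedBall x s)
    Metric.isClosed_closedBall.measurableSet
  rw [← hν] at h2
  have h3 : ENNReal.ofReal c * (ENNReal.ofReal ((s / R) ^ r) * volume A)
      ≤ ν (Metric.closedBall x s) := le_trans (by gcongr) h2
  have h4 := ENNReal.toReal_mono (measure_ne_top _ _) h3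
  rw [ENNReal.toReal_mul, ENNReal.toReal_mul, ENNReal.toReal_ofReal hc.le,
    ENNReal.toReal_ofReal (by positivity)] at h4
  calc c * (volume A).toReal / R ^ r * s ^ r = c * ((s / R) ^ r * (volume A).toReal) := by
        rw [div_pow]; ring
    _ ≤ _ := h4

end Density

/-! ### Chernoff bounds for counts -/

section Concentration

variable {Ω : Type*} [MeasurableSpace Ω] {μ : Measure Ω} {n : ℕ} {E : Type*} [MeasurableSpace E]
  {X : Fin n → Ω → E} {ν : Measure E}

/-- The number of sample points in `S`. -/
noncomputable def countIn (X : Fin n → Ω → E) (S : Set E) (ω : Ω) : ℝ :=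
  ∑ j, S.indicator (fun _ => (1 : ℝ)) (X j ω)

/-- The count is binomial, and its moment generating function is dominated by the Poisson one
through `1 + x ≤ exp x`. -/
theorem mgf_countIn_le [IsProbabilityMeasure μ] (hX : ∀ j, Measurable (X j)) (hind : iIndepFun X μ)
    (hν : ∀ j, μ.map (X j) = ν) {S : Set E} (hS : MeasurableSet S) (t : ℝ) :
    mgf (countIn X S) μ t ≤ Real.exp (n * (ν.real S * (Real.exp t - 1))) := by
  have hg : Measurable (S.indicator fun _ => (1 : ℝ)) := measurable_const.indicator hS
  have hind' := hind.comp (fun _ => S.indicator fun _ => (1 : ℝ)) fun _ => hg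
  have hsum : countIn X S = ∑ j, (S.indicator fun _ => (1 : ℝ)) ∘ X j := by
    ext ω; simp [countIn]
  rw [hsum, hind'.mgf_sum (fun j => hg.comp (hX j))]
  have h1 : ∀ j, mgf ((S.indicator fun _ => (1 : ℝ)) ∘ X j) μ t
      ≤ Real.exp (ν.real S * (Real.exp t - 1)) := by
    intro j
    have hpre : MeasurableSet (X j ⁻¹' S) := hX j hS
    have h2 : (fun ω => Real.exp (t * ((S.indicator fun _ => (1 : ℝ)) ∘ X j) ω))
        = fun ω => (X j ⁻¹' S).indicator (fun _ => Real.exp t - 1) ω + 1 := by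
      ext ω
      by_cases h : X j ω ∈ S <;> simp [Set.indicator, h]
    have h3 : ν.real S = μ.real (X j ⁻¹' S) := by
      rw [← hν j, map_measureReal_apply (hX j) hS]
    rw [mgf, h2, integral_add ((integrable_const _).indicator hpre) (integrable_const _),
      integral_indicator_const _ hpre, h3]
    simp only [smul_eq_mul, integral_const, probReal_univ, mul_one]
    exact Real.add_one_le_exp _
  calc ∏ j, mgf ((S.indicator fun _ => (1 : ℝ)) ∘ X j) μ t
      ≤ ∏ _j : Fin n, Real.exp (ν.real S * (Real.exp t - 1)) :=
        Finset.prod_le_prod (fun j _ => mgf_nonneg) fun j _ => h1 j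
    _ = _ := by rw [Finset.prod_const, Finset.card_univ, Fintype.card_fin, ← Real.exp_nat_mul]

theorem measurable_countIn (hX : ∀ j, Measurable (X j)) {S : Set E} (hS : MeasurableSet S) :
    Measurable (countIn X S) := by
  unfold countIn
  exact Finset.measurable_sum _ fun j _ => (measurable_const.indicator hS).comp (hX j)

theorem integrable_exp_mul_countIn [IsProbabilityMeasure μ] (hX : ∀ j, Measurable (X j)) {S : Set E}
    (hS : MeasurableSet S) (t : ℝ) : Integrable (fun ω => Real.exp (t * countIn X S ω)) μ := by
  refine Integrable.of_bound
    ((measurable_const.mul (measurable_countIn hX hS)).exp.aestronglyMeasurable)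
    (Real.exp (|t| * n)) (ae_of_all _ fun ω => ?_)
  rw [Real.norm_of_nonneg (Real.exp_pos _).le, Real.exp_le_exp]
  have h1 : |countIn X S ω| ≤ n := by
    calc |countIn X S ω| ≤ ∑ j : Fin n, |S.indicator (fun _ => (1 : ℝ)) (X j ω)| :=
          Finset.abs_sum_le_sum_abs _ _
      _ ≤ ∑ j : Fin n, (1 : ℝ) := Finset.sum_le_sum fun j _ => by
          by_cases h : X j ω ∈ S <;> simp [h]
      _ = n := by simp
  calc t * countIn X S ω ≤ |t * countIn X S ω| := le_abs_self _
    _ = |t| * |countIn X S ω| := abs_mul _ _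
    _ ≤ |t| * n := by gcongr

/-- Chernoff at `t = 1`: since `exp 1 - 1 ≤ 2`, the exponent is at most `-k/2 + 2 (k/8) = -k/4`. -/
theorem measure_half_le_countIn_le [IsProbabilityMeasure μ] (hX : ∀ j, Measurable (X j))
    (hind : iIndepFun X μ) (hν : ∀ j, μ.map (X j) = ν) {S : Set E} (hS : MeasurableSet S) {k : ℝ}
    (hk : n * ν.real S ≤ k / 8) :
    μ.real {ω | k / 2 ≤ countIn X S ω} ≤ Real.exp (-(k / 4)) := by
  refine (measure_ge_le_exp_mul_mgf (k / 2) zero_le_one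
    (integrable_exp_mul_countIn hX hS 1)).trans ?_
  refine (mul_le_mul_of_nonneg_left (mgf_countIn_le hX hind hν hS 1) (Real.exp_pos _).le).trans ?_
  rw [← Real.exp_add, Real.exp_le_exp]
  have h1 : Real.exp 1 - 1 ≤ 2 := by have := Real.exp_one_lt_d9; linarith
  have h2 : 0 ≤ n * ν.real S := by positivity
  nlinarith [mul_le_mul_of_nonneg_left h1 h2]

/-- Chernoff at `t = -1`: since `exp (-1) ≤ 1/2`, the exponent is at most `k - (4k)/2 = -k`. -/
theorem measure_countIn_le_le [IsProbabilityMeasure μ] (hX : ∀ j, Measurable (X j))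
    (hind : iIndepFun X μ) (hν : ∀ j, μ.map (X j) = ν) {S : Set E} (hS : MeasurableSet S) {k : ℝ}
    (hk : 4 * k ≤ n * ν.real S) :
    μ.real {ω | countIn X S ω ≤ k} ≤ Real.exp (-k) := by
  refine (measure_le_le_exp_mul_mgf k (by norm_num : (-1 : ℝ) ≤ 0)
    (integrable_exp_mul_countIn hX hS (-1))).trans ?_
  refine (mul_le_mul_of_nonneg_left (mgf_countIn_le hX hind hν hS (-1)) (Real.exp_pos _).le).trans ?_
  rw [← Real.exp_add, Real.exp_le_exp]
  have h1 : Real.exp (-1) ≤ 1 / 2 := by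
    rw [Real.exp_neg, one_div]
    exact inv_anti₀ two_pos (by have := Real.add_one_le_exp (1 : ℝ); linarith)
  have h2 : 0 ≤ n * ν.real S := by positivity
  nlinarith [mul_le_mul_of_nonneg_left h1 h2]

end Concentration

theorem countIn_mono {Ω E : Type*} {n : ℕ} (X : Fin n → Ω → E) {S S' : Set E} (h : S ⊆ S') (ω : Ω) :
    countIn X S ω ≤ countIn X S' ω :=
  Finset.sum_le_sum fun j _ =>
    Set.indicator_le_indicator_of_subset h (fun _ => zero_le_one) (X j ω)

theorem measure_biUnion_finset_le_ofReal {Ω ι : Type*} [MeasurableSpace Ω] {μ : Measure Ω}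
    [IsProbabilityMeasure μ] (T : Finset ι) (B : ι → Set Ω) {b c : ℝ} (hb : 0 ≤ b)
    (h : ∀ s ∈ T, μ.real (B s) ≤ b) (hT : (T.card : ℝ) ≤ c) :
    μ (⋃ s ∈ T, B s) ≤ ENNReal.ofReal (c * b) := by
  calc μ (⋃ s ∈ T, B s) ≤ ∑ s ∈ T, μ (B s) := measure_biUnion_finset_le _ _
    _ ≤ ∑ s ∈ T, ENNReal.ofReal b := Finset.sum_le_sum fun s hs => by
        rw [← ofReal_measureReal]; exact ENNReal.ofReal_le_ofReal (h s hs)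
    _ = ENNReal.ofReal (T.card * b) := by
        rw [Finset.sum_const, nsmul_eq_mul, ENNReal.ofReal_mul (by positivity),
          ENNReal.ofReal_natCast]
    _ ≤ _ := ENNReal.ofReal_le_ofReal (by gcongr)

theorem WPA1.of_eventually_le_ofReal {Ω : ℕ → Type*} [∀ n, MeasurableSpace (Ω n)]
    {μ : ∀ n, Measure (Ω n)} {S : ∀ n, Set (Ω n)} {g : ℕ → ℝ} (hg : Tendsto g atTop (𝓝 0))
    (h : ∀ᶠ n in atTop, μ n (S n)ᶜ ≤ ENNReal.ofReal (g n)) : WPA1 μ S := by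
  have h1 : Tendsto (fun n => ENNReal.ofReal (g n)) atTop (𝓝 0) := by
    simpa [Function.comp_def] using (ENNReal.continuous_ofReal.tendsto 0).comp hg
  exact tendsto_of_tendsto_of_tendsto_of_le_of_le' tendsto_const_nhds h1
    (Eventually.of_forall fun _ => zero_le) h

/-- A triangular array of i.i.d. samples from a law `ν` that is comparable with Lebesgue measure
on `A`, observed on balls of radius `h n` with `n h_n^r = K_n` of larger order than `log n`. -/
structure LocalSampling {Ω : ℕ → Type*} [∀ n, MeasurableSpace (Ω n)] {r : ℕ}
    (μ : ∀ n, Measure (Ω n)) (α : ∀ n, Fin n → Ω n → EuclideanSpace ℝ (Fin r))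
    (A : Set (EuclideanSpace ℝ (Fin r))) (ν : Measure (EuclideanSpace ℝ (Fin r)))
    (K : ℕ → ℕ) (h : ℕ → ℝ) : Prop where
  measurable : ∀ n i, Measurable (α n i)
  indep : ∀ n, iIndepFun (α n) (μ n)
  law : ∀ n i, (μ n).map (α n i) = ν
  le_volume : ∃ C : ℝ, 0 < C ∧ ∀ S, MeasurableSet S → ν S ≤ ENNReal.ofReal C * volume S
  closedBall_ge : ∃ κ > (0 : ℝ), ∃ s₀ > (0 : ℝ), ∀ x ∈ A, ∀ s, 0 ≤ s → s ≤ s₀ →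
      κ * s ^ r ≤ ν.real (Metric.closedBall x s)
  one_le : ∀ n, 0 < n → 1 ≤ K n
  pos : ∀ n, 0 < n → 0 < h n
  pow_eq : ∀ n, 0 < n → h n ^ r = (K n : ℝ) / n
  tendsto_h : Tendsto h atTop (𝓝 0)
  tendsto_exp : Tendsto (fun n : ℕ => (n : ℝ) * Real.exp (-((K n : ℝ) / 4))) atTop (𝓝 0)

/-! ### Counts of sample points, uniform over centres and polynomials -/

namespace LocalSampling

variable {Ω : ℕ → Type*} [∀ n, MeasurableSpace (Ω n)] {r : ℕ}
  {μ : ∀ n, Measure (Ω n)} {α : ∀ n, Fin n → Ω n → EuclideanSpace ℝ (Fin r)}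
  {A : Set (EuclideanSpace ℝ (Fin r))} {ν : Measure (EuclideanSpace ℝ (Fin r))}
  {K : ℕ → ℕ} {h : ℕ → ℝ}

/-- A ball of radius of order `h` has mass of order at least `K / n ≥ 1 / n`, so a net of this
spacing has `O(n)` points. This is the factor `n` in the union bounds below. -/
theorem eventually_exists_net [IsProbabilityMeasure ν] (L : LocalSampling μ α A ν K h) {τ : ℝ}
    (hτ : 0 < τ) : ∃ c : ℝ, 0 < c ∧ ∀ᶠ n : ℕ in atTop,
      ∃ T : Finset (EuclideanSpace ℝ (Fin r)), (T : Set (EuclideanSpace ℝ (Fin r))) ⊆ A ∧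
        (T.card : ℝ) ≤ c * n ∧ ∀ x ∈ A, ∃ y ∈ T, dist x y ≤ τ * h n := by
  obtain ⟨κ, hκ, s₀, hs₀, hball⟩ := L.closedBall_ge
  refine ⟨1 / (κ * (τ / 2) ^ r), by positivity, ?_⟩
  have hlim : Tendsto (fun n => τ * h n / 2) atTop (𝓝 0) := by
    simpa using (L.tendsto_h.const_mul τ).div_const 2
  filter_upwards [eventually_gt_atTop 0, hlim.eventually (gt_mem_nhds hs₀)] with n hn hsmall
  have hh := L.pos n hn
  have hK : (1 : ℝ) ≤ K n := by exact_mod_cast L.one_le n hn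
  have hn' : (0 : ℝ) < n := by exact_mod_cast hn
  obtain ⟨T, h1, h2, h3⟩ := exists_finset_net (A := A) ν (κ := κ * (τ * h n / 2) ^ r)
    (ε := τ * h n) (by positivity) fun x hx => hball x hx _ (by positivity) hsmall.le
  refine ⟨T, h1, h2.trans ?_, h3⟩
  have h4 : κ * (τ * h n / 2) ^ r = κ * (τ / 2) ^ r * (K n / n) := by
    rw [← L.pow_eq n hn, mul_assoc, ← mul_pow]; congr 2; ring
  rw [h4, div_le_iff₀ (by positivity)]
  have h5 : 1 / (κ * (τ / 2) ^ r) * n * (κ * (τ / 2) ^ r * (K n / n)) = K n := by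
    field_simp
  rw [h5]; exact hK

/-- The ball of radius `2 R h` about `x` contains the ball of radius `R h` about a net point, so the
lower-tail bound is needed only on the net. -/
theorem wpa1_lt_countIn [∀ n, IsProbabilityMeasure (μ n)] [IsProbabilityMeasure ν] (hr : 1 ≤ r)
    (L : LocalSampling μ α A ν K h) :
    ∃ D : ℝ, 0 < D ∧ WPA1 μ fun n =>
      {ω | ∀ x ∈ A, (K n : ℝ) < countIn (α n) (Metric.closedBall x (D * h n)) ω} := by
  obtain ⟨κ, hκ, s₀, hs₀, hball⟩ := L.closedBall_ge
  -- As `R ≥ 1` and `r ≥ 1`, `κ R ^ r ≥ κ R ≥ 4`: balls of radius `R h` have mass at least `4 K /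
  -- n`, as the lower-tail bound requires.
  set R : ℝ := max 1 (4 / κ)
  have hR1 : 1 ≤ R := le_max_left _ _
  have hR : 0 < R := by linarith
  have hRr : 4 ≤ κ * R ^ r := by
    have h1 : R ≤ R ^ r := le_self_pow₀ hR1 (by omega)
    have h2 : 4 / κ ≤ R := le_max_right _ _
    rw [div_le_iff₀ hκ] at h2
    nlinarith
  obtain ⟨c, hc, hnet⟩ := L.eventually_exists_net hR
  have hlim : Tendsto (fun n => R * h n) atTop (𝓝 0) := by
    simpa using L.tendsto_h.const_mul R
  refine ⟨2 * R, by positivity, WPA1.of_eventually_le_ofReal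
    (g := fun n => c * ((n : ℝ) * Real.exp (-((K n : ℝ) / 4))))
    (by simpa using L.tendsto_exp.const_mul c) ?_⟩
  filter_upwards [eventually_gt_atTop 0, hlim.eventually (gt_mem_nhds hs₀), hnet]
    with n hn hsmall ⟨T, hTA, hTc, hT⟩
  have hh := L.pos n hn
  have hn' : (0 : ℝ) < n := by exact_mod_cast hn
  rw [← mul_assoc]
  refine (measure_mono ?_).trans (measure_biUnion_finset_le_ofReal T
    (fun y => {ω | countIn (α n) (Metric.closedBall y (R * h n)) ω ≤ K n})
    (Real.exp_pos _).le (fun y hy => ?_) hTc)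
  · intro ω hω
    simp only [Set.mem_compl_iff, Set.mem_ofPred_eq, not_forall, not_lt] at hω
    obtain ⟨x, hx, hle⟩ := hω
    obtain ⟨y, hy, hxy⟩ := hT x hx
    simp only [Set.mem_iUnion]
    refine ⟨y, hy, (countIn_mono _ (fun z hz => ?_) ω).trans hle⟩
    rw [Metric.mem_closedBall] at hz ⊢
    calc dist z x ≤ dist z y + dist y x := dist_triangle _ _ _
      _ ≤ R * h n + R * h n := by rw [dist_comm y x]; gcongr
      _ = 2 * R * h n := by ring
  · refine (measure_countIn_le_le (L.measurable n) (L.indep n) (L.law n)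
      Metric.isClosed_closedBall.measurableSet (k := K n) ?_).trans ?_
    · have h1 := hball y (hTA hy) (R * h n) (by positivity) hsmall.le
      rw [mul_pow, L.pow_eq n hn] at h1
      calc 4 * (K n : ℝ) ≤ (κ * R ^ r) * K n := by gcongr
        _ = n * (κ * (R ^ r * (K n / n))) := by field_simp
        _ ≤ _ := by gcongr
    · rw [Real.exp_le_exp]
      have : (0 : ℝ) ≤ K n := by positivity
      linarith

/-- The union bound runs over pairs of a net point and a member of the finite cover. Uniformity in
`x` and `v` permits random centres and directions later on. -/
theorem wpa1_countIn_sublevel_lt [∀ n, IsProbabilityMeasure (μ n)] [IsProbabilityMeasure ν]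
    (L : LocalSampling μ α A ν K h) {N : ℕ} (e : GradedEnum r N) (C : ℝ) :
    ∃ ε : ℝ, 0 < ε ∧ WPA1 μ fun n =>
      {ω | ∀ x ∈ A, ∀ v : Fin ((N + r).choose r) → ℝ, ∑ a, v a ^ 2 = 1 →
        countIn (α n) {y | ‖(h n)⁻¹ • (y - x)‖ ≤ C ∧
          |monomialVec e ((h n)⁻¹ • (y - x)) ⬝ᵥ v| ≤ ε} ω < (K n : ℝ) / 2} := by
  obtain ⟨Cf, hCf, hvol⟩ := L.le_volume
  -- Shrinking by `h` multiplies the volume `1 / (8 Cf)` by `h ^ r = K / n`, so the mass is at most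
  -- `K / (8 n)`, the threshold of the upper-tail bound.
  obtain ⟨ε, hε, τ, hτ, Z, hZ, hcov⟩ := exists_finite_cover_sublevel e C
    (η := ENNReal.ofReal (1 / (8 * Cf))) (ENNReal.ofReal_pos.2 (by positivity))
  obtain ⟨c, hc, hnet⟩ := L.eventually_exists_net hτ
  refine ⟨ε, hε, WPA1.of_eventually_le_ofReal
    (g := fun n => (c * Z.card) * ((n : ℝ) * Real.exp (-((K n : ℝ) / 4))))
    (by simpa using L.tendsto_exp.const_mul (c * Z.card)) ?_⟩
  filter_upwards [eventually_gt_atTop 0, hnet] with n hn ⟨T, hTA, hTc, hT⟩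
  have hh := L.pos n hn
  have hn' : (0 : ℝ) < n := by exact_mod_cast hn
  have hmeasf : ∀ y : EuclideanSpace ℝ (Fin r), Measurable fun z => (h n)⁻¹ • (z - y) := fun y =>
    by fun_prop
  rw [← mul_assoc]
  refine (measure_mono ?_).trans (measure_biUnion_finset_le_ofReal (T ×ˢ Z)
    (fun yB => {ω | (K n : ℝ) / 2 ≤ countIn (α n) ((fun z => (h n)⁻¹ • (z - yB.1)) ⁻¹' yB.2) ω})
    (Real.exp_pos _).le (fun yB hyB => ?_) (c := c * Z.card * n) ?_)
  · intro ω hω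
    simp only [Set.mem_compl_iff, Set.mem_ofPred_eq, not_forall, not_lt] at hω
    obtain ⟨x, hx, v, hv, hle⟩ := hω
    obtain ⟨y, hy, hxy⟩ := hT x hx
    obtain ⟨B, hB, hsub⟩ := hcov v hv
    simp only [Set.mem_iUnion]
    refine ⟨(y, B), Finset.mem_product.2 ⟨hy, hB⟩, hle.trans (countIn_mono _ (fun z hz => ?_) ω)⟩
    -- Replacing `x` by the net point `y` moves the rescaled point by `‖x - y‖ / h ≤ τ`.
    refine hsub _ _ hz.1 ?_ hz.2
    rw [← smul_sub, sub_sub_sub_cancel_left, norm_smul, norm_inv, Real.norm_of_nonneg hh.le,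
      ← dist_eq_norm, inv_mul_le_iff₀ hh, mul_comm]
    exact hxy
  · obtain ⟨hy, hB⟩ := Finset.mem_product.1 hyB
    refine measure_half_le_countIn_le (L.measurable n) (L.indep n) (L.law n)
      (hmeasf yB.1 (hZ _ hB).1) (k := K n) ?_
    have h1 := hvol _ (hmeasf yB.1 (hZ _ hB).1)
    have h2 : volume ((fun z => (h n)⁻¹ • (z - yB.1)) ⁻¹' yB.2)
        = ENNReal.ofReal (h n ^ r) * volume yB.2 := by
      have : (fun z => (h n)⁻¹ • (z - yB.1)) ⁻¹' yB.2
          = (fun z => z - yB.1) ⁻¹' ((fun z => (h n)⁻¹ • z) ⁻¹' yB.2) := rfl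
      rw [this, (measurePreserving_sub_right volume yB.1).measure_preimage
        ((measurable_const_smul _ (hZ _ hB).1).nullMeasurableSet),
        Measure.addHaar_preimage_smul _ (inv_ne_zero hh.ne'), finrank_euclideanSpace,
        Fintype.card_fin, inv_pow, inv_inv, abs_of_nonneg (by positivity)]
    have h3 : ν ((fun z => (h n)⁻¹ • (z - yB.1)) ⁻¹' yB.2) ≤
        ENNReal.ofReal (Cf * (h n ^ r * (1 / (8 * Cf)))) := by
      rw [ENNReal.ofReal_mul hCf.le, ENNReal.ofReal_mul (by positivity)]
      refine h1.trans ?_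
      rw [h2]
      gcongr
      exact (hZ _ hB).2
    have h4 := ENNReal.toReal_le_of_le_ofReal (by positivity) h3
    rw [L.pow_eq n hn] at h4
    calc n * ν.real ((fun z => (h n)⁻¹ • (z - yB.1)) ⁻¹' yB.2)
        ≤ n * (Cf * ((K n / n) * (1 / (8 * Cf)))) := by gcongr; exact h4
      _ = K n / 8 := by field_simp
  · rw [Finset.card_product]
    push_cast
    nlinarith [mul_le_mul_of_nonneg_right hTc (Nat.cast_nonneg (α := ℝ) Z.card)]

end LocalSampling

/-! ### Iterated partial derivatives and Taylor's formula -/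

section IteratedPartials

variable {r : ℕ} {A : Set (EuclideanSpace ℝ (Fin r))} {f : EuclideanSpace ℝ (Fin r) → ℝ} {N : ℕ}

/-- Iterated partial derivatives within `A` along a list of coordinates, the head of the list being
the outermost derivative. -/
noncomputable def listDeriv (A : Set (EuclideanSpace ℝ (Fin r))) (f : EuclideanSpace ℝ (Fin r) → ℝ) :
    List (Fin r) → EuclideanSpace ℝ (Fin r) → ℝ
  | [] => f
  | i :: l => fun x => fderivWithin ℝ (listDeriv A f l) A x (EuclideanSpace.single i 1)

theorem contDiffOn_listDeriv (hA : UniqueDiffOn ℝ A) (hf : ContDiffOn ℝ N f A) :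
    ∀ (l : List (Fin r)) (k : ℕ), l.length + k ≤ N → ContDiffOn ℝ k (listDeriv A f l) A
  | [], k, hk => hf.of_le (by simp at hk; exact_mod_cast hk)
  | i :: l, k, hk => by
    have h1 := contDiffOn_listDeriv hA hf l (k + 1) (by simp at hk; omega)
    have h2 : ContDiffOn ℝ k (fderivWithin ℝ (listDeriv A f l) A) A :=
      h1.fderivWithin hA (by norm_cast)
    exact h2.clm_apply contDiffOn_const

theorem iteratedFDerivWithin_single_eq_listDeriv (hA : UniqueDiffOn ℝ A)
    (hf : ContDiffOn ℝ N f A) : ∀ (k : ℕ), k ≤ N → ∀ (τ : Fin k → Fin r), ∀ x ∈ A,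
      iteratedFDerivWithin ℝ k f A x (fun j => EuclideanSpace.single (τ j) 1)
        = listDeriv A f (List.ofFn τ) x
  | 0, _, τ, x, _ => by simp [listDeriv]
  | k + 1, hk, τ, x, hx => by
    have ih := iteratedFDerivWithin_single_eq_listDeriv hA hf k (by omega) (fun j => τ j.succ)
    rw [iteratedFDerivWithin_succ_apply_left, List.ofFn_succ, listDeriv,
      ← fderivWithin_continuousMultilinear_apply_const_apply (hA x hx)
      (hf.differentiableOn_iteratedFDerivWithin (by exact_mod_cast hk) hA x hx)]
    congr 1
    exact fderivWithin_congr (fun y hy => ih y hy) (ih x hx)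

/-- Adjacent transpositions generate all permutations, so symmetry of second derivatives within `A`
suffices. That symmetry extends to boundary points because they are limits of interior points. -/
theorem listDeriv_perm (hA : UniqueDiffOn ℝ A) (hcl : A ⊆ closure (interior A))
    (hf : ContDiffOn ℝ N f A) {l l' : List (Fin r)} (h : l.Perm l') (hl : l.length ≤ N) :
    ∀ x ∈ A, listDeriv A f l x = listDeriv A f l' x := by
  induction h with
  | nil => intro x _; rfl
  | cons i _ ih =>
    intro x hx
    have ih' := ih (by simp at hl; omega)
    simp only [listDeriv]
    rw [fderivWithin_congr ih' (ih' x hx)]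
  | swap i j l =>
    intro x hx
    simp only [List.length_cons] at hl
    have h2 : ContDiffOn ℝ (2 : ℕ) (listDeriv A f l) A := contDiffOn_listDeriv hA hf l 2 (by omega)
    have hd : DifferentiableWithinAt ℝ (fderivWithin ℝ (listDeriv A f l) A) A x :=
      ((h2.fderivWithin (m := 1) hA (by norm_num)).differentiableOn (by norm_num)) x hx
    have hsymm := (h2 x hx).isSymmSndFDerivWithinAt (by simp) hA (hcl hx) hx
    simp only [listDeriv]
    rw [fderivWithin_clm_apply (hA x hx) hd (differentiableWithinAt_const _),
      fderivWithin_clm_apply (hA x hx) hd (differentiableWithinAt_const _)]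
    simpa using hsymm _ _
  | trans h1 _ ih1 ih2 =>
    intro x hx
    rw [ih1 hl x hx, ih2 (by rw [← h1.length_eq]; exact hl) x hx]

/-- The multi-index of a tuple of coordinates: how often each coordinate occurs. -/
def tupleContent {k : ℕ} (τ : Fin k → Fin r) (t : Fin r) : ℕ := (List.ofFn τ).count t

/-- The sorted list of coordinates with a given multi-index. -/
def multiIndexList (q : Fin r → ℕ) : List (Fin r) :=
  (List.finRange r).flatMap fun t => List.replicate (q t) t

theorem count_multiIndexList (q : Fin r → ℕ) (t : Fin r) : (multiIndexList q).count t = q t := by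
  rw [multiIndexList, List.count_flatMap]
  have h1 : (List.map (List.count t ∘ fun t => List.replicate (q t) t) (List.finRange r))
      = List.map (fun s => if s = t then q s else 0) (List.finRange r) := by
    refine List.map_congr_left fun s _ => ?_
    simp [List.count_replicate]
  rw [h1, ← List.ofFn_eq_map, List.sum_ofFn]
  simp

theorem length_multiIndexList (q : Fin r → ℕ) : (multiIndexList q).length = ∑ t, q t := by
  simp [multiIndexList, List.length_flatMap, ← List.ofFn_eq_map, List.sum_ofFn]

theorem multiIndexList_tupleContent_perm {k : ℕ} (τ : Fin k → Fin r) :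
    (List.ofFn τ).Perm (multiIndexList (tupleContent τ)) := by
  rw [List.perm_iff_count]
  intro t
  rw [count_multiIndexList]; rfl

theorem sum_tupleContent {k : ℕ} (τ : Fin k → Fin r) : ∑ t, tupleContent τ t = k := by
  rw [← length_multiIndexList, ← (multiIndexList_tupleContent_perm τ).length_eq, List.length_ofFn]

theorem tupleContent_get (q : Fin r → ℕ) :
    tupleContent (fun k => (multiIndexList q).get k) = q := by
  ext t
  rw [tupleContent]
  have : List.ofFn (fun k => (multiIndexList q).get k) = multiIndexList q := by
    simp [List.ofFn_getElem]
  rw [this, count_multiIndexList]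

theorem prod_eq_prod_pow_tupleContent {k : ℕ} (τ : Fin k → Fin r) (w : Fin r → ℝ) :
    ∏ j, w (τ j) = ∏ t, w t ^ tupleContent τ t := by
  have h1 : ∏ j, w (τ j) = ((List.ofFn τ).map w).prod := by
    rw [List.map_ofFn, List.prod_ofFn]; rfl
  rw [h1, Finset.prod_list_map_count, Finset.prod_subset (Finset.subset_univ _)]
  · rfl
  · intro t _ ht
    rw [List.mem_toFinset] at ht
    rw [List.count_eq_zero_of_not_mem ht, pow_zero]

theorem iteratedFDerivWithin_single_eq_partialDeriv (hA : UniqueDiffOn ℝ A)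
    (hcl : A ⊆ closure (interior A)) (hf : ContDiffOn ℝ N f A) {k : ℕ} (hk : k ≤ N)
    (τ : Fin k → Fin r) {x : EuclideanSpace ℝ (Fin r)} (hx : x ∈ A) :
    iteratedFDerivWithin ℝ k f A x (fun j => EuclideanSpace.single (τ j) 1)
      = partialDeriv A (tupleContent τ) f x := by
  have hp := multiIndexList_tupleContent_perm τ
  rw [iteratedFDerivWithin_single_eq_listDeriv hA hf k hk τ x hx,
    listDeriv_perm hA hcl hf hp (by simpa using hk) x hx, partialDeriv]
  have hlen : (multiIndexList (tupleContent τ)).length ≤ N := by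
    rw [length_multiIndexList, sum_tupleContent]; exact hk
  have h := iteratedFDerivWithin_single_eq_listDeriv hA hf _ hlen
    (fun j => (multiIndexList (tupleContent τ)).get j) x hx
  have h2 : List.ofFn (fun j => (multiIndexList (tupleContent τ)).get j)
      = multiIndexList (tupleContent τ) := by simp [List.ofFn_getElem]
  rw [h2] at h
  exact h.symm

/-- Expand `w` in the standard basis and use multilinearity; by symmetry each term depends on the
tuple only through its multi-index. -/
theorem iteratedFDerivWithin_diag_eq_sum (hA : UniqueDiffOn ℝ A)
    (hcl : A ⊆ closure (interior A)) (hf : ContDiffOn ℝ N f A) {k : ℕ} (hk : k ≤ N)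
    {x : EuclideanSpace ℝ (Fin r)} (hx : x ∈ A) (w : EuclideanSpace ℝ (Fin r)) :
    iteratedFDerivWithin ℝ k f A x (fun _ => w)
      = ∑ τ : Fin k → Fin r,
        (∏ t, w t ^ tupleContent τ t) * partialDeriv A (tupleContent τ) f x := by
  have hw : w = ∑ i, w i • EuclideanSpace.single i (1 : ℝ) := by
    ext t
    simp [Finset.sum_apply, Pi.single_apply]
  conv_lhs => rw [hw]
  rw [ContinuousMultilinearMap.map_sum]
  refine Finset.sum_congr rfl fun τ _ => ?_
  rw [ContinuousMultilinearMap.map_smul_univ,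
    iteratedFDerivWithin_single_eq_partialDeriv hA hcl hf hk τ hx,
    prod_eq_prod_pow_tupleContent τ (fun i => w i), smul_eq_mul]

theorem abs_prod_pow_le {q : Fin r → ℕ} {k : ℕ} (hq : ∑ t, q t = k)
    (w : EuclideanSpace ℝ (Fin r)) : |∏ t, w t ^ q t| ≤ ‖w‖ ^ k := by
  rw [Finset.abs_prod, ← hq, ← Finset.prod_pow_eq_pow_sum]
  refine Finset.prod_le_prod (fun _ _ => abs_nonneg _) fun t _ => ?_
  rw [abs_pow]
  gcongr
  exact PiLp.norm_apply_le w t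

theorem abs_iteratedFDerivWithin_diag_le (hA : UniqueDiffOn ℝ A)
    (hcl : A ⊆ closure (interior A)) (hf : ContDiffOn ℝ N f A) {B : ℝ}
    (hB : ∀ x ∈ A, ∀ q : Fin r → ℕ, ∑ t, q t ≤ N → |partialDeriv A q f x| ≤ B) {k : ℕ} (hk : k ≤ N)
    {x : EuclideanSpace ℝ (Fin r)} (hx : x ∈ A) (w : EuclideanSpace ℝ (Fin r)) :
    |iteratedFDerivWithin ℝ k f A x (fun _ => w)| ≤ (r : ℝ) ^ k * (B * ‖w‖ ^ k) := by
  rw [iteratedFDerivWithin_diag_eq_sum hA hcl hf hk hx]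
  refine (Finset.abs_sum_le_sum_abs _ _).trans ?_
  have h1 : ∀ τ : Fin k → Fin r,
      |(∏ t, w t ^ tupleContent τ t) * partialDeriv A (tupleContent τ) f x| ≤ B * ‖w‖ ^ k := by
    intro τ
    rw [abs_mul, mul_comm]
    refine mul_le_mul (hB x hx _ (by rw [sum_tupleContent]; exact hk))
      (abs_prod_pow_le (sum_tupleContent τ) w) (abs_nonneg _) ?_
    exact (abs_nonneg _).trans (hB x hx 0 (by simp))
  refine (Finset.sum_le_sum fun τ _ => h1 τ).trans ?_
  rw [Finset.sum_const, Finset.card_univ, Fintype.card_pi]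
  simp

/-- Restriction to the segment from `x` to `y`, which lies in `A` by convexity, reduces the claim to
the one-variable Taylor formula on `[0, 1]`. -/
theorem abs_sub_sum_iteratedFDerivWithin_le (hconv : Convex ℝ A) (hA : UniqueDiffOn ℝ A)
    (hcl : A ⊆ closure (interior A)) (hf : ContDiffOn ℝ N f A) {B : ℝ}
    (hB : ∀ x ∈ A, ∀ q : Fin r → ℕ, ∑ t, q t ≤ N → |partialDeriv A q f x| ≤ B) {m : ℕ}
    (hm : m + 1 ≤ N) {x y : EuclideanSpace ℝ (Fin r)} (hx : x ∈ A) (hy : y ∈ A) :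
    |f y - ∑ k ∈ Finset.range (m + 1), ((k.factorial : ℝ))⁻¹ *
      iteratedFDerivWithin ℝ k f A x (fun _ => y - x)|
      ≤ (r : ℝ) ^ (m + 1) * (B * ‖y - x‖ ^ (m + 1)) := by
  set g : ℝ →ᴬ[ℝ] EuclideanSpace ℝ (Fin r) := ContinuousAffineMap.lineMap x y
  have hg : ∀ t, g t = AffineMap.lineMap x y t := fun t => rfl
  have hlin : g.contLinear 1 = y - x := by
    have h1 := g.map_vadd 0 1
    simp only [vadd_eq_add, add_zero] at h1
    have h2 : g 1 = y := by rw [hg]; simp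
    have h3 : g 0 = x := by rw [hg]; simp
    rw [h2, h3] at h1
    exact eq_sub_of_add_eq h1.symm
  have hmem : ∀ t ∈ Set.Icc (0 : ℝ) 1, g t ∈ A := fun t ht => by
    rw [hg]; exact hconv.lineMap_mem hx hy ht
  -- Pulling the whole Taylor series back along the affine map avoids an iterated chain rule;
  -- uniqueness of derivatives on `[0, 1]` then identifies its terms.
  have hT := (((hf.of_le (by exact_mod_cast hm : ((m + 1 : ℕ) : WithTop ℕ∞) ≤ N)).ftaylorSeriesWithin
    hA).comp_continuousAffineMap g).mono (fun t ht => hmem t ht : Set.Icc (0 : ℝ) 1 ⊆ g ⁻¹' A)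
  have hud := uniqueDiffOn_Icc (zero_lt_one (α := ℝ))
  have hder : ∀ k ≤ m + 1, ∀ t ∈ Set.Icc (0 : ℝ) 1,
      iteratedDerivWithin k (f ∘ g) (Set.Icc 0 1) t
        = iteratedFDerivWithin ℝ k f A (g t) (fun _ => y - x) := by
    intro k hk t ht
    have h1 := hT.eq_iteratedFDerivWithin_of_uniqueDiffOn (m := k) (by exact_mod_cast hk) hud ht
    rw [iteratedDerivWithin_eq_iteratedFDerivWithin, ← h1]
    simp [ftaylorSeriesWithin, hlin]
  have hcd : ContDiffOn ℝ (m + 1) (f ∘ g) (Set.Icc 0 1) :=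
    hT.contDiffOn (n := (m + 1 : ℕ))
  have hbound := taylor_mean_remainder_bound (n := m) (zero_le_one) hcd
    (Set.right_mem_Icc.2 (zero_le_one (α := ℝ))) (C := (r : ℝ) ^ (m + 1) * (B * ‖y - x‖ ^ (m + 1)))
    fun t ht => by
      rw [hder _ le_rfl t ht, Real.norm_eq_abs]
      exact abs_iteratedFDerivWithin_diag_le hA hcl hf hB hm (hmem t ht) _
  rw [taylor_within_apply, Real.norm_eq_abs] at hbound
  have h0 : g 0 = x := by rw [hg]; simp
  have h1 : g 1 = y := by rw [hg]; simp
  have hsum : ∑ k ∈ Finset.range (m + 1), (((k.factorial : ℝ))⁻¹ * (1 - 0) ^ k) •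
      iteratedDerivWithin k (f ∘ g) (Set.Icc 0 1) 0 = ∑ k ∈ Finset.range (m + 1),
      ((k.factorial : ℝ))⁻¹ * iteratedFDerivWithin ℝ k f A x (fun _ => y - x) := by
    refine Finset.sum_congr rfl fun k hk => ?_
    rw [hder k (Finset.mem_range.1 hk).le 0 (Set.left_mem_Icc.2 zero_le_one), h0]
    simp
  rw [hsum, Function.comp_apply, h1] at hbound
  refine hbound.trans ?_
  simp only [sub_zero, one_pow, mul_one]
  -- The factorial in the denominator is dropped; only the order of the remainder matters.
  refine div_le_self ?_ (by exact_mod_cast Nat.one_le_iff_ne_zero.2 (Nat.factorial_ne_zero m))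
  have hB0 : 0 ≤ B := (abs_nonneg _).trans (hB x hx 0 (by simp))
  positivity

/-- The weight of the `a`-th monomial in Taylor's formula, in terms of `∂^q f`. -/
noncomputable def taylorWeight {M : ℕ} (e : GradedEnum r M) (a : Fin ((M + r).choose r)) : ℝ :=
  ∑ k ∈ Finset.range (M + 1), ((k.factorial : ℝ))⁻¹ *
    (Finset.univ.filter fun τ : Fin k → Fin r => tupleContent τ = e.toEquiv a).card

/-- The weight is in fact `1 / q!`, but only its sign matters: positive weights do not spoil the
conditioning of the derivative matrix. The sorted list of `q` is a tuple that contributes. -/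
theorem taylorWeight_pos {M : ℕ} (e : GradedEnum r M) (a : Fin ((M + r).choose r)) :
    0 < taylorWeight e a := by
  set q : Fin r → ℕ := (e.toEquiv a).1
  refine Finset.sum_pos' (fun k _ => by positivity) ⟨(multiIndexList q).length, ?_, ?_⟩
  · rw [Finset.mem_range, length_multiIndexList]
    exact Nat.lt_succ_of_le (e.toEquiv a).2
  · have : 0 < (Finset.univ.filter fun τ : Fin (multiIndexList q).length → Fin r =>
        tupleContent τ = e.toEquiv a).card :=
      Finset.card_pos.2 ⟨fun k => (multiIndexList q).get k, by
        simpa using tupleContent_get q⟩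
    positivity

/-- Tuples of length at most `M` are grouped into the fibres of their multi-index. -/
theorem sum_tupleContent_eq_sum_taylorWeight {M : ℕ} (e : GradedEnum r M)
    (G : (Fin r → ℕ) → ℝ) :
    ∑ k ∈ Finset.range (M + 1), ((k.factorial : ℝ))⁻¹ * ∑ τ : Fin k → Fin r, G (tupleContent τ)
      = ∑ a, taylorWeight e a * G (e.toEquiv a) := by
  simp only [taylorWeight, Finset.sum_mul]
  rw [Finset.sum_comm]
  refine Finset.sum_congr rfl fun k hk => ?_
  simp only [mul_assoc]
  rw [← Finset.mul_sum]
  congr 1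
  have hk' : k ≤ M := Nat.lt_succ_iff.1 (Finset.mem_range.1 hk)
  let φ : (Fin k → Fin r) → Fin ((M + r).choose r) := fun τ =>
    e.toEquiv.symm ⟨tupleContent τ, by rw [sum_tupleContent]; exact hk'⟩
  rw [← Finset.sum_fiberwise Finset.univ φ]
  refine Finset.sum_congr rfl fun a _ => ?_
  have hφ : ∀ τ, φ τ = a ↔ tupleContent τ = e.toEquiv a := by
    intro τ
    simp only [φ, Equiv.symm_apply_eq, Subtype.ext_iff]
  simp only [hφ]
  rw [Finset.sum_congr rfl (g := fun _ => G (e.toEquiv a))]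
  · rw [Finset.sum_const, nsmul_eq_mul]
  · intro τ hτ
    rw [(Finset.mem_filter.1 hτ).2]

theorem abs_sub_taylor_le (hconv : Convex ℝ A) (hA : UniqueDiffOn ℝ A)
    (hcl : A ⊆ closure (interior A)) (hf : ContDiffOn ℝ N f A) {B : ℝ}
    (hB : ∀ x ∈ A, ∀ q : Fin r → ℕ, ∑ t, q t ≤ N → |partialDeriv A q f x| ≤ B) {m : ℕ}
    (hm : m + 1 ≤ N) (e : GradedEnum r m) {x y : EuclideanSpace ℝ (Fin r)} (hx : x ∈ A)
    (hy : y ∈ A) :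
    |f y - ∑ a, taylorWeight e a * partialDeriv A (e.toEquiv a) f x * monomialVec e (y - x) a|
      ≤ (r : ℝ) ^ (m + 1) * B * ‖y - x‖ ^ (m + 1) := by
  have h := abs_sub_sum_iteratedFDerivWithin_le hconv hA hcl hf hB hm hx hy
  have h2 := sum_tupleContent_eq_sum_taylorWeight e
    fun q => (∏ t, (y - x) t ^ q t) * partialDeriv A q f x
  have h3 : ∑ k ∈ Finset.range (m + 1), ((k.factorial : ℝ))⁻¹ *
      iteratedFDerivWithin ℝ k f A x (fun _ => y - x)
      = ∑ a, taylorWeight e a * partialDeriv A (e.toEquiv a) f x * monomialVec e (y - x) a := by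
    rw [Finset.sum_congr rfl fun k hk => by
      rw [iteratedFDerivWithin_diag_eq_sum hA hcl hf
        (by have := Finset.mem_range.1 hk; omega) hx (y - x)], h2]
    refine Finset.sum_congr rfl fun a _ => ?_
    rw [monomialVec]; ring
  rw [h3] at h
  rw [mul_assoc]
  exact h

end IteratedPartials

/-! ### Measurability of random functions at random points -/

section Composition

theorem measurable_randomIndex {Ω ι : Type*} [MeasurableSpace Ω] [Finite ι] [MeasurableSpace ι]
    [MeasurableSingletonClass ι] {g : ι → Ω → ℝ} (hg : ∀ j, Measurable (g j))
    {k : Ω → ι} (hk : Measurable k) : Measurable fun ω => g (k ω) ω := by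
  have h2 : Measurable fun z : ι × Ω => g z.1 z.2 := measurable_from_prod_countable_right hg
  exact h2.comp (hk.prodMk measurable_id)

/-- Only the values at fixed points of `A` are assumed measurable, not `f` jointly. The point `a` is
therefore approximated by simple functions with values in `A`, and continuity of `f ω` passes to the
limit. -/
theorem exists_measurable_randomFunction_comp {Ω E : Type*} [MeasurableSpace Ω]
    [PseudoEMetricSpace E] [MeasurableSpace E] [OpensMeasurableSpace E] {A : Set E}
    [TopologicalSpace.SeparableSpace A] (hA : A.Nonempty) {f : Ω → E → ℝ}
    (hf : ∀ x ∈ A, Measurable fun ω => f ω x) {a : Ω → E} (ha : Measurable a) :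
    ∃ g : Ω → ℝ, Measurable g ∧ ∀ ω, a ω ∈ A → ContinuousOn (f ω) A → g ω = f ω (a ω) := by
  classical
  obtain ⟨y₀, h₀⟩ := hA
  let s := SimpleFunc.approxOn a ha A y₀ h₀
  have hs : ∀ k ω, s k ω ∈ A := SimpleFunc.approxOn_mem ha h₀
  have hmeas : ∀ k, Measurable fun ω => f ω (s k ω) := by
    intro k
    -- Outside `A` the function is replaced by `0`, because measurability is demanded at every
    -- point; the simple functions never leave `A`.
    have h1 := SimpleFunc.measurable_bind (s k) (fun x ω => if x ∈ A then f ω x else 0) fun x => by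
      by_cases hx : x ∈ A
      · simpa [hx] using hf x hx
      · simp [hx]
    simpa [hs] using h1
  -- A `limsup` is measurable whether or not the sequence converges, so the exceptional outcomes
  -- need no care.
  refine ⟨fun ω => limsup (fun k => f ω (s k ω)) atTop, Measurable.limsup hmeas, ?_⟩
  intro ω h1 h2
  have h3 : Tendsto (fun k => s k ω) atTop (𝓝 (a ω)) :=
    SimpleFunc.tendsto_approxOn ha h₀ (subset_closure h1)
  exact ((h2 (a ω) h1).tendsto.comp
    (tendsto_nhdsWithin_iff.2 ⟨h3, Eventually.of_forall fun k => hs k ω⟩)).limsup_eq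

variable {Ω : Type*} {m m₀ : MeasurableSpace Ω} {μ : Measure[m₀] Ω}

theorem aestronglyMeasurable_randomIndex {ι : Type*} [Finite ι] [MeasurableSpace ι]
    [MeasurableSingletonClass ι] {g : ι → Ω → ℝ} (hg : ∀ j, AEStronglyMeasurable[m] (g j) μ)
    {k : Ω → ι} (hk : Measurable[m] k) : AEStronglyMeasurable[m] (fun ω => g (k ω) ω) μ := by
  have h1 := @measurable_randomIndex Ω ι m _ _ _ (fun j => (hg j).mk (g j))
    (fun j => (hg j).stronglyMeasurable_mk.measurable) k hk
  refine ⟨_, h1.stronglyMeasurable, ?_⟩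
  filter_upwards [ae_all_iff.2 fun j => (hg j).ae_eq_mk] with ω hω
  exact hω (k ω)

theorem aestronglyMeasurable_randomFunction_comp {E : Type*} [PseudoEMetricSpace E]
    [MeasurableSpace E] [OpensMeasurableSpace E] {A : Set E} [TopologicalSpace.SeparableSpace A]
    (hA : A.Nonempty) {f : Ω → E → ℝ} (hf : ∀ x ∈ A, Measurable[m] fun ω => f ω x) {a : Ω → E}
    (ha : Measurable[m] a) (haA : ∀ᵐ ω ∂μ, a ω ∈ A) (hc : ∀ᵐ ω ∂μ, ContinuousOn (f ω) A) :
    AEStronglyMeasurable[m] (fun ω => f ω (a ω)) μ := by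
  obtain ⟨g, hg, h⟩ := @exists_measurable_randomFunction_comp Ω E m _ _ _ A _ hA f hf a ha
  refine ⟨g, hg.stronglyMeasurable, ?_⟩
  filter_upwards [haA, hc] with ω h1 h2
  exact (h ω h1 h2).symm

theorem aestronglyMeasurable_sum_mul {ι : Type*} (s : Finset ι) {f g : ι → Ω → ℝ}
    (hf : ∀ k, AEStronglyMeasurable[m] (f k) μ) (hg : ∀ k, AEStronglyMeasurable[m] (g k) μ) :
    AEStronglyMeasurable[m] (fun ω => ∑ k ∈ s, f k ω * g k ω) μ := by
  classical
  induction s using Finset.induction_on with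
  | empty => simpa using (stronglyMeasurable_const (b := (0 : ℝ))).aestronglyMeasurable
  | insert k s hk ih =>
    simp only [Finset.sum_insert hk]
    exact ((hf k).mul (hg k)).add ih

end Composition

/-! ### Almost sure properties and conditional expectations in the model -/

namespace FactorArray

variable {Ω : ℕ → Type*} [∀ n, MeasurableSpace (Ω n)] {r : ℕ} (M : FactorArray Ω r)
  {A : Set (EuclideanSpace ℝ (Fin r))} {μ : ∀ n, Measure (Ω n)} {mbar : ℕ}

theorem Regularities.ae_mem (hreg : M.Regularities μ A mbar) (n : ℕ) :
    ∀ᵐ ω ∂μ n, ∀ i, M.α n i ω ∈ A := by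
  obtain ⟨f, c, C, -, -, -, hmap⟩ := hreg.density
  rw [ae_all_iff]
  intro i
  have hA := hreg.compact.isClosed.measurableSet
  have h1 : ((μ n).map (M.α n i)) Aᶜ = 0 := by
    rw [hmap n i]
    exact withDensity_absolutelyContinuous _ _ (by rw [Measure.restrict_apply hA.compl]; simp)
  rw [Measure.map_apply (M.measurable_α n i) hA.compl] at h1
  exact h1

/-- The pair has a product law and singletons are null, so the diagonal is null by Fubini. The
matching conditions speak only of units with distinct latent variables; this extends them to all
pairs of distinct units. -/
theorem Regularities.ae_ne [∀ n, IsProbabilityMeasure (μ n)] (hr : 1 ≤ r) (hreg : M.Regularities μ A mbar) (n : ℕ) :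
    ∀ᵐ ω ∂μ n, ∀ i j, i ≠ j → M.α n i ω ≠ M.α n j ω := by
  obtain ⟨f, c, C, -, -, -, hmap⟩ := hreg.density
  have : Nonempty (Fin r) := ⟨⟨0, hr⟩⟩
  rw [ae_all_iff]; intro i
  rw [ae_all_iff]; intro j
  by_cases hij : i = j
  · simp [hij]
  have hpair := (indepFun_iff_map_prod_eq_prod_map_map (M.measurable_α n i).aemeasurable
    (M.measurable_α n j).aemeasurable).1 ((hreg.indep n).indepFun hij)
  have hd : MeasurableSet (Set.diagonal (EuclideanSpace ℝ (Fin r))) := measurableSet_diagonal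
  have hprob : IsProbabilityMeasure ((μ n).map (M.α n j)) :=
    Measure.isProbabilityMeasure_map (M.measurable_α n j).aemeasurable
  have h0 : ((μ n).map (M.α n i)).prod ((μ n).map (M.α n j)) (Set.diagonal _) = 0 := by
    rw [Measure.measure_prod_null hd]
    refine ae_of_all _ fun x => ?_
    have : Prod.mk x ⁻¹' Set.diagonal (EuclideanSpace ℝ (Fin r)) = {x} := by
      ext y; simp [eq_comm]
    change ((μ n).map (M.α n j)) (Prod.mk x ⁻¹' _) = 0
    rw [this, hmap n j]
    exact withDensity_absolutelyContinuous _ _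
      (le_antisymm ((Measure.restrict_apply_le _ _).trans (by simp)) zero_le)
  rw [← hpair, Measure.map_apply ((M.measurable_α n i).prodMk (M.measurable_α n j)) hd] at h0
  have h1 : ∀ᵐ ω ∂μ n, ¬ M.α n i ω = M.α n j ω := by
    rw [ae_iff]; simpa [Set.preimage, Set.diagonal] using h0
  filter_upwards [h1] with ω hω _ using hω

theorem Regularities.nonempty [∀ n, IsProbabilityMeasure (μ n)] (hreg : M.Regularities μ A mbar) : A.Nonempty := by
  obtain ⟨ω, hω⟩ := (hreg.ae_mem M 1).exists
  exact ⟨_, hω 0⟩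

theorem measurable_η_apply (n : ℕ) (l : Fin (M.p n)) (x : EuclideanSpace ℝ (Fin r)) :
    Measurable fun ω => M.η n l ω x :=
  (M.measurable_η n l).comp (measurable_id.prodMk measurable_const)

theorem measurable_H (n : ℕ) (i : Fin n) (l : Fin (M.p n)) : Measurable (M.H n i l) :=
  (M.measurable_η n l).comp (measurable_id.prodMk (M.measurable_α n i))

theorem measurable_Xdag (n : ℕ) : Measurable (M.Xdag n) :=
  measurable_pi_lambda _ fun i => measurable_pi_lambda _ fun l =>
    (M.measurable_H n i l).add (M.measurable_u n i l)

theorem sigmaLatent_le (n : ℕ) : M.sigmaLatent A n ≤ (inferInstance : MeasurableSpace (Ω n)) :=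
  sup_le (iSup_le fun i => (M.measurable_α n i).comap_le)
    (iSup_le fun l => iSup_le fun x => (M.measurable_η_apply n l x).comap_le)

theorem sigmaMatch_le (n : ℕ) : M.sigmaMatch A n ≤ (inferInstance : MeasurableSpace (Ω n)) :=
  sup_le (M.sigmaLatent_le n) (M.measurable_Xdag n).comap_le

theorem measurable_α_sigmaMatch (n : ℕ) (i : Fin n) : Measurable[M.sigmaMatch A n] (M.α n i) :=
  measurable_iff_comap_le.2
    (le_sup_of_le_left (le_sup_of_le_left (le_iSup_of_le i le_rfl)))

theorem measurable_η_sigmaMatch (n : ℕ) (l : Fin (M.p n)) {x : EuclideanSpace ℝ (Fin r)}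
    (hx : x ∈ A) : Measurable[M.sigmaMatch A n] fun ω => M.η n l ω x :=
  measurable_iff_comap_le.2
    (le_sup_of_le_left (le_sup_of_le_right
      (le_iSup_of_le l (le_iSup_of_le (⟨x, hx⟩ : A) le_rfl))))

theorem measurable_Xdag_sigmaMatch (n : ℕ) : Measurable[M.sigmaMatch A n] (M.Xdag n) :=
  measurable_iff_comap_le.2 le_sup_right

theorem measurable_nbr_sigmaMatch {K : ℕ → ℕ} {ρ : ∀ n, M.MatchData n → Fin n → Fin n → ℝ}
    {nn : ∀ n, M.MatchData n → Fin n → Fin (K n) → Fin n} (hnn : M.IsNearestNeighbors K ρ nn)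
    (n : ℕ) (i : Fin n) (k : Fin (K n)) : Measurable[M.sigmaMatch A n] (M.nbr nn n i k) :=
  (hnn.measurable n i k).comp (M.measurable_Xdag_sigmaMatch n)

/-- The conditioning σ-field sees `η_l` only at fixed points of `A`; almost sure continuity recovers
its value at the random point `α_i`. -/
theorem Regularities.aestronglyMeasurable_H [∀ n, IsProbabilityMeasure (μ n)] (hreg : M.Regularities μ A mbar) (n : ℕ) (i : Fin n)
    (l : Fin (M.p n)) : AEStronglyMeasurable[M.sigmaMatch A n] (M.H n i l) (μ n) := by
  refine aestronglyMeasurable_randomFunction_comp (hreg.nonempty M)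
    (fun x hx => M.measurable_η_sigmaMatch n l hx) (M.measurable_α_sigmaMatch n i) ?_ ?_
  · filter_upwards [hreg.ae_mem M n] with ω hω using hω i
  · filter_upwards [hreg.smooth n l] with ω hω using hω.continuousOn

theorem Regularities.aestronglyMeasurable_Hloc [∀ n, IsProbabilityMeasure (μ n)] (hreg : M.Regularities μ A mbar) {K : ℕ → ℕ}
    {ρ : ∀ n, M.MatchData n → Fin n → Fin n → ℝ}
    {nn : ∀ n, M.MatchData n → Fin n → Fin (K n) → Fin n} (hnn : M.IsNearestNeighbors K ρ nn)
    (n : ℕ) (i : Fin n) (l : {l // l ∈ M.Rddag n}) (k : Fin (K n)) :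
    AEStronglyMeasurable[M.sigmaMatch A n] (fun ω => M.Hloc nn n i ω l k) (μ n) :=
  aestronglyMeasurable_randomIndex (g := fun j => M.H n j l)
    (fun j => hreg.aestronglyMeasurable_H M n j l) (M.measurable_nbr_sigmaMatch hnn n i k)

theorem aestronglyMeasurable_monomialLoadings {K : ℕ → ℕ}
    {ρ : ∀ n, M.MatchData n → Fin n → Fin n → ℝ}
    {nn : ∀ n, M.MatchData n → Fin n → Fin (K n) → Fin n} (hnn : M.IsNearestNeighbors K ρ nn)
    {m : ℕ} (e : GradedEnum r (m - 1)) (n : ℕ) (i : Fin n) (k : Fin (K n))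
    (b : Fin ((m - 1 + r).choose r)) :
    AEStronglyMeasurable[M.sigmaMatch A n] (fun ω => M.monomialLoadings nn e n i ω k b) (μ n) := by
  refine aestronglyMeasurable_randomIndex (g := fun j ω => ∏ t,
    (M.α n j ω t - M.α n i ω t) ^ (e.toEquiv b : Fin r → ℕ) t) (fun j => ?_)
    (M.measurable_nbr_sigmaMatch hnn n i k)
  have hco : ∀ t : Fin r, Measurable fun x : EuclideanSpace ℝ (Fin r) => x t := fun t => by fun_prop
  refine (Finset.measurable_prod _ fun t _ => Measurable.pow_const ?_ _).stronglyMeasurable.aestronglyMeasurable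
  exact ((hco t).comp (M.measurable_α_sigmaMatch n j)).sub
    ((hco t).comp (M.measurable_α_sigmaMatch n i))

theorem monomialLoadings_eq {K : ℕ → ℕ} (nn : ∀ n, M.MatchData n → Fin n → Fin (K n) → Fin n)
    {m : ℕ} (e : GradedEnum r (m - 1)) (n : ℕ) (i : Fin n) (ω : Ω n) (k : Fin (K n))
    (b : Fin ((m - 1 + r).choose r)) :
    M.monomialLoadings nn e n i ω k b
      = monomialVec e (M.α n (M.nbr nn n i k ω) ω - M.α n i ω) b := by
  simp [monomialLoadings, monomialVec]

theorem Regularities.exists_ae_abs_Hloc_le (hreg : M.Regularities μ A mbar) :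
    ∃ B : ℝ, 0 ≤ B ∧ ∀ n, ∀ᵐ ω ∂μ n, ∀ i l, |M.H n i l ω| ≤ B := by
  obtain ⟨B, hB⟩ := hreg.bounded
  refine ⟨max B 0, le_max_right _ _, fun n => ?_⟩
  filter_upwards [hreg.ae_mem M n, ae_all_iff.2 (hB n)] with ω h1 h2 i l
  have h3 := h2 l _ (h1 i) 0 (by simp)
  -- The zero multi-index has the empty list of directions, so its derivative is the function
  -- itself.
  have h4 : partialDeriv A 0 (M.η n l ω) (M.α n i ω) = M.H n i l ω := by
    have : ((List.finRange r).flatMap fun t => List.replicate ((0 : Fin r → ℕ) t) t) = [] := by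
      simp
    unfold partialDeriv
    rw [this]
    simp [H]
  rw [h4] at h3
  exact h3.trans (le_max_left _ _)

theorem abs_monomialVec_le {N : ℕ} (e : GradedEnum r N) (y : EuclideanSpace ℝ (Fin r))
    (b : Fin ((N + r).choose r)) : |monomialVec e y b| ≤ ‖y‖ ^ e.deg b :=
  abs_prod_pow_le rfl y

theorem Regularities.exists_ae_abs_monomialLoadings_le (hreg : M.Regularities μ A mbar) {K : ℕ → ℕ}
    (nn : ∀ n, M.MatchData n → Fin n → Fin (K n) → Fin n) {m : ℕ} (e : GradedEnum r (m - 1)) :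
    ∃ B : ℝ, 0 ≤ B ∧ ∀ n, ∀ᵐ ω ∂μ n, ∀ i k b, |M.monomialLoadings nn e n i ω k b| ≤ B := by
  refine ⟨∑ b, Metric.diam A ^ e.deg b,
    Finset.sum_nonneg fun b _ => pow_nonneg Metric.diam_nonneg _, fun n => ?_⟩
  filter_upwards [hreg.ae_mem M n] with ω hω i k b
  rw [monomialLoadings_eq]
  refine (abs_monomialVec_le e _ b).trans ?_
  have h1 : ‖M.α n (M.nbr nn n i k ω) ω - M.α n i ω‖ ≤ Metric.diam A := by
    rw [← dist_eq_norm]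
    exact Metric.dist_le_diam_of_mem hreg.compact.isBounded (hω _) (hω _)
  calc _ ≤ Metric.diam A ^ e.deg b := by gcongr
    _ ≤ _ := Finset.single_le_sum (f := fun b => Metric.diam A ^ e.deg b)
      (fun b _ => pow_nonneg Metric.diam_nonneg _) (Finset.mem_univ b)

section CondExp

variable {K : ℕ → ℕ} {ρ : ∀ n, M.MatchData n → Fin n → Fin n → ℝ}
  {nn : ∀ n, M.MatchData n → Fin n → Fin (K n) → Fin n} {m : ℕ}

theorem Regularities.aestronglyMeasurable_Hloc_mul [∀ n, IsProbabilityMeasure (μ n)] (hreg : M.Regularities μ A mbar)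
    (hnn : M.IsNearestNeighbors K ρ nn) (e : GradedEnum r (m - 1)) (n : ℕ) (i : Fin n)
    (l : {l // l ∈ M.Rddag n}) (b : Fin ((m - 1 + r).choose r)) :
    AEStronglyMeasurable[M.sigmaMatch A n]
      (fun ω => (M.Hloc nn n i ω * M.monomialLoadings nn e n i ω) l b) (μ n) := by
  simp only [Matrix.mul_apply]
  exact aestronglyMeasurable_sum_mul _ (fun k => hreg.aestronglyMeasurable_Hloc M hnn n i l k)
    fun k => M.aestronglyMeasurable_monomialLoadings hnn e n i k b

theorem aestronglyMeasurable_loadings_gram (hnn : M.IsNearestNeighbors K ρ nn)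
    (e : GradedEnum r (m - 1)) (n : ℕ) (i : Fin n) (a b : Fin ((m - 1 + r).choose r)) :
    AEStronglyMeasurable[M.sigmaMatch A n]
      (fun ω => ((M.monomialLoadings nn e n i ω)ᵀ * M.monomialLoadings nn e n i ω) a b) (μ n) := by
  simp only [Matrix.mul_apply, Matrix.transpose_apply]
  exact aestronglyMeasurable_sum_mul _
    (fun k => M.aestronglyMeasurable_monomialLoadings hnn e n i k a)
    fun k => M.aestronglyMeasurable_monomialLoadings hnn e n i k b

theorem Regularities.integrable_Hloc_mul [∀ n, IsProbabilityMeasure (μ n)] (hreg : M.Regularities μ A mbar)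
    (hnn : M.IsNearestNeighbors K ρ nn) (e : GradedEnum r (m - 1)) (n : ℕ) (i : Fin n)
    (l : {l // l ∈ M.Rddag n}) (b : Fin ((m - 1 + r).choose r)) :
    Integrable (fun ω => (M.Hloc nn n i ω * M.monomialLoadings nn e n i ω) l b) (μ n) := by
  obtain ⟨B, hB0, hB⟩ := hreg.exists_ae_abs_Hloc_le
  obtain ⟨C, hC0, hC⟩ := hreg.exists_ae_abs_monomialLoadings_le M nn e
  refine Integrable.of_bound ((hreg.aestronglyMeasurable_Hloc_mul M hnn e n i l b).mono
    (M.sigmaMatch_le n)) (∑ _k : Fin (K n), B * C) ?_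
  filter_upwards [hB n, hC n] with ω h1 h2
  rw [Matrix.mul_apply]
  refine (norm_sum_le _ _).trans (Finset.sum_le_sum fun k _ => ?_)
  rw [Real.norm_eq_abs, abs_mul]
  exact mul_le_mul (h1 _ _) (h2 _ _ _) (abs_nonneg _) hB0

theorem Regularities.integrable_loadings_gram [∀ n, IsProbabilityMeasure (μ n)] (hreg : M.Regularities μ A mbar)
    (hnn : M.IsNearestNeighbors K ρ nn) (e : GradedEnum r (m - 1)) (n : ℕ) (i : Fin n)
    (a b : Fin ((m - 1 + r).choose r)) :
    Integrable (fun ω => ((M.monomialLoadings nn e n i ω)ᵀ * M.monomialLoadings nn e n i ω) a b)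
      (μ n) := by
  obtain ⟨C, hC0, hC⟩ := hreg.exists_ae_abs_monomialLoadings_le M nn e
  refine Integrable.of_bound ((M.aestronglyMeasurable_loadings_gram (A := A) hnn e n i a b).mono
    (M.sigmaMatch_le n)) (∑ _k : Fin (K n), C * C) ?_
  filter_upwards [hC n] with ω h2
  rw [Matrix.mul_apply]
  refine (norm_sum_le _ _).trans (Finset.sum_le_sum fun k _ => ?_)
  rw [Real.norm_eq_abs, abs_mul]
  exact mul_le_mul (h2 _ _ _) (h2 _ _ _) (abs_nonneg _) hC0

/-- Neighbours are functions of `X†` and the latent variables are conditioned upon, so the Gram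
matrix is already measurable and `E‡` leaves it unchanged. With the analogous fact for `H Λ`, `F`
becomes an ordinary least-squares coefficient matrix. -/
theorem Regularities.ae_condExpMat_gram [∀ n, IsProbabilityMeasure (μ n)] (hreg : M.Regularities μ A mbar)
    (hnn : M.IsNearestNeighbors K ρ nn) (e : GradedEnum r (m - 1)) (n : ℕ) :
    ∀ᵐ ω ∂μ n, ∀ i, condExpMat (μ n) (M.sigmaMatch A n)
      (fun ω' => (M.monomialLoadings nn e n i ω')ᵀ * M.monomialLoadings nn e n i ω') ω
      = (M.monomialLoadings nn e n i ω)ᵀ * M.monomialLoadings nn e n i ω := by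
  have h : ∀ i a b, _ := fun i a b => condExp_of_aestronglyMeasurable' (M.sigmaMatch_le (A := A) n)
    (M.aestronglyMeasurable_loadings_gram hnn e n i a b)
    (hreg.integrable_loadings_gram M hnn e n i a b)
  filter_upwards [ae_all_iff.2 fun i => ae_all_iff.2 fun a => ae_all_iff.2 fun b => h i a b]
    with ω hω i
  ext a b
  exact hω i a b

theorem Regularities.ae_condExpMat_Hloc_mul [∀ n, IsProbabilityMeasure (μ n)] (hreg : M.Regularities μ A mbar)
    (hnn : M.IsNearestNeighbors K ρ nn) (e : GradedEnum r (m - 1)) (n : ℕ) :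
    ∀ᵐ ω ∂μ n, ∀ i, condExpMat (μ n) (M.sigmaMatch A n)
      (fun ω' => M.Hloc nn n i ω' * M.monomialLoadings nn e n i ω') ω
      = M.Hloc nn n i ω * M.monomialLoadings nn e n i ω := by
  have h : ∀ i l b, _ := fun i l b => condExp_of_aestronglyMeasurable' (M.sigmaMatch_le (A := A) n)
    (hreg.aestronglyMeasurable_Hloc_mul M hnn e n i l b)
    (hreg.integrable_Hloc_mul M hnn e n i l b)
  filter_upwards [ae_all_iff.2 fun i => ae_all_iff.2 fun a => ae_all_iff.2 fun b => h i a b]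
    with ω hω i
  ext a b
  exact hω i a b

end CondExp

end FactorArray

/-! ### Matrix bounds and perturbation of least squares -/

section MatrixBounds

variable {ι κ : Type*} [Fintype ι] {d : ℕ}

theorem sum_sq_mulVec_le {B : ℝ} (D : Matrix ι (Fin d) ℝ) (hD : ∀ l a, |D l a| ≤ B)
    (v : Fin d → ℝ) : ∑ l, (D *ᵥ v) l ^ 2 ≤ Fintype.card ι * (d * B ^ 2) * ∑ a, v a ^ 2 := by
  have h1 : ∀ l, (D *ᵥ v) l ^ 2 ≤ (d * B ^ 2) * ∑ a, v a ^ 2 := by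
    intro l
    refine (sq_dotProduct_le (D l) v).trans ?_
    gcongr
    calc ∑ a, D l a ^ 2 ≤ ∑ _a : Fin d, B ^ 2 := Finset.sum_le_sum fun a _ => by
          rw [← sq_abs]; exact pow_le_pow_left₀ (abs_nonneg _) (hD l a) 2
      _ = d * B ^ 2 := by simp
  refine (Finset.sum_le_sum fun l _ => h1 l).trans ?_
  simp only [Finset.sum_const, nsmul_eq_mul, Finset.card_univ, mul_assoc, le_refl]

theorem sum_sq_transpose_mulVec_le {B : ℝ} (D : Matrix ι (Fin d) ℝ) (hD : ∀ l a, |D l a| ≤ B)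
    (z : ι → ℝ) : ∑ a, (Dᵀ *ᵥ z) a ^ 2 ≤ d * (Fintype.card ι * B ^ 2) * ∑ l, z l ^ 2 := by
  have h1 : ∀ a, (Dᵀ *ᵥ z) a ^ 2 ≤ (Fintype.card ι * B ^ 2) * ∑ l, z l ^ 2 := by
    intro a
    refine (sq_dotProduct_le (Dᵀ a) z).trans ?_
    gcongr
    calc ∑ l, Dᵀ a l ^ 2 ≤ ∑ _l : ι, B ^ 2 := Finset.sum_le_sum fun l _ => by
          rw [← sq_abs]; exact pow_le_pow_left₀ (abs_nonneg _) (hD l a) 2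
      _ = Fintype.card ι * B ^ 2 := by simp
  refine (Finset.sum_le_sum fun l _ => h1 l).trans ?_
  simp only [Finset.sum_const, nsmul_eq_mul, Finset.card_univ, Fintype.card_fin, mul_assoc, le_refl]

/-- With `G = P⁻¹ D'D`, the singular value bounds `‖G v‖` from below, while `G v = P⁻¹ D'(D v)` is
bounded above through `‖D v‖`. The loss of a constant factor is harmless. -/
theorem sum_sq_mulVec_ge_of_sMin {B c : ℝ} (hc : 0 < c) (D : Matrix ι (Fin d) ℝ)
    (hD : ∀ l a, |D l a| ≤ B) (hs : c ≤ sMin ((Fintype.card ι : ℝ)⁻¹ • (Dᵀ * D)))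
    (v : Fin d → ℝ) :
    c ^ 2 * ∑ a, v a ^ 2 ≤ d * B ^ 2 * ((Fintype.card ι : ℝ)⁻¹ * ∑ l, (D *ᵥ v) l ^ 2) := by
  set P : ℝ := (Fintype.card ι : ℝ)
  have hP : 0 ≤ P := by positivity
  have h1 := sMin_sq_mul_le (P⁻¹ • (Dᵀ * D)) v
  have h2 : c ^ 2 ≤ sMin (P⁻¹ • (Dᵀ * D)) ^ 2 := pow_le_pow_left₀ hc.le hs 2
  have h3 : ∑ a, ((P⁻¹ • (Dᵀ * D)) *ᵥ v) a ^ 2 = P⁻¹ ^ 2 * ∑ a, (Dᵀ *ᵥ (D *ᵥ v)) a ^ 2 := by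
    rw [Finset.mul_sum]
    refine Finset.sum_congr rfl fun a _ => ?_
    rw [Matrix.smul_mulVec, ← Matrix.mulVec_mulVec, Pi.smul_apply, smul_eq_mul, mul_pow]
  have h4 := sum_sq_transpose_mulVec_le D hD (D *ᵥ v)
  calc c ^ 2 * ∑ a, v a ^ 2 ≤ sMin (P⁻¹ • (Dᵀ * D)) ^ 2 * ∑ a, v a ^ 2 := by gcongr
    _ ≤ P⁻¹ ^ 2 * ∑ a, (Dᵀ *ᵥ (D *ᵥ v)) a ^ 2 := h1.trans h3.le
    _ ≤ P⁻¹ ^ 2 * (d * (P * B ^ 2) * ∑ l, (D *ᵥ v) l ^ 2) := by gcongr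
    _ = (P⁻¹ * P) * P⁻¹ * (d * B ^ 2 * ∑ l, (D *ᵥ v) l ^ 2) := by ring
    -- An inequality rather than an equality, since `P` may be `0`.
    _ ≤ 1 * P⁻¹ * (d * B ^ 2 * ∑ l, (D *ᵥ v) l ^ 2) := by
        gcongr
        exact inv_mul_le_one
    _ = _ := by ring

theorem mul_inv_diagonal_apply {υ : Fin d → ℝ} (hυ : ∀ a, 0 < υ a) (L : Matrix κ (Fin d) ℝ)
    (k : κ) (a : Fin d) : (L * (Matrix.diagonal υ)⁻¹) k a = L k a / υ a := by
  have h1 : (Matrix.diagonal υ)⁻¹ = Matrix.diagonal fun a => (υ a)⁻¹ := by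
    refine Matrix.inv_eq_right_inv ?_
    rw [Matrix.diagonal_mul_diagonal, ← Matrix.diagonal_one]
    congr 1
    ext a
    exact mul_inv_cancel₀ (hυ a).ne'
  rw [h1, Matrix.mul_diagonal, div_eq_mul_inv]

theorem mul_inv_diagonal_mulVec {υ : Fin d → ℝ} (hυ : ∀ a, 0 < υ a) (L : Matrix κ (Fin d) ℝ)
    (s : Fin d → ℝ) : (L * (Matrix.diagonal υ)⁻¹) *ᵥ (fun a => υ a * s a) = L *ᵥ s := by
  ext k
  simp only [Matrix.mulVec, dotProduct]
  refine Finset.sum_congr rfl fun a _ => ?_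
  rw [mul_inv_diagonal_apply hυ]
  field_simp [(hυ a).ne']

theorem FactorArray.scaledGram_eq {K : ℕ} (υ : Fin d → ℝ) (L : Matrix (Fin K) (Fin d) ℝ) :
    FactorArray.scaledGram υ L = (K : ℝ)⁻¹ •
      ((L * (Matrix.diagonal υ)⁻¹)ᵀ * (L * (Matrix.diagonal υ)⁻¹)) := by
  rw [FactorArray.scaledGram, Matrix.transpose_mul, Matrix.transpose_nonsing_inv,
    Matrix.diagonal_transpose]
  simp only [Matrix.mul_assoc]

end MatrixBounds

section LeastSquares

variable {ι : Type*} {K d : ℕ} {L : Matrix (Fin K) (Fin d) ℝ} {υ : Fin d → ℝ} {c : ℝ}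

theorem isUnit_det_gram (hυ : ∀ a, 0 < υ a) (hc : 0 < c)
    (hL : ∀ v : Fin d → ℝ, c * ∑ a, v a ^ 2 ≤
      (K : ℝ)⁻¹ * ∑ k, ((L * (Matrix.diagonal υ)⁻¹) *ᵥ v) k ^ 2) :
    IsUnit (Lᵀ * L).det := by
  rw [isUnit_iff_ne_zero]
  intro h0
  obtain ⟨v, hv, hv0⟩ := Matrix.exists_mulVec_eq_zero_iff.2 h0
  apply hv
  have h1 : (L *ᵥ v) ⬝ᵥ (L *ᵥ v) = 0 := by rw [← gram_bilin, hv0, dotProduct_zero]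
  have h2 := hL fun a => υ a * v a
  rw [mul_inv_diagonal_mulVec hυ] at h2
  have h3 : ∑ k, (L *ᵥ v) k ^ 2 = 0 := by
    rw [← h1]; simp [dotProduct, sq]
  rw [h3, mul_zero] at h2
  have h4 : ∑ a, (υ a * v a) ^ 2 = 0 := by
    have h5 : 0 ≤ ∑ a, (υ a * v a) ^ 2 := Finset.sum_nonneg fun a _ => sq_nonneg _
    nlinarith
  rw [Finset.sum_eq_zero_iff_of_nonneg fun a _ => sq_nonneg _] at h4
  ext a
  have := h4 a (Finset.mem_univ a)
  have h6 : υ a * v a = 0 := by simpa using this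
  exact (mul_eq_zero.1 h6).resolve_left (hυ a).ne'

/-- The normal equations give `‖L s‖² = ⟨L s, R⟩`, hence `‖L s‖² ≤ ‖R‖² ≤ K b²`. Applying the form
bound to `Υ s` transfers this to the scaled coefficients. -/
theorem sum_sq_leastSquares_le (hυ : ∀ a, 0 < υ a) (hc : 0 < c)
    (hL : ∀ v : Fin d → ℝ, c * ∑ a, v a ^ 2 ≤
      (K : ℝ)⁻¹ * ∑ k, ((L * (Matrix.diagonal υ)⁻¹) *ᵥ v) k ^ 2)
    {R : Fin K → ℝ} {s : Fin d → ℝ} (hs : (Lᵀ * L) *ᵥ s = Lᵀ *ᵥ R) {b : ℝ}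
    (hR : ∀ k, |R k| ≤ b) : ∑ a, (υ a * s a) ^ 2 ≤ b ^ 2 / c := by
  set x := ∑ k, (L *ᵥ s) k ^ 2
  have hx0 : 0 ≤ x := Finset.sum_nonneg fun k _ => sq_nonneg _
  have hx : x = (L *ᵥ s) ⬝ᵥ R := by
    have h1 : x = (L *ᵥ s) ⬝ᵥ (L *ᵥ s) := by simp [x, dotProduct, sq]
    rw [h1, ← gram_bilin, hs, Matrix.dotProduct_mulVec, Matrix.vecMul_transpose]
  have hRs : ∑ k, R k ^ 2 ≤ K * b ^ 2 := by
    calc ∑ k, R k ^ 2 ≤ ∑ _k : Fin K, b ^ 2 := Finset.sum_le_sum fun k _ => by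
          rw [← sq_abs]; exact pow_le_pow_left₀ (abs_nonneg _) (hR k) 2
      _ = K * b ^ 2 := by simp
  have hcs := sq_dotProduct_le (L *ᵥ s) R
  rw [← hx] at hcs
  have hxle : x ≤ K * b ^ 2 := by
    rcases hx0.eq_or_lt with h | h
    · rw [← h]; positivity
    · refine le_trans ?_ hRs
      refine le_of_mul_le_mul_left ?_ h
      rw [← sq]; exact hcs
  have h2 := hL fun a => υ a * s a
  rw [mul_inv_diagonal_mulVec hυ] at h2
  rw [le_div_iff₀ hc, mul_comm]
  refine h2.trans ?_
  calc (K : ℝ)⁻¹ * x ≤ (K : ℝ)⁻¹ * (K * b ^ 2) := by gcongr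
    _ = ((K : ℝ)⁻¹ * K) * b ^ 2 := by ring
    _ ≤ 1 * b ^ 2 := by gcongr; exact inv_mul_le_one
    _ = b ^ 2 := one_mul _

/-- The rows of the least-squares coefficient matrix of `R` on `L`. -/
theorem leastSquares_row_eq (hdet : IsUnit (Lᵀ * L).det) (R : Matrix ι (Fin K) ℝ) (l : ι) :
    (Lᵀ * L) *ᵥ ((R * L * (Lᵀ * L)⁻¹) l) = Lᵀ *ᵥ (R l) := by
  have h1 : (R * L * (Lᵀ * L)⁻¹) * (Lᵀ * L) = R * L := by
    rw [Matrix.mul_assoc, Matrix.nonsing_inv_mul _ hdet, Matrix.mul_one]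
  have h2 : (Lᵀ * L)ᵀ = Lᵀ * L := by rw [Matrix.transpose_mul, Matrix.transpose_transpose]
  ext a
  have h3 := congrFun (congrFun h1 l) a
  rw [Matrix.mul_apply] at h3
  rw [Matrix.mul_apply] at h3
  simp only [Matrix.mulVec, dotProduct, Matrix.transpose_apply]
  rw [Finset.sum_congr rfl fun k _ => mul_comm (L k a) (R l k), ← h3]
  refine Finset.sum_congr rfl fun b _ => ?_
  rw [mul_comm, ← congrFun (congrFun h2 a) b, Matrix.transpose_apply]

/-- A fitted value pairs a row of `L Υ⁻¹` with `Υ s`, so the scales cancel and the fit has the same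
order as `R` in sup-norm. -/
theorem abs_sub_leastSquares_le {R : Matrix ι (Fin K) ℝ} (hυ : ∀ a, 0 < υ a) (hc : 0 < c)
    (hL : ∀ v : Fin d → ℝ, c * ∑ a, v a ^ 2 ≤
      (K : ℝ)⁻¹ * ∑ k, ((L * (Matrix.diagonal υ)⁻¹) *ᵥ v) k ^ 2)
    {b : ℝ} (hb : 0 ≤ b) (hR : ∀ l k, |R l k| ≤ b) {B : ℝ}
    (hLB : ∀ k a, |(L * (Matrix.diagonal υ)⁻¹) k a| ≤ B) (l : ι) (k : Fin K) :
    |(R - R * L * (Lᵀ * L)⁻¹ * Lᵀ) l k| ≤ (1 + √(d * B ^ 2 / c)) * b := by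
  have hdet := isUnit_det_gram hυ hc hL
  set s := (R * L * (Lᵀ * L)⁻¹) l
  have h1 := sum_sq_leastSquares_le hυ hc hL (leastSquares_row_eq hdet R l) (hR l)
  have h2 : (R * L * (Lᵀ * L)⁻¹ * Lᵀ) l k
      = (L * (Matrix.diagonal υ)⁻¹) k ⬝ᵥ fun a => υ a * s a := by
    have h3 := congrFun (mul_inv_diagonal_mulVec hυ L s) k
    rw [Matrix.mulVec] at h3
    rw [h3, Matrix.mul_apply, Matrix.mulVec, dotProduct]
    exact Finset.sum_congr rfl fun a _ => mul_comm _ _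
  have h4 := sq_dotProduct_le ((L * (Matrix.diagonal υ)⁻¹) k) fun a => υ a * s a
  rw [← h2] at h4
  have h5 : ∑ a, (L * (Matrix.diagonal υ)⁻¹) k a ^ 2 ≤ d * B ^ 2 := by
    calc _ ≤ ∑ _a : Fin d, B ^ 2 := Finset.sum_le_sum fun a _ => by
          rw [← sq_abs]; exact pow_le_pow_left₀ (abs_nonneg _) (hLB k a) 2
      _ = d * B ^ 2 := by simp
  have h6 : |(R * L * (Lᵀ * L)⁻¹ * Lᵀ) l k| ≤ √(d * B ^ 2 / c) * b := by
    refine abs_le_of_sq_le_sq ?_ (by positivity)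
    rw [mul_pow, Real.sq_sqrt (by positivity)]
    calc _ ≤ _ := h4
      _ ≤ (d * B ^ 2) * (b ^ 2 / c) := by
          gcongr
      _ = _ := by ring
  rw [Matrix.sub_apply]
  calc _ ≤ |R l k| + |(R * L * (Lᵀ * L)⁻¹ * Lᵀ) l k| := abs_sub _ _
    _ ≤ b + √(d * B ^ 2 / c) * b := add_le_add (hR l k) h6
    _ = _ := by ring

/-- Undoing the scaling of the coefficients costs at most a factor `1 / υ₀`, the reciprocal of the
smallest scale. -/
theorem sum_sq_mulVec_leastSquares_le [Fintype ι] {R : Matrix ι (Fin K) ℝ} (hυ : ∀ a, 0 < υ a) (hc : 0 < c)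
    (hL : ∀ v : Fin d → ℝ, c * ∑ a, v a ^ 2 ≤
      (K : ℝ)⁻¹ * ∑ k, ((L * (Matrix.diagonal υ)⁻¹) *ᵥ v) k ^ 2)
    {b : ℝ} (hR : ∀ l k, |R l k| ≤ b) {υ₀ : ℝ} (hυ₀ : 0 < υ₀) (hυ₀' : ∀ a, υ₀ ≤ υ a)
    (v : Fin d → ℝ) : ∑ l, ((R * L * (Lᵀ * L)⁻¹) *ᵥ v) l ^ 2
      ≤ Fintype.card ι * (b ^ 2 / (c * υ₀ ^ 2)) * ∑ a, v a ^ 2 := by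
  have hdet := isUnit_det_gram hυ hc hL
  have h1 : ∀ l, ((R * L * (Lᵀ * L)⁻¹) *ᵥ v) l ^ 2 ≤ (b ^ 2 / (c * υ₀ ^ 2)) * ∑ a, v a ^ 2 := by
    intro l
    refine (sq_dotProduct_le ((R * L * (Lᵀ * L)⁻¹) l) v).trans ?_
    have h2 := sum_sq_leastSquares_le hυ hc hL (leastSquares_row_eq hdet R l) (hR l)
    gcongr
    rw [← div_div, le_div_iff₀ (by positivity), mul_comm, Finset.mul_sum]
    refine (Finset.sum_le_sum fun a _ => ?_).trans h2
    rw [mul_pow]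
    gcongr
    exact hυ₀' a
  refine (Finset.sum_le_sum fun l _ => h1 l).trans ?_
  simp only [Finset.sum_const, nsmul_eq_mul, Finset.card_univ, mul_assoc, le_refl]

end LeastSquares

theorem matMaxNorm_le {ι κ : Type*} {A : Matrix ι κ ℝ} {C : ℝ} (hC : 0 ≤ C)
    (h : ∀ i k, |A i k| ≤ C) : matMaxNorm A ≤ C :=
  Real.iSup_le (fun ab => h ab.1 ab.2) hC

theorem matMaxNorm_nonneg {ι κ : Type*} (A : Matrix ι κ ℝ) : 0 ≤ matMaxNorm A :=
  Real.iSup_nonneg fun _ => abs_nonneg _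

section Projection

variable {ι : Type*} [Fintype ι] {K d : ℕ}

/-- The bounds that a local least-squares fit inherits from an approximate factor structure
`H ≈ D L'` with a well-conditioned scaled loading matrix `L Υ⁻¹` and a well-conditioned `D`. -/
theorem projection_bounds [Nonempty ι] (hd : 0 < d) {L : Matrix (Fin K) (Fin d) ℝ}
    {υ : Fin d → ℝ} {c : ℝ} (hυ : ∀ a, 0 < υ a) (hc : 0 < c)
    (hL : ∀ v : Fin d → ℝ, c * ∑ a, v a ^ 2 ≤
      (K : ℝ)⁻¹ * ∑ k, ((L * (Matrix.diagonal υ)⁻¹) *ᵥ v) k ^ 2)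
    {B : ℝ} (hLB : ∀ k a, |(L * (Matrix.diagonal υ)⁻¹) k a| ≤ B)
    {H : Matrix ι (Fin K) ℝ} {D : Matrix ι (Fin d) ℝ} {b : ℝ} (hb : 0 ≤ b)
    (hR : ∀ l k, |(H - D * Lᵀ) l k| ≤ b) {υ₀ : ℝ} (hυ₀ : 0 < υ₀) (hυ₀' : ∀ a, υ₀ ≤ υ a)
    {BD cD : ℝ} (hcD : 0 < cD) (hD : ∀ l a, |D l a| ≤ BD)
    (hDc : ∀ v : Fin d → ℝ,
      cD * ∑ a, v a ^ 2 ≤ (Fintype.card ι : ℝ)⁻¹ * ∑ l, (D *ᵥ v) l ^ 2)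
    (hsmall : b ^ 2 / (c * υ₀ ^ 2) ≤ cD / 4) {F : Matrix ι (Fin d) ℝ}
    (hF : F = H * L * (Lᵀ * L)⁻¹) :
    (∀ l k, |(H - F * Lᵀ) l k| ≤ (1 + √(d * B ^ 2 / c)) * b) ∧
    cD / 4 ≤ sMin ((Fintype.card ι : ℝ)⁻¹ • (Fᵀ * F)) ∧
    sMax ((Fintype.card ι : ℝ)⁻¹ • (Fᵀ * F)) ≤ 2 * (d * BD ^ 2) + cD / 2 := by
  have hdet := isUnit_det_gram hυ hc hL
  set R := H - D * Lᵀ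
  set S := R * L * (Lᵀ * L)⁻¹
  have hH : H = R + D * Lᵀ := by simp [R]
  -- Regressing `D L'` on `L` returns `D` exactly, so `F` differs from `D` only by the fit of the
  -- remainder.
  have hFS : F = D + S := by
    have h1 : D * Lᵀ * L * (Lᵀ * L)⁻¹ = D := by
      rw [Matrix.mul_assoc D, Matrix.mul_assoc D, Matrix.mul_nonsing_inv _ hdet, Matrix.mul_one]
    rw [hF, hH, Matrix.add_mul, Matrix.add_mul, h1, add_comm]
  set P : ℝ := (Fintype.card ι : ℝ)
  have hP : 0 < P := by simp only [P]; exact_mod_cast Fintype.card_pos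
  have hS : ∀ v : Fin d → ℝ, P⁻¹ * ∑ l, (S *ᵥ v) l ^ 2 ≤ cD / 4 * ∑ a, v a ^ 2 := by
    intro v
    have h1 := sum_sq_mulVec_leastSquares_le hυ hc hL hR hυ₀ hυ₀' v
    have h0 : 0 ≤ ∑ a, v a ^ 2 := Finset.sum_nonneg fun a _ => sq_nonneg _
    calc P⁻¹ * ∑ l, (S *ᵥ v) l ^ 2
        ≤ P⁻¹ * (P * (b ^ 2 / (c * υ₀ ^ 2)) * ∑ a, v a ^ 2) := by gcongr
      _ = b ^ 2 / (c * υ₀ ^ 2) * ∑ a, v a ^ 2 := by field_simp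
      _ ≤ _ := by gcongr
  have hDu : ∀ v : Fin d → ℝ, P⁻¹ * ∑ l, (D *ᵥ v) l ^ 2 ≤ d * BD ^ 2 * ∑ a, v a ^ 2 := by
    intro v
    calc P⁻¹ * ∑ l, (D *ᵥ v) l ^ 2 ≤ P⁻¹ * (P * (d * BD ^ 2) * ∑ a, v a ^ 2) := by
          gcongr; exact sum_sq_mulVec_le D hD v
      _ = _ := by field_simp
  refine ⟨fun l k => ?_, ?_, ?_⟩
  · have h1 : H - F * Lᵀ = R - R * L * (Lᵀ * L)⁻¹ * Lᵀ := by
      rw [hFS, hH, Matrix.add_mul]; abel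
    rw [h1]
    exact abs_sub_leastSquares_le hυ hc hL hb hR hLB l k
  · refine le_sMin_smul_gram hd F fun v => ?_
    -- From `D = F - S`: the bound `cD` on the form of `D` leaves `(cD - 2 cD/4) / 2 = cD/4` for
    -- `F`.
    have h1 : ∑ l, (D *ᵥ v) l ^ 2 ≤ 2 * ∑ l, (F *ᵥ v) l ^ 2 + 2 * ∑ l, (S *ᵥ v) l ^ 2 := by
      rw [Finset.mul_sum, Finset.mul_sum, ← Finset.sum_add_distrib]
      refine Finset.sum_le_sum fun l _ => ?_
      rw [hFS, Matrix.add_mulVec, Pi.add_apply]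
      nlinarith [sq_nonneg ((D *ᵥ v) l + 2 * (S *ᵥ v) l)]
    have h2 := mul_le_mul_of_nonneg_left h1 (inv_nonneg.2 hP.le)
    have h3 := hDc v
    have h4 := hS v
    linarith
  · refine sMax_smul_gram_le hd F (inv_nonneg.2 hP.le) (by positivity) fun v => ?_
    have h1 : ∑ l, (F *ᵥ v) l ^ 2 ≤ 2 * ∑ l, (D *ᵥ v) l ^ 2 + 2 * ∑ l, (S *ᵥ v) l ^ 2 := by
      rw [Finset.mul_sum, Finset.mul_sum, ← Finset.sum_add_distrib]
      refine Finset.sum_le_sum fun l _ => ?_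
      rw [hFS, Matrix.add_mulVec, Pi.add_apply]
      nlinarith [sq_nonneg ((D *ᵥ v) l - (S *ᵥ v) l)]
    have h2 := mul_le_mul_of_nonneg_left h1 (inv_nonneg.2 hP.le)
    have h3 := hDu v
    have h4 := hS v
    linarith

end Projection

/-! ### Scaled monomial loadings -/

section Loadings

variable {r N : ℕ}

theorem monomialVec_smul (e : GradedEnum r N) (t : ℝ) (y : EuclideanSpace ℝ (Fin r))
    (a : Fin ((N + r).choose r)) : monomialVec e (t • y) a = t ^ e.deg a * monomialVec e y a := by
  simp only [monomialVec, GradedEnum.deg, PiLp.smul_apply, smul_eq_mul, mul_pow,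
    Finset.prod_mul_distrib, Finset.prod_pow_eq_pow_sum]

theorem GradedEnum.deg_le (e : GradedEnum r N) (a : Fin ((N + r).choose r)) : e.deg a ≤ N :=
  (e.toEquiv a).2

/-- Homogeneity of monomials is what singles out `h^|q|` as the scale: dividing by it amounts to
rescaling the point. -/
theorem scaled_loadings_apply (e : GradedEnum r N) {K : ℕ} {h : ℝ} (hh : 0 < h)
    (y : Fin K → EuclideanSpace ℝ (Fin r)) {L : Matrix (Fin K) (Fin ((N + r).choose r)) ℝ}
    (hL : ∀ k a, L k a = monomialVec e (y k) a) (k : Fin K) (a : Fin ((N + r).choose r)) :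
    (L * (Matrix.diagonal fun a => h ^ e.deg a)⁻¹) k a = monomialVec e (h⁻¹ • y k) a := by
  rw [mul_inv_diagonal_apply (fun a => pow_pos hh _), hL, monomialVec_smul, inv_pow,
    div_eq_inv_mul]

theorem abs_scaled_loadings_le (e : GradedEnum r N) {C : ℝ} {y : EuclideanSpace ℝ (Fin r)}
    (hy : ‖y‖ ≤ C) (a : Fin ((N + r).choose r)) : |monomialVec e y a| ≤ max 1 C ^ N :=
  calc |monomialVec e y a| ≤ ‖y‖ ^ e.deg a := FactorArray.abs_monomialVec_le e y a
    _ ≤ max 1 C ^ e.deg a := by gcongr; exact hy.trans (le_max_right _ _)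
    _ ≤ max 1 C ^ N := pow_le_pow_right₀ (le_max_left _ _) (e.deg_le a)

/-- If fewer than half of the points lie where the unit-norm polynomial `P_v` is small, its mean
square over the points is bounded below. -/
theorem mean_sq_monomialVec_ge (e : GradedEnum r N) {K : ℕ} (hK : 0 < K) {ε : ℝ} (hε : 0 < ε)
    (y : Fin K → EuclideanSpace ℝ (Fin r))
    (hy : ∀ v : Fin ((N + r).choose r) → ℝ, ∑ a, v a ^ 2 = 1 →
      ∑ k, {z | |monomialVec e z ⬝ᵥ v| ≤ ε}.indicator (fun _ => (1 : ℝ)) (y k) ≤ (K : ℝ) / 2)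
    (v : Fin ((N + r).choose r) → ℝ) :
    ε ^ 2 / 2 * ∑ a, v a ^ 2 ≤ (K : ℝ)⁻¹ * ∑ k, (monomialVec e (y k) ⬝ᵥ v) ^ 2 := by
  have hK' : (0 : ℝ) < K := by exact_mod_cast hK
  have hunit : ∀ v : Fin ((N + r).choose r) → ℝ, ∑ a, v a ^ 2 = 1 →
      ε ^ 2 / 2 ≤ (K : ℝ)⁻¹ * ∑ k, (monomialVec e (y k) ⬝ᵥ v) ^ 2 := by
    intro v hv
    -- Each point outside the sublevel set contributes at least `ε ^ 2`; those inside are bounded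
    -- below by `0`.
    have h1 : ∀ k, ε ^ 2 * (1 - {z | |monomialVec e z ⬝ᵥ v| ≤ ε}.indicator
        (fun _ => (1 : ℝ)) (y k)) ≤ (monomialVec e (y k) ⬝ᵥ v) ^ 2 := by
      intro k
      by_cases h : |monomialVec e (y k) ⬝ᵥ v| ≤ ε
      · rw [Set.indicator_of_mem (by exact h)]
        simpa using sq_nonneg _
      · rw [Set.indicator_of_notMem (by exact h), sub_zero, mul_one, ← sq_abs (_ ⬝ᵥ _)]
        push Not at h
        gcongr
    have h2 := Finset.sum_le_sum fun k (_ : k ∈ Finset.univ) => h1 k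
    rw [← Finset.mul_sum, Finset.sum_sub_distrib] at h2
    simp only [Finset.sum_const, Finset.card_univ, Fintype.card_fin, nsmul_eq_mul, mul_one] at h2
    have h3 := hy v hv
    rw [inv_mul_eq_div, le_div_iff₀ hK']
    have h4 : ε ^ 2 * ((K : ℝ) / 2) ≤ ε ^ 2 * ((K : ℝ) -
        ∑ k, {z | |monomialVec e z ⬝ᵥ v| ≤ ε}.indicator (fun _ => (1 : ℝ)) (y k)) := by
      gcongr; linarith
    linarith
  set s := ∑ a, v a ^ 2
  have hs0 : 0 ≤ s := Finset.sum_nonneg fun a _ => sq_nonneg _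
  rcases hs0.eq_or_lt with h0 | hs
  · rw [← h0, mul_zero]
    exact mul_nonneg (inv_nonneg.2 hK'.le) (Finset.sum_nonneg fun k _ => sq_nonneg _)
  · have h1 := hunit ((√s)⁻¹ • v) (by
      simp only [Pi.smul_apply, smul_eq_mul, mul_pow, ← Finset.mul_sum, inv_pow,
        Real.sq_sqrt hs0]
      exact inv_mul_cancel₀ hs.ne')
    simp only [dotProduct_smul, smul_eq_mul, mul_pow, ← Finset.mul_sum, inv_pow,
      Real.sq_sqrt hs0] at h1
    rw [← mul_assoc, mul_comm _ s⁻¹, mul_assoc, inv_mul_eq_div, le_div_iff₀ hs] at h1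
    exact h1

end Loadings

/-! ### Stochastic orders and counting arguments -/

section Orders

variable {Ω : ℕ → Type*} [∀ n, MeasurableSpace (Ω n)] {μ : ∀ n, Measure (Ω n)}
  {a b : ∀ n, Ω n → ℝ}

/-- For `b ≥ 0` the events shrink as `ε` grows, so one constant for each `δ` controls the whole tail
of the limit. -/
theorem StochLE.of_forall_exists (hb : ∀ n ω, 0 ≤ b n ω)
    (h : ∀ δ : ℝ≥0∞, 0 < δ → ∃ E : ℝ, ∀ᶠ n in atTop, μ n {ω | E * b n ω ≤ |a n ω|} ≤ δ) :
    StochLE μ a b := by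
  rw [StochLE, ENNReal.tendsto_nhds_zero]
  intro δ hδ
  obtain ⟨E, hE⟩ := h δ hδ
  filter_upwards [eventually_ge_atTop E] with ε hε
  refine limsup_le_of_le (by isBoundedDefault) ?_
  filter_upwards [hE] with n hn
  refine (measure_mono fun ω hω => ?_).trans hn
  exact (mul_le_mul_of_nonneg_right hε (hb n ω)).trans hω

theorem StochLE.exists_eventually_le (h : StochLE μ a b) {δ : ℝ≥0∞} (hδ : 0 < δ) :
    ∃ E : ℝ, 0 < E ∧ ∀ᶠ n in atTop, μ n {ω | E * b n ω ≤ |a n ω|} ≤ δ := by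
  have h1 := (h.eventually (gt_mem_nhds hδ)).and (eventually_gt_atTop (0 : ℝ))
  obtain ⟨E, hE, hE0⟩ := h1.exists
  exact ⟨E, hE0, (eventually_lt_of_limsup_lt hE).mono fun n hn => hn.le⟩

theorem WPA1.eventually_le {S : ∀ n, Set (Ω n)} (h : WPA1 μ S) {δ : ℝ≥0∞} (hδ : 0 < δ) :
    ∀ᶠ n in atTop, μ n (S n)ᶜ ≤ δ :=
  (h.eventually (gt_mem_nhds hδ)).mono fun _ hn => hn.le

end Orders

section CountIn

variable {Ω E : Type*} {n K : ℕ}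

/-- Injectivity lets any data-dependent selection be bounded by the full sample, so the dependence
of the neighbours on the noise plays no role. -/
theorem sum_indicator_comp_le_countIn (X : Fin n → Ω → E) (S : Set E) (ω : Ω)
    {σ : Fin K → Fin n} (hσ : Function.Injective σ) :
    ∑ k, S.indicator (fun _ => (1 : ℝ)) (X (σ k) ω) ≤ countIn X S ω := by
  classical
  rw [← Finset.sum_image (f := fun j => S.indicator (fun _ => (1 : ℝ)) (X j ω))
    (g := σ) hσ.injOn]
  exact Finset.sum_le_univ_sum_of_nonneg fun j => Set.indicator_nonneg (fun _ _ => zero_le_one) _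

theorem exists_notMem_range_of_lt_countIn (X : Fin n → Ω → E) (S : Set E) (ω : Ω)
    (σ : Fin K → Fin n) (h : (K : ℝ) < countIn X S ω) : ∃ j, j ∉ Set.range σ ∧ X j ω ∈ S := by
  classical
  by_contra! hno
  refine h.not_ge ?_
  have h1 : ∀ j, S.indicator (fun _ => (1 : ℝ)) (X j ω)
      ≤ if j ∈ Finset.univ.image σ then 1 else 0 := by
    intro j
    by_cases hj : j ∈ Set.range σ
    · rw [if_pos (by simpa using hj)]
      exact Set.indicator_le_self' (fun _ _ => zero_le_one) _
    · rw [if_neg (by simpa using hj), Set.indicator_of_notMem (hno j hj)]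
  refine (Finset.sum_le_sum fun j _ => h1 j).trans ?_
  rw [Finset.sum_ite_mem, Finset.univ_inter, Finset.sum_const, nsmul_eq_mul, mul_one]
  exact_mod_cast Finset.card_image_le.trans (by simp)

end CountIn

/-! ### Radius of the nearest neighbours -/

namespace FactorArray

variable {Ω : ℕ → Type*} [∀ n, MeasurableSpace (Ω n)] {r : ℕ} (M : FactorArray Ω r)

theorem IsNearestNeighbors.one_le {M : FactorArray Ω r} {K : ℕ → ℕ}
    {ρ : ∀ n, M.MatchData n → Fin n → Fin n → ℝ}
    {nn : ∀ n, M.MatchData n → Fin n → Fin (K n) → Fin n} (hnn : M.IsNearestNeighbors K ρ nn)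
    {n : ℕ} (hn : 0 < n) : 1 ≤ K n := by
  obtain ⟨k, -⟩ := hnn.self_mem n (fun _ _ => 0) ⟨0, hn⟩
  have := k.2
  omega

theorem IsNearestNeighbors.le {M : FactorArray Ω r} {K : ℕ → ℕ}
    {ρ : ∀ n, M.MatchData n → Fin n → Fin n → ℝ}
    {nn : ∀ n, M.MatchData n → Fin n → Fin (K n) → Fin n} (hnn : M.IsNearestNeighbors K ρ nn)
    {n : ℕ} (hn : 0 < n) : K n ≤ n := by
  simpa using Fintype.card_le_of_injective _ (hnn.injective n (fun _ _ => 0) ⟨0, hn⟩)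

/-- On the event that the distances are sandwiched and the balls of radius `D h` contain more than
`K` points, all `K` nearest neighbours lie within a multiple of `h`. -/
theorem norm_nbr_sub_le {K : ℕ → ℕ} {ρ : ∀ n, M.MatchData n → Fin n → Fin n → ℝ}
    {nn : ∀ n, M.MatchData n → Fin n → Fin (K n) → Fin n} (hnn : M.IsNearestNeighbors K ρ nn)
    {ρ₀ ς C₁ C₂ c₃ D h a : ℝ} (hς : 0 < ς) (hC₁ : 0 ≤ C₁) (hC₂ : 0 ≤ C₂) (hc₃ : 0 < c₃)
    (hD : 0 < D) (hh : 0 < h) (hah : a ≤ h ^ ς) {n : ℕ} {ω : Ω n}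
    (hne : ∀ i j, i ≠ j → M.α n i ω ≠ M.α n j ω)
    (hden : ∀ i j, i ≠ j →
      |ρ n (M.Xdag n ω) i j - ρ n (M.Hdag n ω) i j - ρ₀| ≤ C₁ * a)
    (hup : ∀ i j, i ≠ j → ρ n (M.Hdag n ω) i j / ‖M.α n i ω - M.α n j ω‖ ^ ς ≤ C₂)
    (hlo : ∀ i j, i ≠ j → c₃ ≤ ρ n (M.Hdag n ω) i j / ‖M.α n i ω - M.α n j ω‖ ^ ς)
    (hcount : ∀ i, (K n : ℝ) < countIn (M.α n) (Metric.closedBall (M.α n i ω) (D * h)) ω)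
    (i : Fin n) (k : Fin (K n)) :
    ‖M.α n (M.nbr nn n i k ω) ω - M.α n i ω‖ ≤
      ((C₂ * D ^ ς + 2 * C₁) / c₃ + 1) ^ (1 / ς) * h := by
  set C : ℝ := ((C₂ * D ^ ς + 2 * C₁) / c₃ + 1) ^ (1 / ς)
  have hbase : 0 < (C₂ * D ^ ς + 2 * C₁) / c₃ + 1 := by positivity
  have hC0 : 0 < C := Real.rpow_pos_of_pos hbase _
  have hCς : C ^ ς = (C₂ * D ^ ς + 2 * C₁) / c₃ + 1 := by
    rw [← Real.rpow_mul hbase.le, one_div_mul_cancel hς.ne', Real.rpow_one]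
  by_contra! hlt
  set q := M.nbr nn n i k ω
  have hqi : q ≠ i := by
    intro h0
    rw [h0, sub_self, norm_zero] at hlt
    have : 0 < C * h := by positivity
    linarith
  -- Pigeonhole: the ball holds more than `K` units, so one of them is not listed, and it is no
  -- closer in `ρ` than the listed `q`.
  obtain ⟨j, hj, hjball⟩ := exists_notMem_range_of_lt_countIn (M.α n) _ ω
    (nn n (M.Xdag n ω) i) (hcount i)
  have hji : i ≠ j := by
    rintro rfl
    exact hj (hnn.self_mem n _ i)
  have hnear := hnn.nearest n (M.Xdag n ω) i k j hqi hj
  change ρ n (M.Xdag n ω) i q ≤ _ at hnear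
  have hpos : ∀ j, i ≠ j → 0 < ‖M.α n i ω - M.α n j ω‖ := fun j hij =>
    norm_pos_iff.2 (sub_ne_zero.2 (hne i j hij))
  have h1 : c₃ * (C * h) ^ ς ≤ ρ n (M.Hdag n ω) i q := by
    have h2 := hlo i q hqi.symm
    rw [le_div_iff₀ (Real.rpow_pos_of_pos (hpos q hqi.symm) _)] at h2
    refine le_trans ?_ h2
    gcongr
    rw [norm_sub_rev]; exact hlt.le
  have h2 : ρ n (M.Hdag n ω) i j ≤ C₂ * (D * h) ^ ς := by
    have h3 := hup i j hji
    rw [div_le_iff₀ (Real.rpow_pos_of_pos (hpos j hji) _)] at h3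
    refine h3.trans ?_
    gcongr
    rw [norm_sub_rev, ← dist_eq_norm]
    exact hjball
  -- The offset cancels: `c₃ (C h)^ς - C₁ a ≤ ρ(X; i, q) - ρ₀ ≤ ρ(X; i, j) - ρ₀ ≤ C₂ (D h)^ς + C₁
  -- a`. Since `a ≤ h^ς`, the `+ 1` in the base of `C` makes this impossible.
  have h3 := abs_le.1 (hden i q hqi.symm)
  have h4 := abs_le.1 (hden i j hji)
  have hhς : 0 < h ^ ς := Real.rpow_pos_of_pos hh _
  rw [Real.mul_rpow hC0.le hh.le, hCς] at h1
  rw [Real.mul_rpow hD.le hh.le] at h2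
  have h5 : C₁ * a ≤ C₁ * h ^ ς := by gcongr
  have h6 : c₃ * (((C₂ * D ^ ς + 2 * C₁) / c₃ + 1) * h ^ ς)
      = (C₂ * D ^ ς + 2 * C₁) * h ^ ς + c₃ * h ^ ς := by
    field_simp
  rw [h6] at h1
  have h7 : 0 < c₃ * h ^ ς := by positivity
  nlinarith [h3.1, h3.2, h4.1, h4.2]

end FactorArray

/-! ### The deterministic local fit -/

namespace FactorArray

variable {Ω : ℕ → Type*} [∀ n, MeasurableSpace (Ω n)] {r : ℕ} (M : FactorArray Ω r)
  {A : Set (EuclideanSpace ℝ (Fin r))} {μ : ∀ n, Measure (Ω n)} {mbar : ℕ}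
  {K : ℕ → ℕ} {m : ℕ}

/-- The matrix of all partial derivatives of the latent functions in the local-PCA rows. -/
noncomputable def derivMatrix (A : Set (EuclideanSpace ℝ (Fin r))) (e : GradedEnum r (m - 1)) (n : ℕ)
    (i : Fin n) (ω : Ω n) : Matrix {l // l ∈ M.Rddag n} (Fin ((m - 1 + r).choose r)) ℝ :=
  Matrix.of fun l a => partialDeriv A (e.toEquiv a) (M.η n l ω) (M.α n i ω)

theorem derivGram_eq (e : GradedEnum r (m - 1)) (n : ℕ) (i : Fin n) (ω : Ω n) :
    M.derivGram A e n i ω = ((M.Rddag n).card : ℝ)⁻¹ •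
      ((M.derivMatrix A e n i ω)ᵀ * M.derivMatrix A e n i ω) := by
  rw [derivGram]
  congr 1
  ext a b
  rw [Matrix.sum_apply, Matrix.mul_apply, ← Finset.sum_coe_sort (M.Rddag n)]
  rfl

/-- All the bounds of the local-approximation condition, for one outcome. -/
structure LocalFit (μ : ∀ n, Measure (Ω n)) (A : Set (EuclideanSpace ℝ (Fin r)))
    (nn : ∀ n, M.MatchData n → Fin n → Fin (K n) → Fin n) (e : GradedEnum r (m - 1)) (h E : ℝ)
    (n : ℕ) (ω : Ω n) : Prop where
  invertible : ∀ i, IsUnit (condExpMat (μ n) (M.sigmaMatch A n)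
    (fun ω' => (M.monomialLoadings nn e n i ω')ᵀ * M.monomialLoadings nn e n i ω') ω).det
  loadings_max : ∀ i, matMaxNorm
    (M.monomialLoadings nn e n i ω * (Matrix.diagonal fun b => h ^ e.deg b)⁻¹) ≤ E
  loadings_min : ∀ i, E⁻¹ ≤ sMin (scaledGram (fun b => h ^ e.deg b) (M.monomialLoadings nn e n i ω))
  loadings_sup : ∀ i, sMax (scaledGram (fun b => h ^ e.deg b) (M.monomialLoadings nn e n i ω)) ≤ E
  bias : ∀ i, matMaxNorm (M.Xiloc μ A nn (M.monomialLoadings nn e) n i ω) ≤ E * h ^ m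
  factors_min : ∀ i, E⁻¹ ≤ sMin (((M.Rddag n).card : ℝ)⁻¹ •
    ((M.Floc μ A nn (M.monomialLoadings nn e) n i ω)ᵀ *
      M.Floc μ A nn (M.monomialLoadings nn e) n i ω))
  factors_sup : ∀ i, sMax (((M.Rddag n).card : ℝ)⁻¹ •
    ((M.Floc μ A nn (M.monomialLoadings nn e) n i ω)ᵀ *
      M.Floc μ A nn (M.monomialLoadings nn e) n i ω)) ≤ E

set_option maxHeartbeats 400000 in
-- The pointwise half of the proof. `E` and `h₀` are fixed before `n` and `ω` and depend only on the
-- constants, so a probability statement about the hypotheses transfers at once to the conclusion.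
theorem exists_localFit (nn : ∀ n, M.MatchData n → Fin n → Fin (K n) → Fin n)
    (hinj : ∀ n V i, Function.Injective (nn n V i)) (hm : 1 ≤ m) (e : GradedEnum r (m - 1))
    {B T C ε c₀ : ℝ} (hB : 0 < B) (hT : 0 ≤ T) (hC : 0 ≤ C) (hε : 0 < ε) (hc₀ : 0 < c₀) :
    ∃ E > (0 : ℝ), ∃ h₀ > (0 : ℝ), ∀ h, 0 < h → h ≤ h₀ → ∀ n, 0 < K n → 0 < (M.Rddag n).card →
      ∀ ω : Ω n,
      (∀ i, M.α n i ω ∈ A) →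
      (∀ i j l, |M.H n j l ω - ∑ a, taylorWeight e a *
        partialDeriv A (e.toEquiv a) (M.η n l ω) (M.α n i ω) *
        monomialVec e (M.α n j ω - M.α n i ω) a| ≤ T * ‖M.α n j ω - M.α n i ω‖ ^ m) →
      (∀ i l a, |partialDeriv A (e.toEquiv a) (M.η n l ω) (M.α n i ω)| ≤ B) →
      (∀ i, condExpMat (μ n) (M.sigmaMatch A n)
        (fun ω' => (M.monomialLoadings nn e n i ω')ᵀ * M.monomialLoadings nn e n i ω') ω
        = (M.monomialLoadings nn e n i ω)ᵀ * M.monomialLoadings nn e n i ω) →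
      (∀ i, condExpMat (μ n) (M.sigmaMatch A n)
        (fun ω' => M.Hloc nn n i ω' * M.monomialLoadings nn e n i ω') ω
        = M.Hloc nn n i ω * M.monomialLoadings nn e n i ω) →
      (∀ i k, ‖M.α n (M.nbr nn n i k ω) ω - M.α n i ω‖ ≤ C * h) →
      (∀ x ∈ A, ∀ v : Fin ((m - 1 + r).choose r) → ℝ, ∑ a, v a ^ 2 = 1 →
        countIn (M.α n) {y | ‖h⁻¹ • (y - x)‖ ≤ C ∧
          |monomialVec e (h⁻¹ • (y - x)) ⬝ᵥ v| ≤ ε} ω < (K n : ℝ) / 2) →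
      (∀ i, c₀ ≤ sMin (M.derivGram A e n i ω)) →
      M.LocalFit μ A nn e h E n ω := by
  set d := (m - 1 + r).choose r
  have hd : 0 < d := Nat.choose_pos (by omega)
  have : Nonempty (Fin d) := ⟨⟨0, hd⟩⟩
  obtain ⟨a₀, ha₀⟩ := Finite.exists_min (taylorWeight e)
  obtain ⟨w₀, hw₀, hw₀le⟩ : ∃ w₀ > (0 : ℝ), ∀ a, w₀ ≤ taylorWeight e a :=
    ⟨taylorWeight e a₀, taylorWeight_pos e a₀, ha₀⟩
  obtain ⟨W, hW⟩ : ∃ W : ℝ, ∀ a, taylorWeight e a ≤ W :=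
    ⟨∑ a, taylorWeight e a, fun a =>
      Finset.single_le_sum (fun a _ => (taylorWeight_pos e a).le) (Finset.mem_univ a)⟩
  have hdR : (0 : ℝ) < d := by exact_mod_cast hd
  obtain ⟨cL, hcL, hcLeq⟩ : ∃ cL > (0 : ℝ), cL = ε ^ 2 / 2 := ⟨_, by positivity, rfl⟩
  obtain ⟨BL, hBL, hBLeq⟩ : ∃ BL : ℝ, 1 ≤ BL ∧ BL = max 1 C ^ (m - 1) :=
    ⟨_, one_le_pow₀ (le_max_left _ _), rfl⟩
  -- Lower bound for the form of the weighted derivative matrix `D`: `c₀² / (d B²)` from the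
  -- derivative Gram matrix, times the square of the least Taylor weight.
  obtain ⟨cD, hcD, hcDeq⟩ : ∃ cD > (0 : ℝ), cD = c₀ ^ 2 * w₀ ^ 2 / (d * B ^ 2) :=
    ⟨_, by positivity, rfl⟩
  -- With remainder bound `T (C h)^m` and smallest scale `h^(m-1)`, the perturbation of `D` has
  -- squared size at most `q h²`.
  obtain ⟨q, hq, hqeq⟩ : ∃ q : ℝ, 0 ≤ q ∧ q = T ^ 2 * C ^ (2 * m) / cL := ⟨_, by positivity, rfl⟩
  -- The sum of all upper bounds and of the reciprocals of all lower bounds, so that one constant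
  -- serves every clause.
  obtain ⟨E, hEeq⟩ : ∃ E : ℝ, E = BL + d * BL ^ 2 + cL⁻¹ + (1 + √(d * BL ^ 2 / cL)) * (T * C ^ m) + (cD / 4)⁻¹ +
    (2 * (d * (W * B) ^ 2) + cD / 2) := ⟨_, rfl⟩
  have hE1 : 0 < BL := by linarith
  have hE2 : 0 ≤ d * BL ^ 2 := by positivity
  have hE3 : 0 < cL⁻¹ := by positivity
  have hE4 : 0 ≤ (1 + √(d * BL ^ 2 / cL)) * (T * C ^ m) := by positivity
  have hE5 : 0 < (cD / 4)⁻¹ := by positivity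
  have hE6 : 0 ≤ 2 * (d * (W * B) ^ 2) + cD / 2 := by positivity
  have hE : 0 < E := by rw [hEeq]; linarith
  refine ⟨E, hE, min 1 (cD / 4 / (q + 1)), by positivity, ?_⟩
  intro h hh hhle n hK hcard ω hα hTay hder hce1 hce2 hnear hsub hgram
  have hh1 : h ≤ 1 := hhle.trans (min_le_left _ _)
  have hh2 : h ≤ cD / 4 / (q + 1) := hhle.trans (min_le_right _ _)
  have hυ : ∀ a : Fin d, 0 < h ^ e.deg a := fun a => pow_pos hh _
  have hυ₀ : ∀ a : Fin d, h ^ (m - 1) ≤ h ^ e.deg a := fun a =>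
    pow_le_pow_of_le_one hh.le hh1 (e.deg_le a)
  have hKR : (0 : ℝ) < K n := by exact_mod_cast hK
  have key : ∀ i, IsUnit ((M.monomialLoadings nn e n i ω)ᵀ * M.monomialLoadings nn e n i ω).det ∧
      matMaxNorm (M.monomialLoadings nn e n i ω * (Matrix.diagonal fun b => h ^ e.deg b)⁻¹) ≤ BL ∧
      cL ≤ sMin (scaledGram (fun b => h ^ e.deg b) (M.monomialLoadings nn e n i ω)) ∧
      sMax (scaledGram (fun b => h ^ e.deg b) (M.monomialLoadings nn e n i ω)) ≤ d * BL ^ 2 ∧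
      (∀ l k, |M.Xiloc μ A nn (M.monomialLoadings nn e) n i ω l k|
        ≤ (1 + √(d * BL ^ 2 / cL)) * (T * (C * h) ^ m)) ∧
      cD / 4 ≤ sMin (((M.Rddag n).card : ℝ)⁻¹ •
        ((M.Floc μ A nn (M.monomialLoadings nn e) n i ω)ᵀ *
          M.Floc μ A nn (M.monomialLoadings nn e) n i ω)) ∧
      sMax (((M.Rddag n).card : ℝ)⁻¹ •
        ((M.Floc μ A nn (M.monomialLoadings nn e) n i ω)ᵀ *
          M.Floc μ A nn (M.monomialLoadings nn e) n i ω)) ≤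
        2 * (d * (W * B) ^ 2) + cD / 2 := by
    intro i
    set L := M.monomialLoadings nn e n i ω
    set y : Fin (K n) → EuclideanSpace ℝ (Fin r) := fun k => M.α n (M.nbr nn n i k ω) ω - M.α n i ω
    have hLy : ∀ k a, L k a = monomialVec e (y k) a := fun k a =>
      M.monomialLoadings_eq nn e n i ω k a
    have hsc : ∀ k, ‖h⁻¹ • y k‖ ≤ C := by
      intro k
      rw [norm_smul, norm_inv, Real.norm_of_nonneg hh.le, inv_mul_le_iff₀ hh, mul_comm]
      exact hnear i k
    have hLs := scaled_loadings_apply e hh y hLy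
    have hLB : ∀ k a, |(L * (Matrix.diagonal fun a => h ^ e.deg a)⁻¹) k a| ≤ BL := by
      intro k a
      rw [hLs]
      rw [hBLeq]
      exact abs_scaled_loadings_le e (hsc k) a
    have hmv : ∀ (v : Fin d → ℝ) k, ((L * (Matrix.diagonal fun a => h ^ e.deg a)⁻¹) *ᵥ v) k
        = monomialVec e (h⁻¹ • y k) ⬝ᵥ v := by
      intro v k
      rw [Matrix.mulVec]
      congr 1
      ext a
      exact hLs k a
    have hL : ∀ v : Fin d → ℝ, cL * ∑ a, v a ^ 2 ≤
        (K n : ℝ)⁻¹ * ∑ k, ((L * (Matrix.diagonal fun a => h ^ e.deg a)⁻¹) *ᵥ v) k ^ 2 := by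
      intro v
      simp only [hmv, hcLeq]
      refine mean_sq_monomialVec_ge e hK hε (fun k => h⁻¹ • y k) (fun v hv => ?_) v
      -- All neighbours already satisfy the radius condition, so those in the sublevel set are among
      -- the counted sample points.
      refine le_trans ?_ (hsub (M.α n i ω) (hα i) v hv).le
      refine le_trans (Finset.sum_le_sum fun k _ => ?_) (sum_indicator_comp_le_countIn (M.α n) _ ω
        (hinj n (M.Xdag n ω) i))
      by_cases hk : |monomialVec e (h⁻¹ • y k) ⬝ᵥ v| ≤ ε
      · rw [Set.indicator_of_mem (by exact hk), Set.indicator_of_mem (by exact ⟨hsc k, hk⟩)]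
      · rw [Set.indicator_of_notMem (by exact hk)]
        exact Set.indicator_nonneg (fun _ _ => zero_le_one) _
    have hdet := isUnit_det_gram hυ hcL hL
    set D : Matrix {l // l ∈ M.Rddag n} (Fin d) ℝ := Matrix.of fun l a =>
      taylorWeight e a * M.derivMatrix A e n i ω l a
    have hD0 : ∀ l a, |M.derivMatrix A e n i ω l a| ≤ B := fun l a => hder i l a
    have hD : ∀ l a, |D l a| ≤ W * B := by
      intro l a
      change |taylorWeight e a * M.derivMatrix A e n i ω l a| ≤ W * B
      rw [abs_mul, abs_of_pos (taylorWeight_pos e a)]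
      exact mul_le_mul (hW a) (hD0 l a) (abs_nonneg _)
        ((taylorWeight_pos e a).le.trans (hW a))
    have hcardeq : (Fintype.card {l // l ∈ M.Rddag n} : ℝ) = (M.Rddag n).card := by
      rw [Fintype.card_coe]
    have hDc : ∀ v : Fin d → ℝ, cD * ∑ a, v a ^ 2 ≤
        (Fintype.card {l // l ∈ M.Rddag n} : ℝ)⁻¹ * ∑ l, (D *ᵥ v) l ^ 2 := by
      intro v
      have h1 := sum_sq_mulVec_ge_of_sMin hc₀ (M.derivMatrix A e n i ω) hD0
        (by rw [hcardeq, ← derivGram_eq]; exact hgram i) fun a => taylorWeight e a * v a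
      have h2 : (M.derivMatrix A e n i ω) *ᵥ (fun a => taylorWeight e a * v a) = D *ᵥ v := by
        ext l
        simp only [Matrix.mulVec, dotProduct, D, Matrix.of_apply]
        exact Finset.sum_congr rfl fun a _ => by ring
      rw [h2] at h1
      have h3 : w₀ ^ 2 * ∑ a, v a ^ 2 ≤ ∑ a, (taylorWeight e a * v a) ^ 2 := by
        rw [Finset.mul_sum]
        refine Finset.sum_le_sum fun a _ => ?_
        rw [mul_pow]
        gcongr
        exact hw₀le a
      rw [hcDeq, div_mul_eq_mul_div, div_le_iff₀ (by positivity)]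
      calc c₀ ^ 2 * w₀ ^ 2 * ∑ a, v a ^ 2 = c₀ ^ 2 * (w₀ ^ 2 * ∑ a, v a ^ 2) := by ring
        _ ≤ c₀ ^ 2 * ∑ a, (taylorWeight e a * v a) ^ 2 := by gcongr
        _ ≤ _ := h1
        _ = _ := by ring
    have hR : ∀ l k, |(M.Hloc nn n i ω - D * Lᵀ) l k| ≤ T * (C * h) ^ m := by
      intro l k
      have h1 := hTay i (M.nbr nn n i k ω) l
      have h2 : (M.Hloc nn n i ω - D * Lᵀ) l k = M.H n (M.nbr nn n i k ω) l ω -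
          ∑ a, taylorWeight e a * partialDeriv A (e.toEquiv a) (M.η n l ω) (M.α n i ω) *
          monomialVec e (M.α n (M.nbr nn n i k ω) ω - M.α n i ω) a := by
        rw [Matrix.sub_apply, Matrix.mul_apply]
        congr 1
      rw [h2]
      refine h1.trans ?_
      gcongr
      exact hnear i k
    have hne : Nonempty {l // l ∈ M.Rddag n} := by
      obtain ⟨l, hl⟩ := Finset.card_pos.1 hcard
      exact ⟨⟨l, hl⟩⟩
    have hsmall : (T * (C * h) ^ m) ^ 2 / (cL * (h ^ (m - 1)) ^ 2) ≤ cD / 4 := by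
      have h1 : (T * (C * h) ^ m) ^ 2 / (cL * (h ^ (m - 1)) ^ 2) = q * h ^ 2 := by
        obtain ⟨m', rfl⟩ : ∃ m', m = m' + 1 := ⟨m - 1, by omega⟩
        have hh0 := hh.ne'
        simp only [hqeq, Nat.add_sub_cancel]
        field_simp
        ring
      have h2 : h ^ 2 ≤ h := by nlinarith
      have h3 := mul_le_mul_of_nonneg_left h2 hq
      rw [h1]
      calc q * h ^ 2 ≤ (q + 1) * h := by linarith
        _ ≤ (q + 1) * (cD / 4 / (q + 1)) := by gcongr
        _ = cD / 4 := by field_simp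
    have hF : M.Floc μ A nn (M.monomialLoadings nn e) n i ω
        = M.Hloc nn n i ω * L * (Lᵀ * L)⁻¹ := by
      rw [Floc, hce1, hce2]
    have hproj := projection_bounds hd hυ hcL hL hLB (b := T * (C * h) ^ m) (by positivity) hR
      (pow_pos hh (m - 1)) hυ₀ hcD hD hDc hsmall hF
    rw [hcardeq] at hproj
    refine ⟨hdet, matMaxNorm_le (by linarith) hLB, ?_, ?_, hproj⟩
    · rw [scaledGram_eq]
      exact le_sMin_smul_gram hd _ hL
    · rw [scaledGram_eq]
      refine sMax_smul_gram_le hd _ (by positivity) (by positivity) fun v => ?_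
      have h1 := sum_sq_mulVec_le _ hLB v
      rw [Fintype.card_fin] at h1
      calc _ ≤ (K n : ℝ)⁻¹ * (K n * (d * BL ^ 2) * ∑ a, v a ^ 2) := by gcongr
        _ = _ := by field_simp
  have hEle : ∀ {x : ℝ}, 0 < x → x⁻¹ ≤ E → E⁻¹ ≤ x := fun hx hxE =>
    inv_le_of_inv_le₀ hx hxE
  refine ⟨fun i => ?_, fun i => ?_, fun i => ?_, fun i => ?_, fun i => ?_, fun i => ?_,
    fun i => ?_⟩
  · rw [hce1]; exact (key i).1
  · refine (key i).2.1.trans ?_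
    rw [hEeq]; linarith
  · refine le_trans (hEle hcL ?_) (key i).2.2.1
    rw [hEeq]; linarith
  · refine (key i).2.2.2.1.trans ?_
    rw [hEeq]; linarith
  · refine matMaxNorm_le (by positivity) fun l k => ((key i).2.2.2.2.1 l k).trans ?_
    rw [mul_pow, ← mul_assoc T, ← mul_assoc]
    gcongr
    rw [hEeq]; linarith
  · refine le_trans (hEle (by positivity) ?_) (key i).2.2.2.2.2.1
    rw [hEeq]; linarith
  · refine (key i).2.2.2.2.2.2.trans ?_
    rw [hEeq]; linarith

end FactorArray

/-! ### The bandwidth -/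

theorem bandwidth_eq {K : ℕ → ℕ} {ς : ℝ} (hς : 0 < ς) (r n : ℕ) :
    bandwidth K ς ς r n = ((K n : ℝ) / n) ^ ((r : ℝ)⁻¹) := by
  rw [bandwidth, div_mul_eq_div_div, div_self hς.ne', one_div]

/-- With equal exponents the bandwidth is `(K / n)^(1/r)`, the radius at which balls have mass of
order `K / n`. -/
theorem bandwidth_pow {K : ℕ → ℕ} {ς : ℝ} (hς : 0 < ς) {r : ℕ} (hr : 1 ≤ r) (n : ℕ) :
    bandwidth K ς ς r n ^ r = (K n : ℝ) / n := by
  rw [bandwidth_eq hς, Real.rpow_inv_natCast_pow (by positivity) (by omega)]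

theorem tendsto_bandwidth {K : ℕ → ℕ} {ς : ℝ} (hς : 0 < ς) {r : ℕ} (hr : 1 ≤ r)
    (hK : Tendsto (fun n => (K n : ℝ) / (n : ℝ)) atTop (𝓝 0)) :
    Tendsto (bandwidth K ς ς r) atTop (𝓝 0) := by
  have hr' : (0 : ℝ) < (r : ℝ)⁻¹ := by positivity
  have := hK.rpow_const (p := (r : ℝ)⁻¹) (Or.inr hr'.le)
  rw [Real.zero_rpow hr'.ne'] at this
  exact this.congr fun n => (bandwidth_eq hς r n).symm

namespace FactorArray

variable {Ω : ℕ → Type*} [∀ n, MeasurableSpace (Ω n)] {r : ℕ} (M : FactorArray Ω r)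
  {A : Set (EuclideanSpace ℝ (Fin r))} {μ : ∀ n, Measure (Ω n)} {mbar : ℕ}
  {K : ℕ → ℕ} {ρ : ∀ n, M.MatchData n → Fin n → Fin n → ℝ}
  {nn : ∀ n, M.MatchData n → Fin n → Fin (K n) → Fin n} {m : ℕ}

theorem IsNearestNeighbors.bandwidth_pos {M : FactorArray Ω r}
    {ρ : ∀ n, M.MatchData n → Fin n → Fin n → ℝ}
    {nn : ∀ n, M.MatchData n → Fin n → Fin (K n) → Fin n} (hnn : M.IsNearestNeighbors K ρ nn)
    (ςlo ςup : ℝ) {n : ℕ} (hn : 0 < n) : 0 < bandwidth K ςlo ςup r n := by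
  have := hnn.one_le hn
  exact Real.rpow_pos_of_pos (by positivity) _

theorem IsNearestNeighbors.bandwidth_le_one {M : FactorArray Ω r}
    {ρ : ∀ n, M.MatchData n → Fin n → Fin n → ℝ}
    {nn : ∀ n, M.MatchData n → Fin n → Fin (K n) → Fin n} (hnn : M.IsNearestNeighbors K ρ nn)
    {ς : ℝ} (hς : 0 < ς) {n : ℕ} (hn : 0 < n) : bandwidth K ς ς r n ≤ 1 := by
  rw [bandwidth_eq hς]
  refine Real.rpow_le_one (by positivity) ?_ (by positivity)
  rw [div_le_one (by exact_mod_cast hn)]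
  exact_mod_cast hnn.le hn

/-! ### Consequences of the regularity conditions -/

/-- The boundary of a convex set is null, so with empty interior `A` itself would be null and could
not carry a law with a density. -/
theorem Regularities.interior_nonempty [∀ n, IsProbabilityMeasure (μ n)]
    (hreg : M.Regularities μ A mbar) : (interior A).Nonempty := by
  by_contra hne
  rw [Set.not_nonempty_iff_eq_empty] at hne
  obtain ⟨f, c, C, -, -, -, hlaw⟩ := hreg.density
  have hA : volume A = 0 := by
    rw [← hreg.convex.addHaar_frontier (volume : Measure (EuclideanSpace ℝ (Fin r))), frontier,
      hne, Set.sdiff_empty, hreg.compact.isClosed.closure_eq]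
  have h1 : (μ 1).map (M.α 1 0) = 0 := by
    rw [hlaw, Measure.restrict_eq_zero.2 hA, withDensity_zero_left]
  have := Measure.isProbabilityMeasure_map (μ := μ 1) (M.measurable_α 1 0).aemeasurable
  exact IsProbabilityMeasure.ne_zero _ h1

/-- The Taylor expansion of the latent functions at the latent variables. -/
theorem Regularities.ae_abs_sub_taylor_le [∀ n, IsProbabilityMeasure (μ n)]
    (hreg : M.Regularities μ A mbar) (hm : 1 ≤ m) (hmbar : m ≤ mbar)
    (e : GradedEnum r (m - 1)) : ∃ B > (0 : ℝ), ∃ T : ℝ, 0 ≤ T ∧ ∀ n, ∀ᵐ ω ∂μ n,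
      (∀ i j l, |M.H n j l ω - ∑ a, taylorWeight e a *
        partialDeriv A (e.toEquiv a) (M.η n l ω) (M.α n i ω) *
        monomialVec e (M.α n j ω - M.α n i ω) a| ≤ T * ‖M.α n j ω - M.α n i ω‖ ^ m) ∧
      (∀ i l a, |partialDeriv A (e.toEquiv a) (M.η n l ω) (M.α n i ω)| ≤ B) := by
  obtain ⟨B, hB⟩ := hreg.bounded
  have hint := hreg.interior_nonempty M
  have hcl : A ⊆ closure (interior A) := by
    rw [hreg.convex.closure_interior_eq_closure_of_nonempty_interior hint]
    exact subset_closure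
  refine ⟨max B 1, by positivity, r ^ m * max B 1, by positivity, fun n => ?_⟩
  filter_upwards [hreg.ae_mem M n, ae_all_iff.2 fun l => hreg.smooth n l,
    ae_all_iff.2 fun l => hB n l] with ω hα hsm hb
  refine ⟨fun i j l => ?_, fun i l a => ?_⟩
  · have := abs_sub_taylor_le hreg.convex (uniqueDiffOn_convex hreg.convex hint) hcl (hsm l)
      (B := max B 1) (fun x hx q hq => (hb l x hx q hq).trans (le_max_left _ _))
      (m := m - 1) (by omega) e (hα i) (hα j)
    rwa [Nat.sub_add_cancel hm] at this
  · refine (hb l _ (hα i) _ ((e.toEquiv a).2.trans (by omega))).trans (le_max_left _ _)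

/-- Without rows the derivative Gram matrix vanishes, so the eigenvalue bound fails with probability
one. -/
theorem eventually_card_Rddag_pos [∀ n, IsProbabilityMeasure (μ n)] {e : GradedEnum r (m - 1)} {c : ℝ} (hc : 0 < c)
    (hgram : WPA1 μ fun n => {ω | ∀ i, c ≤ sMin (M.derivGram A e n i ω)}) :
    ∀ᶠ n in atTop, 0 < (M.Rddag n).card := by
  filter_upwards [hgram.eventually_le (δ := 1 / 2) (by simp), eventually_gt_atTop 0]
    with n hn hn0
  by_contra hcard
  have hempty : M.Rddag n = ∅ := Finset.card_eq_zero.1 (by omega)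
  have hset : {ω | ∀ i, c ≤ sMin (M.derivGram A e n i ω)}ᶜ = Set.univ := by
    refine Set.eq_univ_of_forall fun ω hω => ?_
    have h1 := hω ⟨0, hn0⟩
    have hd : 0 < (m - 1 + r).choose r := Nat.choose_pos (by omega)
    have h2 := sMin_sq_mul_le (M.derivGram A e n ⟨0, hn0⟩ ω) 1
    have h0 : M.derivGram A e n ⟨0, hn0⟩ ω = 0 := by
      rw [derivGram, hempty, Finset.sum_empty, smul_zero]
    have h3 : 0 < sMin (M.derivGram A e n ⟨0, hn0⟩ ω) := hc.trans_le h1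
    have hdR : (0 : ℝ) < ((m - 1 + r).choose r : ℕ) := by exact_mod_cast hd
    have h4 : 0 < sMin (M.derivGram A e n ⟨0, hn0⟩ ω) ^ 2 * ((m - 1 + r).choose r : ℕ) := by
      positivity
    rw [h0] at h2 h4
    simp only [Pi.one_apply, one_pow, Finset.sum_const, Finset.card_univ, Fintype.card_fin,
      nsmul_eq_mul, mul_one, Matrix.zero_mulVec, Pi.zero_apply, ne_eq, OfNat.ofNat_ne_zero,
      not_false_eq_true, zero_pow, mul_zero] at h2
    linarith
  rw [hset, measure_univ] at hn
  norm_num at hn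

/-- As `h ≤ 1`, eventually `δ_n⁻¹ ≤ 1/3`, that is `K ∧ p ≥ 9 log (n ∨ p)`. Hence `K / 4 ≥ 2 log n`,
and the product is at most `1 / n`. -/
theorem tendsto_mul_exp_of_delta {h : ℕ → ℝ} (hnn : ∀ n, 0 < n → 0 < h n ∧ h n ≤ 1)
    (hp : ∀ᶠ n in atTop, 0 < M.p n)
    (hK : ∀ n, 0 < n → 1 ≤ K n)
    (hδ : Tendsto (fun n => (M.delta K n)⁻¹ / h n ^ (m - 1)) atTop (𝓝 0)) :
    Tendsto (fun n : ℕ => (n : ℝ) * Real.exp (-((K n : ℝ) / 4))) atTop (𝓝 0) := by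
  refine squeeze_zero' (Eventually.of_forall fun n => by positivity) ?_
    tendsto_inv_atTop_nhds_zero_nat
  filter_upwards [hp, eventually_gt_atTop 1,
    (tendsto_order.1 hδ).2 (1 / 3) (by norm_num)] with n hpn hn hd
  obtain ⟨h0, h1⟩ := hnn n (by omega)
  have hnR : (1 : ℝ) < n := by exact_mod_cast hn
  have hlog0 : 0 < Real.log n := Real.log_pos hnR
  have hlog : Real.log n ≤ Real.log (max n (M.p n) : ℕ) :=
    Real.log_le_log (by linarith) (by exact_mod_cast le_max_left _ _)
  -- Positivity of `p` matters: for `p = 0` the inverse of `δ_n` would be `0` by convention and the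
  -- hypothesis would carry no information.
  have hmin : 0 < min (K n) (M.p n) := lt_min (hK n (by omega)) hpn
  have hminR : (0 : ℝ) < (min (K n) (M.p n) : ℕ) := by exact_mod_cast hmin
  have hd' : (M.delta K n)⁻¹ ≤ 1 / 3 := by
    refine le_trans ?_ hd.le
    refine le_div_self (inv_nonneg.2 ?_) (pow_pos h0 _) (pow_le_one₀ h0.le h1)
    exact div_nonneg (Real.sqrt_nonneg _) (Real.sqrt_nonneg _)
  have h8 : 9 * Real.log (max n (M.p n) : ℕ) ≤ (min (K n) (M.p n) : ℕ) := by
    rw [delta, inv_div, div_le_iff₀ (Real.sqrt_pos.2 hminR)] at hd'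
    have h2 : (3 * √(Real.log (max n (M.p n) : ℕ))) ^ 2 ≤ √(min (K n) (M.p n) : ℕ) ^ 2 :=
      pow_le_pow_left₀ (by positivity) (by linarith) 2
    rw [mul_pow, Real.sq_sqrt (by linarith), Real.sq_sqrt hminR.le] at h2
    linarith
  have hKmin : ((min (K n) (M.p n) : ℕ) : ℝ) ≤ K n := by exact_mod_cast min_le_left _ _
  calc (n : ℝ) * Real.exp (-((K n : ℝ) / 4))
      ≤ n * Real.exp (-(2 * Real.log n)) := by gcongr; linarith
    _ = (n : ℝ)⁻¹ := by
      rw [Real.exp_neg, two_mul, Real.exp_add, Real.exp_log (by linarith)]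
      field_simp

theorem Regularities.exists_localSampling [∀ n, IsProbabilityMeasure (μ n)]
    (hreg : M.Regularities μ A mbar) (hr : 1 ≤ r) (hnn : M.IsNearestNeighbors K ρ nn)
    {ς : ℝ} (hς : 0 < ς) (hKn : Tendsto (fun n => (K n : ℝ) / (n : ℝ)) atTop (𝓝 0))
    (hexp : Tendsto (fun n : ℕ => (n : ℝ) * Real.exp (-((K n : ℝ) / 4))) atTop (𝓝 0)) :
    ∃ ν : Measure (EuclideanSpace ℝ (Fin r)), IsProbabilityMeasure ν ∧
      LocalSampling μ M.α A ν K (bandwidth K ς ς r) := by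
  obtain ⟨f, c, C, -, hc, hf, hlaw⟩ := hreg.density
  have hν : IsProbabilityMeasure
      ((volume.restrict A).withDensity fun x => ENNReal.ofReal (f x)) := by
    rw [← hlaw 1 0]
    exact Measure.isProbabilityMeasure_map (M.measurable_α 1 0).aemeasurable
  refine ⟨_, hν, M.measurable_α, hreg.indep, hlaw, ⟨max C 1, by positivity, fun S hS => ?_⟩,
    exists_measure_closedBall_ge hreg.compact hreg.convex hc (fun x hx => (hf x hx).1) rfl,
    fun n hn => hnn.one_le hn, fun n hn => hnn.bandwidth_pos ς ς hn,
    fun n _ => bandwidth_pow hς hr n, tendsto_bandwidth hς hr hKn, hexp⟩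
  exact withDensity_restrict_le hreg.compact.measurableSet
    (fun x hx => (hf x hx).2.trans (le_max_left _ _)) hS

end FactorArray

theorem measure_not_le_of_ae_imp {α : Type*} {mα : MeasurableSpace α} {μ : Measure α} {δ : ℝ≥0∞}
    {P : α → Prop} {S₁ S₂ S₃ S₄ S₅ S₆ : Set α} (h₁ : μ S₁ ≤ δ) (h₂ : μ S₂ ≤ δ) (h₃ : μ S₃ ≤ δ)
    (h₄ : μ S₄ ≤ δ) (h₅ : μ S₅ ≤ δ) (h₆ : μ S₆ ≤ δ)
    (h : ∀ᵐ x ∂μ, x ∉ S₁ → x ∉ S₂ → x ∉ S₃ → x ∉ S₄ → x ∉ S₅ → x ∉ S₆ → P x) :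
    μ {x | ¬ P x} ≤ 6 * δ := by
  have key : ∀ᵐ x ∂μ, x ∈ {x | ¬ P x} → x ∈ S₁ ∪ (S₂ ∪ (S₃ ∪ (S₄ ∪ (S₅ ∪ S₆)))) := by
    filter_upwards [h] with x hx hP
    by_contra hbad
    simp only [Set.mem_union, not_or] at hbad
    obtain ⟨g₁, g₂, g₃, g₄, g₅, g₆⟩ := hbad
    exact hP (hx g₁ g₂ g₃ g₄ g₅ g₆)
  refine (measure_mono_ae key).trans ?_
  calc _ ≤ δ + (δ + (δ + (δ + (δ + δ)))) :=
        (measure_union_le _ _).trans (add_le_add h₁ ((measure_union_le _ _).trans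
          (add_le_add h₂ ((measure_union_le _ _).trans (add_le_add h₃
          ((measure_union_le _ _).trans (add_le_add h₄ ((measure_union_le _ _).trans
          (add_le_add h₅ h₆)))))))))
    _ = 6 * δ := by ring

/-! ### The high-probability event -/

namespace FactorArray

variable {Ω : ℕ → Type*} [∀ n, MeasurableSpace (Ω n)] {r : ℕ} (M : FactorArray Ω r)
  {A : Set (EuclideanSpace ℝ (Fin r))} {μ : ∀ n, Measure (Ω n)} {mbar : ℕ}
  {K : ℕ → ℕ} {ρ : ∀ n, M.MatchData n → Fin n → Fin n → ℝ}
  {nn : ∀ n, M.MatchData n → Fin n → Fin (K n) → Fin n} {m : ℕ}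

theorem IndirectMatching.eventually_le_bandwidth {M : FactorArray Ω r}
    {ρ : ∀ n, M.MatchData n → Fin n → Fin n → ℝ} {ρ₀ ς ςup : ℝ} {a h : ℕ → ℝ}
    (hmatch : M.IndirectMatching μ ρ ρ₀ ς ςup a) (hh : ∀ᶠ n in atTop, 0 < h n)
    (ha : (fun n => a n ^ (1 / ς)) =o[atTop] h) : ∀ᶠ n in atTop, a n ≤ h n ^ ς := by
  filter_upwards [ha.bound one_pos, hmatch.a_pos, hh] with n hn han hhn
  rw [one_mul, Real.norm_of_nonneg (by positivity), Real.norm_of_nonneg hhn.le] at hn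
  have := Real.rpow_le_rpow (by positivity) hn hmatch.lo_pos.le
  rwa [← Real.rpow_mul han.le, one_div, inv_mul_cancel₀ hmatch.lo_pos.ne', Real.rpow_one] at this

/-- With probability arbitrarily close to one, the bounds of the local-approximation condition
hold with a fixed constant. -/
theorem exists_eventually_localFit [∀ n, IsProbabilityMeasure (μ n)] (hr : 1 ≤ r)
    (hreg : M.Regularities μ A mbar) (hnn : M.IsNearestNeighbors K ρ nn) {ρ₀ ς : ℝ} {a : ℕ → ℝ}
    (hmatch : M.IndirectMatching μ ρ ρ₀ ς ς a) (hm : 1 ≤ m) (hmbar : m ≤ mbar)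
    (e : GradedEnum r (m - 1)) {c₀ : ℝ} (hc₀ : 0 < c₀)
    (hgram : WPA1 μ fun n => {ω | ∀ i, c₀ ≤ sMin (M.derivGram A e n i ω)})
    (hKn : Tendsto (fun n => (K n : ℝ) / (n : ℝ)) atTop (𝓝 0))
    (hδ : Tendsto (fun n => (M.delta K n)⁻¹ / bandwidth K ς ς r n ^ (m - 1)) atTop (𝓝 0))
    (ha : (fun n => a n ^ (1 / ς)) =o[atTop] bandwidth K ς ς r) {δ : ℝ≥0∞} (hδ0 : 0 < δ) :
    ∃ E > (0 : ℝ), ∀ᶠ n in atTop,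
      μ n {ω | ¬ M.LocalFit μ A nn e (bandwidth K ς ς r n) E n ω} ≤ δ := by
  have hς := hmatch.lo_pos
  have hcard := M.eventually_card_Rddag_pos hc₀ hgram
  have hp : ∀ᶠ n in atTop, 0 < M.p n := hcard.mono fun n hn => by
    obtain ⟨l, -⟩ := Finset.card_pos.1 hn
    exact l.pos
  have hexp := M.tendsto_mul_exp_of_delta (m := m)
    (fun n hn => ⟨hnn.bandwidth_pos ς ς hn, hnn.bandwidth_le_one hς hn⟩) hp
    (fun n hn => hnn.one_le hn) hδ
  obtain ⟨ν, hν, hsamp⟩ := hreg.exists_localSampling M hr hnn hς hKn hexp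
  have hbpos : ∀ᶠ n in atTop, 0 < bandwidth K ς ς r n :=
    (eventually_gt_atTop 0).mono fun n hn => hnn.bandwidth_pos ς ς hn
  have hah := hmatch.eventually_le_bandwidth hbpos ha
  -- Six events may fail: the three matching bounds, the two uniform counts, and the derivative Gram
  -- bound. All other properties used hold almost surely.
  obtain ⟨δ', hδ', hsum⟩ : ∃ δ' : ℝ≥0∞, 0 < δ' ∧ 6 * δ' = δ :=
    ⟨δ / 6, ENNReal.div_pos hδ0.ne' (by simp), ENNReal.mul_div_cancel (by simp) (by simp)⟩
  obtain ⟨C₁, hC₁, hden⟩ := hmatch.denoise.exists_eventually_le hδ'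
  obtain ⟨C₂, hC₂, hup⟩ := hmatch.upper.exists_eventually_le hδ'
  obtain ⟨C₃, hC₃, hlo⟩ := hmatch.lower.exists_eventually_le hδ'
  obtain ⟨D, hD, hcount⟩ := hsamp.wpa1_lt_countIn hr
  -- The constants are chosen in the order matching constants and `D`, then `C`, then `ε`, then `E`,
  -- so nothing is circular. `C₃⁻¹` appears because the lower matching bound reads `1 < C₃ * inf`.
  obtain ⟨C, hC, hCeq⟩ : ∃ C : ℝ, 0 ≤ C ∧
      C = ((C₂ * D ^ ς + 2 * C₁) / C₃⁻¹ + 1) ^ (1 / ς) := ⟨_, by positivity, rfl⟩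
  obtain ⟨ε, hε, hsub⟩ := hsamp.wpa1_countIn_sublevel_lt e C
  obtain ⟨B, hB, T, hT, htay⟩ := hreg.ae_abs_sub_taylor_le M hm hmbar e
  obtain ⟨E, hE, h₀, hh₀, hfit⟩ := M.exists_localFit (A := A) (μ := μ) nn hnn.injective hm e
    hB hT hC hε hc₀
  refine ⟨E, hE, ?_⟩
  filter_upwards [hcard, hbpos, hah, hden, hup, hlo, hcount.eventually_le hδ',
    hsub.eventually_le hδ', hgram.eventually_le hδ', eventually_gt_atTop 0,
    (tendsto_order.1 (tendsto_bandwidth hς hr hKn)).2 h₀ hh₀]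
    with n hcard hh hah h1 h2 h3 h4 h5 h6 hn hhle
  rw [← hsum]
  refine measure_not_le_of_ae_imp h1 h2 h3 h4 h5 h6 ?_
  filter_upwards [hreg.ae_mem M n, hreg.ae_ne M hr n, htay n,
    hreg.ae_condExpMat_gram M hnn e n, hreg.ae_condExpMat_Hloc_mul M hnn e n]
    with ω hα hne htay hce1 hce2 g1 g2 g3 g4 g5 g6
  refine hfit _ hh hhle.le n (hnn.one_le hn) hcard ω hα htay.1 htay.2 hce1 hce2 ?_
    (Set.notMem_compl_iff.1 g5) (Set.notMem_compl_iff.1 g6)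
  rw [hCeq]
  refine M.norm_nbr_sub_le (ρ₀ := ρ₀) hnn hς hC₁.le hC₂.le (inv_pos.2 hC₃) hD hh hah hne
    (fun i j hij => ?_) (fun i j hij => ?_) (fun i j hij => ?_)
    (fun i => Set.notMem_compl_iff.1 g4 _ (hα i))
  · refine le_trans ?_ (le_trans (le_abs_self _) (not_le.1 g1).le)
    exact le_ciSup (f := fun ij : {ij : Fin n × Fin n // ij.1 ≠ ij.2} =>
      |ρ n (M.Xdag n ω) ij.1.1 ij.1.2 - ρ n (M.Hdag n ω) ij.1.1 ij.1.2 - ρ₀|)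
      (Set.finite_range _).bddAbove ⟨(i, j), hij⟩
  · refine le_trans ?_ (le_trans (le_abs_self _) ((not_le.1 g2).le.trans_eq (mul_one _)))
    exact le_ciSup (f := fun ij : {ij : Fin n × Fin n // M.α n ij.1 ω ≠ M.α n ij.2 ω} =>
      ρ n (M.Hdag n ω) ij.1.1 ij.1.2 / ‖M.α n ij.1.1 ω - M.α n ij.1.2 ω‖ ^ ς)
      (Set.finite_range _).bddAbove ⟨(i, j), hne i j hij⟩
  · have h7 := ciInf_le (f := fun ij : {ij : Fin n × Fin n // M.α n ij.1 ω ≠ M.α n ij.2 ω} =>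
      ρ n (M.Hdag n ω) ij.1.1 ij.1.2 / ‖M.α n ij.1.1 ω - M.α n ij.1.2 ω‖ ^ ς)
      (Set.finite_range _).bddBelow ⟨(i, j), hne i j hij⟩
    have h8 := not_le.1 g3
    rw [abs_one] at h8
    refine le_trans ?_ h7
    rw [inv_le_iff_one_le_mul₀' hC₃]
    exact h8.le

end FactorArray

/-! ### From uniform bounds to stochastic orders -/

theorem sMin_nonneg {a b : ℕ} (A : Matrix (Fin a) (Fin b) ℝ) : 0 ≤ sMin A :=
  LinearMap.singularValues_nonneg _ _

theorem sMax_nonneg {a b : ℕ} (A : Matrix (Fin a) (Fin b) ℝ) : 0 ≤ sMax A :=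
  LinearMap.singularValues_nonneg _ _

section UniformBounds

variable {Ω : ℕ → Type*} [∀ n, MeasurableSpace (Ω n)] {μ : ∀ n, Measure (Ω n)}
  {P : ℝ → ∀ n, Ω n → Prop} {f : ∀ n, Ω n → Fin n → ℝ}

theorem WPA1.of_forall_exists {S : ∀ n, Set (Ω n)}
    (hP : ∀ δ : ℝ≥0∞, 0 < δ → ∃ E > (0 : ℝ), ∀ᶠ n in atTop, μ n {ω | ¬ P E n ω} ≤ δ)
    (hS : ∀ E n ω, P E n ω → ω ∈ S n) : WPA1 μ S := by
  refine ENNReal.tendsto_nhds_zero.2 fun δ hδ => ?_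
  obtain ⟨E, -, hE⟩ := hP δ hδ
  filter_upwards [hE] with n hn
  refine le_trans (measure_mono ?_) hn
  exact fun ω hω hω' => hω (hS E n ω hω')

/-- Doubling the constant makes the bound strict, since the event in `StochLE` contains the case of
equality; this needs `b n > 0`, hence the eventual positivity. -/
theorem StochLE.iSup_le {b : ℕ → ℝ} (hb : ∀ n, 0 ≤ b n) (hb' : ∀ᶠ n in atTop, 0 < b n)
    (hP : ∀ δ : ℝ≥0∞, 0 < δ → ∃ E > (0 : ℝ), ∀ᶠ n in atTop, μ n {ω | ¬ P E n ω} ≤ δ)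
    (hf0 : ∀ n ω i, 0 ≤ f n ω i) (hf : ∀ E n ω, P E n ω → ∀ i, f n ω i ≤ E * b n) :
    StochLE μ (fun n ω => ⨆ i, f n ω i) (fun n _ => b n) := by
  refine StochLE.of_forall_exists (fun n _ => hb n) fun δ hδ => ?_
  obtain ⟨E, hE, hev⟩ := hP δ hδ
  refine ⟨2 * E, ?_⟩
  filter_upwards [hev, hb'] with n hn hbn
  refine (measure_mono fun ω hω hω' => ?_).trans hn
  have h1 : ⨆ i, f n ω i ≤ E * b n := Real.iSup_le (hf E n ω hω') (by positivity)
  have h2 : 2 * E * b n ≤ |⨆ i, f n ω i| := hω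
  rw [abs_of_nonneg (Real.iSup_nonneg (hf0 n ω))] at h2
  have h3 : 0 < E * b n := by positivity
  linarith

theorem StochLE.le_iInf
    (hP : ∀ δ : ℝ≥0∞, 0 < δ → ∃ E > (0 : ℝ), ∀ᶠ n in atTop, μ n {ω | ¬ P E n ω} ≤ δ)
    (hf0 : ∀ n ω i, 0 ≤ f n ω i) (hf : ∀ E n ω, P E n ω → ∀ i, E⁻¹ ≤ f n ω i) :
    StochLE μ (fun _ _ => 1) (fun n ω => ⨅ i, f n ω i) := by
  refine StochLE.of_forall_exists (fun n ω => Real.iInf_nonneg (hf0 n ω)) fun δ hδ => ?_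
  obtain ⟨E, hE, hev⟩ := hP δ hδ
  refine ⟨2 * E, ?_⟩
  filter_upwards [hev, eventually_gt_atTop 0] with n hn hn0
  refine (measure_mono fun ω hω hω' => ?_).trans hn
  -- Over no units the infimum would be `0` by convention, which is why `n > 0` is required.
  have : Nonempty (Fin n) := ⟨⟨0, hn0⟩⟩
  have h1 : E⁻¹ ≤ ⨅ i, f n ω i := le_ciInf (hf E n ω hω')
  have h2 : 2 * E * ⨅ i, f n ω i ≤ |1| := hω
  rw [abs_one] at h2
  have h3 : 2 * E * E⁻¹ ≤ 2 * E * ⨅ i, f n ω i := by gcongr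
  rw [mul_assoc, mul_inv_cancel₀ hE.ne'] at h3
  linarith

end UniformBounds

/-! ### The theorem -/

theorem mainTheorem8 {Ω : ℕ → Type*} [∀ n, MeasurableSpace (Ω n)]
    (μ : ∀ n, Measure (Ω n)) [∀ n, IsProbabilityMeasure (μ n)]
    {r : ℕ} (hr : 1 ≤ r) (M : FactorArray Ω r) (hsplit : M.BalancedSplit)
    (A : Set (EuclideanSpace ℝ (Fin r))) (mbar : ℕ) (hreg : M.Regularities μ A mbar)
    (K : ℕ → ℕ) (ρ : ∀ n, M.MatchData n → Fin n → Fin n → ℝ)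
    (hρ : ∀ n i j, Measurable fun V => ρ n V i j)
    (nn : ∀ n, M.MatchData n → Fin n → Fin (K n) → Fin n)
    (hnn : M.IsNearestNeighbors K ρ nn)
    (ρ₀ ςlo ςup : ℝ) (a : ℕ → ℝ) (hmatch : M.IndirectMatching μ ρ ρ₀ ςlo ςup a)
    (m : ℕ) (hm : 1 ≤ m) (hmbar : m ≤ mbar) (e : GradedEnum r (m - 1))
    (hgram : ∃ c : ℝ, 0 < c ∧
      WPA1 μ fun n => {ω | ∀ i, c ≤ sMin (M.derivGram A e n i ω)})
    (hKn : Tendsto (fun n => (K n : ℝ) / (n : ℝ)) atTop (𝓝 0))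
    (hδ : Tendsto (fun n => (M.delta K n)⁻¹ / bandwidth K ςlo ςup r n ^ (m - 1)) atTop (𝓝 0))
    (ha : (fun n => a n ^ (1 / ςlo)) =o[atTop] bandwidth K ςlo ςup r)
    (hς : ςup = ςlo) :
    M.LocalApproximation μ A nn (bandwidth K ςlo ςup r) m
      (fun _ _ => (m - 1 + r).choose r)
      (fun n i ω => M.monomialLoadings nn e n i ω)
      (fun n _ b => bandwidth K ςlo ςup r n ^ e.deg b) := by
  subst hς
  obtain ⟨c₀, hc₀, hgram⟩ := hgram
  have hς := hmatch.lo_pos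
  have hfit : ∀ δ : ℝ≥0∞, 0 < δ → ∃ E > (0 : ℝ), ∀ᶠ n in atTop,
      μ n {ω | ¬ M.LocalFit μ A nn e (bandwidth K ςup ςup r n) E n ω} ≤ δ := fun δ hδ0 =>
    M.exists_eventually_localFit hr hreg hnn hmatch hm hmbar e hc₀ hgram hKn hδ ha hδ0
  have hpos : ∀ n, 0 < n → 0 < bandwidth K ςup ςup r n := fun n hn => hnn.bandwidth_pos ςup ςup hn
  have hle : ∀ n, 0 < n → bandwidth K ςup ςup r n ≤ 1 := fun n hn => hnn.bandwidth_le_one hς hn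
  have hlim := tendsto_bandwidth hς hr hKn
  have h0 : ∀ n, 0 ≤ bandwidth K ςup ςup r n := fun n => by rw [bandwidth]; positivity
  have hdeg : ∀ n, 0 < n → ∀ j, bandwidth K ςup ςup r n ^ (m - 1) ≤
      bandwidth K ςup ςup r n ^ e.deg j := fun n hn j =>
    pow_le_pow_of_le_one (h0 n) (hle n hn) (e.deg_le j)
  refine
    { integrable_HΛ := fun n i l b => hreg.integrable_Hloc_mul M hnn e n i l b
      integrable_ΛΛ := fun n i a b => hreg.integrable_loadings_gram M hnn e n i a b
      invertible := WPA1.of_forall_exists hfit fun _ _ _ h => h.invertible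
      d_pos := fun _ _ => Nat.choose_pos (by omega)
      scale_pos := fun n i j => pow_pos (hpos n i.pos) _
      scale_anti := fun n i j k hjk => pow_le_pow_of_le_one (h0 n) (hle n i.pos) (e.mono hjk)
      loadings_max := StochLE.iSup_le (fun _ => zero_le_one) (.of_forall fun _ => one_pos) hfit
        (fun _ _ _ => matMaxNorm_nonneg _) fun _ _ _ h i => by
          rw [mul_one]; exact h.loadings_max i
      loadings_min := StochLE.le_iInf hfit (fun _ _ _ => sMin_nonneg _)
        fun _ _ _ h => h.loadings_min
      loadings_sup := StochLE.iSup_le (fun _ => zero_le_one) (.of_forall fun _ => one_pos) hfit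
        (fun _ _ _ => sMax_nonneg _) fun _ _ _ h i => by
          rw [mul_one]; exact h.loadings_sup i
      scale_ratio := fun j => ?_
      bias := StochLE.iSup_le (fun n => pow_nonneg (h0 n) m)
        ((eventually_gt_atTop 0).mono fun n hn => pow_pos (hpos n hn) m) hfit
        (fun _ _ _ => matMaxNorm_nonneg _) fun _ _ _ h => h.bias
      bias_small := fun ε hε => ?_
      noise_small := fun ε hε => ?_
      factors_min := StochLE.le_iInf hfit (fun _ _ _ => sMin_nonneg _)
        fun _ _ _ h => h.factors_min
      factors_sup := StochLE.iSup_le (fun _ => zero_le_one) (.of_forall fun _ => one_pos) hfit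
        (fun _ _ _ => sMax_nonneg _) fun _ _ _ h i => by
          rw [mul_one]; exact h.factors_sup i }
  · by_cases hj : ∃ hj : j + 1 < (m - 1 + r).choose r,
        e.deg ⟨j, Nat.lt_of_succ_lt hj⟩ < e.deg ⟨j + 1, hj⟩
    · obtain ⟨hj, hlt⟩ := hj
      refine ⟨∅, ⟨0, .of_forall fun _ _ _ h => h.elim⟩, fun C => ?_⟩
      -- The maximum with `1` keeps the threshold positive when `C ≤ 0`.
      filter_upwards [(tendsto_order.1 hlim).2 (max C 1)⁻¹ (by positivity)] with n hn i _ _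
      have hb := hpos n i.pos
      rw [le_div_iff₀ (pow_pos hb _)]
      have h1 : C * bandwidth K ςup ςup r n ≤ 1 := by
        have h2 : max C 1 * bandwidth K ςup ςup r n ≤ max C 1 * (max C 1)⁻¹ := by gcongr
        rw [mul_inv_cancel₀ (by positivity)] at h2
        exact le_trans (by gcongr; exact le_max_left _ _) h2
      by_cases hC : 0 ≤ C
      · calc C * bandwidth K ςup ςup r n ^ e.deg ⟨j + 1, hj⟩
            ≤ C * bandwidth K ςup ςup r n ^ (e.deg ⟨j, Nat.lt_of_succ_lt hj⟩ + 1) :=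
              mul_le_mul_of_nonneg_left
                (pow_le_pow_of_le_one hb.le (hle n i.pos) hlt) hC
          _ = (C * bandwidth K ςup ςup r n) *
                bandwidth K ςup ςup r n ^ e.deg ⟨j, Nat.lt_of_succ_lt hj⟩ := by ring
          _ ≤ 1 * bandwidth K ςup ςup r n ^ e.deg ⟨j, Nat.lt_of_succ_lt hj⟩ := by gcongr
          _ = _ := one_mul _
      · exact (mul_nonpos_of_nonpos_of_nonneg (not_le.1 hC).le (pow_pos hb _).le).trans
          (pow_pos hb _).le
    · refine ⟨Set.univ, ⟨1, .of_forall fun n i hj' _ => ?_⟩, fun C => .of_forall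
        fun _ _ _ h => (h (Set.mem_univ _)).elim⟩
      have hle' : e.deg ⟨j + 1, hj'⟩ ≤ e.deg ⟨j, Nat.lt_of_succ_lt hj'⟩ :=
        not_lt.1 fun h => hj ⟨hj', h⟩
      rw [div_le_one (pow_pos (hpos n i.pos) _)]
      exact pow_le_pow_of_le_one (h0 n) (hle n i.pos) hle'
  -- One factor `h ≤ ε` is split off, and `h^(m-1)` is below every scale.
  · filter_upwards [(tendsto_order.1 hlim).2 ε hε] with n hn i j _
    calc bandwidth K ςup ςup r n ^ m
        = bandwidth K ςup ςup r n * bandwidth K ςup ςup r n ^ (m - 1) := by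
          rw [← pow_succ', Nat.sub_add_cancel hm]
      _ ≤ ε * bandwidth K ςup ςup r n ^ e.deg j :=
          mul_le_mul hn.le (hdeg n i.pos j) (pow_nonneg (h0 n) _) hε.le
  · filter_upwards [(tendsto_order.1 hδ).2 ε hε] with n hn i j _
    refine le_trans ?_ hn.le
    refine div_le_div_of_nonneg_left (inv_nonneg.2 ?_) (pow_pos (hpos n i.pos) _)
      (hdeg n i.pos j)
    exact div_nonneg (Real.sqrt_nonneg _) (Real.sqrt_nonneg _)
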